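/- Let $K$ be an algebraically closed field of characteristic $0$. Let $H$ be the Hopf algebra $\mathrm{B}(V)\#K[S_3]$, where $\mathrm{B}(V)$ is the Fomin–Kirillov algebra $FK_3$: as an algebra $H$ is generated by $e_g$ ($g\in S_3$) and $a,b,c$ with relations $$e_ge_h=\delta_{g,h}e_g,\quad \sum_g e_g=1,\quad e_ga=ae_{(12)g},\quad e_gb=be_{(23)g},\quad e_gc=ce_{(13)g},$$ $$a^2=b^2=c^2=0,\quad ab+bc+ca=0,\quad ac+cb+ba=0,$$ its counit is $\epsilon(e_g)=\delta_{g,1}$, $\epsilon(a)=\epsilon(b)=\epsilon(c)=0$, and its comultiplication is given by $\Delta(e_g)=\sum_{kl=g}e_k\otimes e_l$ and $$\Delta(a) = a\otimes 1 + (e_1-e_{(12)})\otimes a + (e_{(132)}-e_{(13)})\otimes b + (e_{(123)}-e_{(23)})\otimes c,$$ $$\Delta(b) = b\otimes 1 + (e_1-e_{(23)})\otimes b + (e_{(132)}-e_{(12)})\otimes c + (e_{(123)}-e_{(13)})\otimes a,$$ $$\Delta(c) = c\otimes 1 + (e_1-e_{(13)})\otimes c + (e_{(132)}-e_{(23)})\otimes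 a + (e_{(123)}-e_{(12)})\otimes b$$ (permutations are composed as functions, from right to left). A 2-cocycle on $H$ is a convolution invertible linear map $\alpha:H\otimes H\to K$ with $\alpha(x_1,y_1)\alpha(x_2y_2,z)=\alpha(y_1,z_1)\alpha(x,y_2z_2)$ and $\alpha(1,x)=\alpha(x,1)=\epsilon(x)$. The cocycle deformation ${}^\alpha H$ is the right $H$-comodule algebra with underlying space $H$, multiplication $x\cdot_\alpha y=\alpha(x_1,y_1)x_2y_2$ and coaction $\Delta$; a cocycle deformation of $H$ is an algebra with a coaction of $H$ that is isomorphic to some ${}^\alpha H$. Two of them are equivalent if they are isomorphic as $H$-comodule algebras. Let $X_H$ be the set of equivalence classes. It is regarded as the quotient $Y_H/GL(W)$, where $W=K^n$, $n=\dim H$, and $Y_H$ is the set of triples $(m,T,A)$ of linear maps $m:W\otimes W\to W$, $T:W\otimes H\to W\otimes W$, $A:H^*\otimes W\to W$ that make $W$ a cocycle deformation with multiplication $m$, with coaction $\rho(w)=w_1\otimes w_2$ such that $A(f\otimes w)=w_1f(w_2)$, and with $T$ inverse to $x\otimes y\mapsto xy_1\otimes y_2$; a function on $X_H$ is regular if its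 pullback to $Y_H$ is the restriction of a polynomial function. For $\lambda=(\lambda_a,\lambda_b,\lambda_c)\in K^3$ let $W_\lambda$ be the algebra generated by $e_g$ ($g\in S_3$) and $w_a,w_b,w_c$ with relations $$e_ge_h=\delta_{g,h}e_g,\quad \sum_g e_g=1,\quad e_gw_a=w_ae_{(12)g},\quad e_gw_b=w_be_{(23)g},\quad e_gw_c=w_ce_{(13)g},$$ $$w_a^2=\lambda_a,\quad w_b^2=\lambda_b,\quad w_c^2=\lambda_c,\quad w_aw_b+w_bw_c+w_cw_a=w_aw_c+w_cw_b+w_bw_a=0,$$ and let $\rho:W_\lambda\to W_\lambda\otimes H$ be the algebra homomorphism given by $\rho(e_g)=\sum_{kl=g}e_k\otimes e_l$ and $$\rho(w_a) = w_a\otimes 1 + (e_1-e_{(12)})\otimes a + (e_{(132)}-e_{(13)})\otimes b + (e_{(123)}-e_{(23)})\otimes c,$$ $$\rho(w_b) = w_b\otimes 1 + (e_1-e_{(23)})\otimes b + (e_{(132)}-e_{(12)})\otimes c + (e_{(123)}-e_{(13)})\otimes a,$$ $$\rho(w_c) = w_c\otimes 1 + (e_1-e_{(13)})\otimes c + (e_{(132)}-e_{(23)})\otimes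 a + (e_{(123)}-e_{(12)})\otimes b.$$ Then: 1. Every cocycle deformation of $H$ is isomorphic, as an $H$-comodule algebra, to $W_\lambda$ for some $\lambda\in K^3$. 2. For every $\lambda\in K^3$, $W_\lambda$ is a cocycle deformation of $H$. 3. $W_\lambda$ and $W_\mu$ are isomorphic as $H$-comodule algebras if and only if $\mu$ is a permutation of $\lambda$. 4. Sending the class of ${}^\alpha H\cong W_\lambda$ to the $S_3$-orbit of $\lambda$ is a bijection $X_H\to\mathbb{A}^3/S_3$, and sending the orbit of $\lambda$ to $(\lambda_a+\lambda_b+\lambda_c,\ \lambda_a\lambda_b+\lambda_b\lambda_c+\lambda_c\lambda_a,\ \lambda_a\lambda_b\lambda_c)$ is a bijection $\mathbb{A}^3/S_3\to\mathbb{A}^3$. Both are isomorphisms of affine varieties: a function on the target is regular if and only if its pullback to the source is regular, where the regular functions on $\mathbb{A}^3/S_3$ are those whose pullback to $\mathbb{A}^3$ is a polynomial function. -/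

import Mathlib

open scoped TensorProduct

namespace FK

noncomputable section

/-! ### Comodule algebras and 2-cocycles over a bialgebra -/

section Cocycles

variable {K : Type*} [CommRing K] {H : Type*} [Ring H] [Bialgebra K H]

/-- The twisted multiplication `x ⊗ y ↦ α(x₁, y₁) x₂ y₂`. -/
def twistMul (α : H ⊗[K] H →ₗ[K] K) : H ⊗[K] H →ₗ[K] H :=
  (TensorProduct.lid K H).toLinearMap ∘ₗ
    TensorProduct.map α (LinearMap.mul' K H) ∘ₗ Coalgebra.comul

/-- A normalised Hopf 2-cocycle on `H`. Spelled out, the condition `cocycle` reads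
`α(x₁, y₁) α(x₂ y₂, z) = α(y₁, z₁) α(x, y₂ z₂)`. -/
structure IsTwoCocycle (α : H ⊗[K] H →ₗ[K] K) : Prop where
  isUnit_conv : IsUnit (WithConv.toConv α)
  cocycle : ∀ x y z : H, α (twistMul α (x ⊗ₜ y) ⊗ₜ z) = α (x ⊗ₜ twistMul α (y ⊗ₜ z))
  one_left : ∀ x : H, α (1 ⊗ₜ x) = Coalgebra.counit x
  one_right : ∀ x : H, α (x ⊗ₜ 1) = Coalgebra.counit x

/-- The algebra `W` with coaction `ρ` is isomorphic, as an algebra with a coaction of `H`, to the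
cocycle deformation `^αH`: the space `H` with unit `1`, multiplication `twistMul α` and coaction
the comultiplication of `H`. -/
def IsDeformationBy (α : H ⊗[K] H →ₗ[K] K) {W : Type*} [Ring W] [Algebra K W]
    (ρ : W →ₐ[K] W ⊗[K] H) : Prop :=
  ∃ φ : H ≃ₗ[K] W, φ 1 = 1 ∧ (∀ x y : H, φ (twistMul α (x ⊗ₜ y)) = φ x * φ y) ∧
    ∀ x : H, ρ (φ x) = φ.toLinearMap.rTensor H (Coalgebra.comul x)

/-- `(W, ρ)` is a cocycle deformation of `H`. -/
def IsCocycleDeformation {W : Type*} [Ring W] [Algebra K W] (ρ : W →ₐ[K] W ⊗[K] H) : Prop :=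
  ∃ α : H ⊗[K] H →ₗ[K] K, IsTwoCocycle α ∧ IsDeformationBy α ρ

/-- Isomorphism of algebras with a coaction of `H`. -/
def ComodAlgIso {W W' : Type*} [Ring W] [Algebra K W] [Ring W'] [Algebra K W']
    (ρ : W →ₐ[K] W ⊗[K] H) (ρ' : W' →ₐ[K] W' ⊗[K] H) : Prop :=
  ∃ φ : W ≃ₐ[K] W', ∀ w : W, ρ' (φ w) = φ.toLinearMap.rTensor H (ρ w)

variable (K H) in
/-- The set of 2-cocycles on `H`. -/
abbrev TwoCocycle : Type _ := {α : H ⊗[K] H →ₗ[K] K // IsTwoCocycle α}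

/-- `^αH` and `^βH` are isomorphic as `H`-comodule algebras. -/
def TwoCocycle.Equivalent (α β : TwoCocycle K H) : Prop :=
  ∃ φ : H ≃ₗ[K] H, φ 1 = 1 ∧
    (∀ x y : H, φ (twistMul α.1 (x ⊗ₜ y)) = twistMul β.1 (φ x ⊗ₜ φ y)) ∧
    ∀ x : H, Coalgebra.comul (φ x) = φ.toLinearMap.rTensor H (Coalgebra.comul x)

theorem TwoCocycle.equivalent_equivalence :
    Equivalence (TwoCocycle.Equivalent (K := K) (H := H)) where
  refl α := ⟨LinearEquiv.refl K H, by simp, by simp, by simp⟩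
  symm := by
    rintro α β ⟨φ, h1, hm, hc⟩
    refine ⟨φ.symm, φ.symm_apply_eq.2 h1.symm, fun x y => ?_, fun x => ?_⟩
    · rw [LinearEquiv.symm_apply_eq, hm]; simp
    · have := hc (φ.symm x)
      rw [LinearEquiv.apply_symm_apply] at this
      rw [this, ← LinearMap.comp_apply, ← LinearMap.rTensor_comp]
      simp
  trans := by
    rintro α β γ ⟨φ, h1, hm, hc⟩ ⟨ψ, h1', hm', hc'⟩
    refine ⟨φ.trans ψ, by simp [h1, h1'], fun x y => by simp [hm, hm'], fun x => ?_⟩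
    rw [LinearEquiv.trans_apply, hc', hc, ← LinearMap.comp_apply, ← LinearMap.rTensor_comp]
    rfl

variable (K H) in
/-- Two cocycles are identified if their cocycle deformations are isomorphic. -/
def twoCocycleSetoid : Setoid (TwoCocycle K H) where
  r := TwoCocycle.Equivalent
  iseqv := TwoCocycle.equivalent_equivalence

variable (K H) in
/-- The set `X_H` of equivalence classes of cocycle deformations of `H`. -/
abbrev Moduli : Type _ := Quotient (twoCocycleSetoid K H)

end Cocycles

/-! ### The variety structure on the set of equivalence classes -/

section Variety

/-- The polynomial functions on a vector space: the algebra generated by the linear forms. -/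
def polyFun (K V : Type*) [CommRing K] [AddCommGroup V] [Module K V] : Subalgebra K (V → K) :=
  Algebra.adjoin K (Set.range fun φ : Module.Dual K V => (φ : V → K))

variable (K : Type*) [CommRing K] (H : Type*) [Ring H] [Bialgebra K H]

/-- The space `K^n`, `n = dim H`, that carries the structures below. -/
abbrev Carrier : Type _ := Fin (Module.finrank K H) → K

/-- The space of triples `(m, T, A)`, where `m` is a multiplication on `W = K^n`, `T` is a map
`W ⊗ H → W ⊗ W` and `A` is a map `H^* ⊗ W → W`. -/
abbrev StructureSpace : Type _ :=
  (Carrier K H ⊗[K] Carrier K H →ₗ[K] Carrier K H) ×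
  (Carrier K H ⊗[K] H →ₗ[K] Carrier K H ⊗[K] Carrier K H) ×
  (Module.Dual K H ⊗[K] Carrier K H →ₗ[K] Carrier K H)

variable {K H}

/-- The map `M : W ⊗ W → W ⊗ H`, `x ⊗ y ↦ x y₁ ⊗ y₂`. -/
def galoisMap {W : Type*} [AddCommGroup W] [Module K W] (m : W ⊗[K] W →ₗ[K] W)
    (ρ : W →ₗ[K] W ⊗[K] H) : W ⊗[K] W →ₗ[K] W ⊗[K] H :=
  m.rTensor H ∘ₗ (TensorProduct.assoc K W W H).symm.toLinearMap ∘ₗ ρ.lTensor W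

/-- The coaction of `H` on a space `W` transported from the comultiplication along `φ`. -/
def transportCoaction {W : Type*} [AddCommGroup W] [Module K W] (φ : H ≃ₗ[K] W) :
    W →ₗ[K] W ⊗[K] H :=
  φ.toLinearMap.rTensor H ∘ₗ Coalgebra.comul ∘ₗ φ.symm.toLinearMap

/-- The triple `(m, T, A)` makes `W = K^n` a cocycle deformation of `H` isomorphic to `^αH`:
`m` is the multiplication, `A(f ⊗ w) = w₁ f(w₂)`, and `T` is the inverse of the map `M`. The
variety `Y_H` consists of the triples that present some 2-cocycle, and its orbits under `GL(W)`
are the fibres of the resulting map `Y_H → X_H`. -/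
def Presents (p : StructureSpace K H) (α : TwoCocycle K H) : Prop :=
  ∃ φ : H ≃ₗ[K] Carrier K H,
    (∀ x y : H, p.1 (φ x ⊗ₜ φ y) = φ (twistMul α.1 (x ⊗ₜ y))) ∧
    (∀ (f : Module.Dual K H) (w : Carrier K H), p.2.2 (f ⊗ₜ w) =
      TensorProduct.rid K (Carrier K H) (f.lTensor (Carrier K H) (transportCoaction φ w))) ∧
    p.2.1 ∘ₗ galoisMap p.1 (transportCoaction φ) = LinearMap.id ∧
    galoisMap p.1 (transportCoaction φ) ∘ₗ p.2.1 = LinearMap.id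

/-- The regular functions on `X_H = Y_H / GL(W)`: those whose pullback to `Y_H` is the
restriction of a polynomial function. -/
def Moduli.IsRegular (f : Moduli K H → K) : Prop :=
  ∃ F ∈ polyFun K (StructureSpace K H),
    ∀ (p : StructureSpace K H) (α : TwoCocycle K H), Presents p α → F p = f ⟦α⟧

end Variety

/-! ### The algebras `W_λ` -/

/-- The symmetric group on three letters, which are here `0, 1, 2`. -/
abbrev S3 : Type := Equiv.Perm (Fin 3)

/-- The transposition that fixes `i`. The generators `x_i` of `V` are indexed by the fixed letter
of the transposition that is their degree; the letters `0, 1, 2` stand for `1, 2, 3`, so that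
the generators `2`, `0`, `1` are `a`, `b`, `c`, of degrees `(12)`, `(23)`, `(13)`. The action of `S3` on `V`
is `g · x_i = sign(g) x_{g i}`. -/
def tr (i : Fin 3) : S3 := Equiv.swap (i + 1) (i + 2)

theorem tr_smul (g : S3) (i : Fin 3) : tr (g i) * g = g * tr i := by
  revert g i; decide

/-- `sign(g)` as an element of `K`. -/
def sgn (K : Type*) [CommRing K] (g : S3) : K := ((Equiv.Perm.sign g : ℤ) : K)

section Algebras

variable (K : Type*) [CommRing K]

/-- The free generators `e_g`, for `g` in `S3`, and `w_i`. -/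
abbrev Gen : Type := S3 ⊕ Fin 3

/-- The free generator `e_g`. -/
abbrev freeE (g : S3) : FreeAlgebra K Gen := FreeAlgebra.ι K (Sum.inl g)

/-- The free generator `w_i`. -/
abbrev freeX (i : Fin 3) : FreeAlgebra K Gen := FreeAlgebra.ι K (Sum.inr i)

/-- The defining relations of `W_λ`. As `a, b, c` are the generators `2, 0, 1`, the relations
`cyc` and `cyc'` are `bc + ca + ab = 0` and `cb + ac + ba = 0`. -/
inductive Rel (t : Fin 3 → K) : FreeAlgebra K Gen → FreeAlgebra K Gen → Prop
  | idem (g : S3) : Rel t (freeE K g * freeE K g) (freeE K g)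
  | orth (g h : S3) (hgh : g ≠ h) : Rel t (freeE K g * freeE K h) 0
  | sum : Rel t (∑ g, freeE K g) 1
  | comm (g : S3) (i : Fin 3) : Rel t (freeE K g * freeX K i) (freeX K i * freeE K (tr i * g))
  | sq (i : Fin 3) : Rel t (freeX K i * freeX K i) (algebraMap K _ (t i))
  | cyc : Rel t (∑ i, freeX K i * freeX K (i + 1)) 0
  | cyc' : Rel t (∑ i, freeX K (i + 1) * freeX K i) 0

/-- The algebra `W_λ`, with `λ = t`, presented by generators and relations. -/
def W (t : Fin 3 → K) : Type _ := RingQuot (Rel K t)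

variable (t : Fin 3 → K)

instance : Ring (W K t) := inferInstanceAs (Ring (RingQuot (Rel K t)))

instance : Algebra K (W K t) := inferInstanceAs (Algebra K (RingQuot (Rel K t)))

/-- The quotient map from the free algebra. -/
def mk : FreeAlgebra K Gen →ₐ[K] W K t := RingQuot.mkAlgHom K (Rel K t)

/-- The generator `e_g` of `W_λ`. -/
def e (g : S3) : W K t := mk K t (freeE K g)

/-- The generator `w_i` of `W_λ`. -/
def w (i : Fin 3) : W K t := mk K t (freeX K i)

variable {K t}

/-- Elements of an algebra that satisfy the defining relations of `W_λ`. -/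
structure IsRep (t : Fin 3 → K) {B : Type*} [Ring B] [Algebra K B] (E : S3 → B) (X : Fin 3 → B) :
    Prop where
  mul_e : ∀ g h, E g * E h = if g = h then E g else 0
  sum_e : ∑ g, E g = 1
  comm : ∀ g i, E g * X i = X i * E (tr i * g)
  sq : ∀ i, X i * X i = algebraMap K B (t i)
  cyc : ∑ i, X i * X (i + 1) = 0
  cyc' : ∑ i, X (i + 1) * X i = 0

theorem mk_rel {a b : FreeAlgebra K Gen} (h : Rel K t a b) : mk K t a = mk K t b :=
  RingQuot.mkAlgHom_rel K h

theorem isRep : IsRep t (e K t) (w K t) where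
  mul_e g h := by
    split_ifs with hgh
    · subst hgh
      simpa [e] using mk_rel (Rel.idem (t := t) g)
    · simpa [e] using mk_rel (Rel.orth (t := t) g h hgh)
  sum_e := by simpa [e] using mk_rel (Rel.sum (t := t))
  comm g i := by simpa [e, w] using mk_rel (Rel.comm (t := t) g i)
  sq i := by
    have := mk_rel (Rel.sq (t := t) i)
    rwa [map_mul, AlgHom.commutes] at this
  cyc := by
    have := mk_rel (Rel.cyc (t := t))
    simp only [map_sum, map_mul, map_zero] at this
    exact this
  cyc' := by
    have := mk_rel (Rel.cyc' (t := t))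
    simp only [map_sum, map_mul, map_zero] at this
    exact this

/-- The universal property of `W_λ`. -/
def lift {B : Type*} [Ring B] [Algebra K B] {E : S3 → B} {X : Fin 3 → B} (h : IsRep t E X) :
    W K t →ₐ[K] B :=
  RingQuot.liftAlgHom K ⟨FreeAlgebra.lift K (Sum.elim E X), by
    intro a b hab
    induction hab with
    | idem g => simp [h.mul_e]
    | orth g h' hgh => simp [h.mul_e, hgh]
    | sum => simp [h.sum_e]
    | comm g i => simp [h.comm]
    | sq i => simp [h.sq]
    | cyc => simpa using h.cyc
    | cyc' => simpa using h.cyc'⟩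

@[simp] theorem lift_e {B : Type*} [Ring B] [Algebra K B] {E : S3 → B} {X : Fin 3 → B}
    (h : IsRep t E X) (g : S3) : lift h (e K t g) = E g := by
  unfold lift e mk
  exact (RingQuot.liftAlgHom_mkAlgHom_apply K _ _ _).trans (by simp)

@[simp] theorem lift_x {B : Type*} [Ring B] [Algebra K B] {E : S3 → B} {X : Fin 3 → B}
    (h : IsRep t E X) (i : Fin 3) : lift h (w K t i) = X i := by
  unfold lift w mk
  exact (RingQuot.liftAlgHom_mkAlgHom_apply K _ _ _).trans (by simp)

theorem hom_ext {B : Type*} [Semiring B] [Algebra K B] {f g : W K t →ₐ[K] B}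
    (he : ∀ s, f (e K t s) = g (e K t s)) (hx : ∀ i, f (w K t i) = g (w K t i)) : f = g := by
  apply RingQuot.ringQuot_ext'
  apply FreeAlgebra.hom_ext
  funext s
  rcases s with s | i
  · exact he s
  · exact hx i

end Algebras

/-! ### The Hopf algebra `H` and its coaction on `W_λ` -/

section Coaction

variable (K : Type*) [CommRing K]

/-- The algebra `B(V) # K[S3]`: its defining relations are those of `W_λ` for `λ = 0`. -/
abbrev H : Type _ := W K (0 : Fin 3 → K)

variable (t : Fin 3 → K)

/-- The image of `e_g` under the coaction: the sum of all `e_k ⊗ e_l` with `k l = g`. -/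
def coE (g : S3) : W K t ⊗[K] H K := ∑ k : S3, e K t k ⊗ₜ[K] e K 0 (k⁻¹ * g)

/-- The sum over `g` of `e_g ⊗ (g⁻¹ · x_i)`. -/
def coQ (i : Fin 3) : W K t ⊗[K] H K := ∑ g : S3, sgn K g • (e K t g ⊗ₜ[K] w K 0 (g⁻¹ i))

/-- The image of `w_i` under the coaction. For `i = 2` this is
`w_a ⊗ 1 + (e_1 - e_(12)) ⊗ a + (e_(132) - e_(13)) ⊗ b + (e_(123) - e_(23)) ⊗ c`. -/
def coX (i : Fin 3) : W K t ⊗[K] H K := w K t i ⊗ₜ[K] 1 + coQ K t i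

variable {K t}

theorem sgn_mul (g h : S3) : sgn K (g * h) = sgn K g * sgn K h := by simp [sgn]

theorem sgn_mul_self (g : S3) : sgn K g * sgn K g = 1 := by
  rcases Int.units_eq_one_or (Equiv.Perm.sign g) with h | h <;> simp [sgn, h]

theorem sgn_inv (g : S3) : sgn K g⁻¹ = sgn K g := by simp [sgn]

theorem sgn_tr (i : Fin 3) : sgn K (tr i) = -1 := by
  have : Equiv.Perm.sign (tr i) = -1 := by revert i; decide
  simp [sgn, this]

theorem tr_mul_self (i : Fin 3) : tr i * tr i = 1 := by simp [tr]

theorem x_mul_e (i : Fin 3) (g : S3) : w K t i * e K t g = e K t (tr i * g) * w K t i := by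
  rw [isRep.comm, ← mul_assoc, tr_mul_self, one_mul]

theorem e_mul_x (i : Fin 3) (g : S3) : e K t g * w K t i = w K t i * e K t (tr i * g) :=
  isRep.comm g i

/-- The cyclic relations are permuted by `S3`. -/
theorem cyc_perm {B : Type*} [AddCommMonoid B] (f : Fin 3 → Fin 3 → B)
    (h1 : ∑ i, f i (i + 1) = 0) (h2 : ∑ i, f (i + 1) i = 0) (g : S3) :
    ∑ i, f (g i) (g (i + 1)) = 0 := by
  have key : (∀ i, g (i + 1) = g i + 1) ∨ (∀ i, g i = g (i + 1) + 1) := by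
    revert g; decide
  rcases key with h | h
  · simp_rw [h]
    rw [Equiv.sum_comp g (fun i => f i (i + 1)), h1]
  · rw [Finset.sum_congr rfl fun i _ => congrArg (fun j => f j (g (i + 1))) (h i)]
    exact (Equiv.sum_comp ((Equiv.addRight (1 : Fin 3)).trans g) (fun i => f (i + 1) i)).trans h2

theorem coQ_mul_coQ (i j : Fin 3) : coQ K t i * coQ K t j =
    ∑ g : S3, e K t g ⊗ₜ[K] (w K 0 (g⁻¹ i) * w K 0 (g⁻¹ j)) := by
  unfold coQ
  rw [Finset.sum_mul_sum]
  refine Finset.sum_congr rfl fun g _ => ?_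
  rw [Finset.sum_eq_single g]
  · rw [smul_mul_smul_comm, sgn_mul_self, one_smul, Algebra.TensorProduct.tmul_mul_tmul,
      isRep.mul_e, if_pos rfl]
  · intro h _ hh
    rw [smul_mul_smul_comm, Algebra.TensorProduct.tmul_mul_tmul, isRep.mul_e, if_neg hh.symm,
      TensorProduct.zero_tmul, smul_zero]
  · simp

theorem coQ_mul_x (i j : Fin 3) : coQ K t i * (w K t j ⊗ₜ[K] 1) =
    -((w K t j ⊗ₜ[K] 1) * coQ K t (tr j i)) := by
  unfold coQ
  rw [Finset.sum_mul, Finset.mul_sum, ← Finset.sum_neg_distrib,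
    ← Equiv.sum_comp (Equiv.mulLeft (tr j))]
  refine Finset.sum_congr rfl fun g _ => ?_
  simp only [Equiv.coe_mulLeft, smul_mul_assoc, mul_smul_comm,
    Algebra.TensorProduct.tmul_mul_tmul, e_mul_x, one_mul, mul_one, sgn_mul, sgn_tr]
  rw [← mul_assoc (tr j), tr_mul_self, one_mul, mul_inv_rev, neg_mul, one_mul, neg_smul]
  have : (tr j)⁻¹ = tr j := by simp [tr]
  rw [this, Equiv.Perm.mul_apply]

theorem coE_mul_x (i : Fin 3) (g : S3) : coE K t g * (w K t i ⊗ₜ[K] 1) =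
    (w K t i ⊗ₜ[K] 1) * coE K t (tr i * g) := by
  unfold coE
  rw [Finset.sum_mul, Finset.mul_sum, ← Equiv.sum_comp (Equiv.mulLeft (tr i))]
  refine Finset.sum_congr rfl fun k _ => ?_
  simp only [Equiv.coe_mulLeft, Algebra.TensorProduct.tmul_mul_tmul, e_mul_x, one_mul, mul_one]
  have h : (tr i)⁻¹ = tr i := by simp [tr]
  rw [← mul_assoc (tr i), tr_mul_self, one_mul, mul_inv_rev, h, mul_assoc]

theorem coE_mul_coQ (i : Fin 3) (g : S3) : coE K t g * coQ K t i =
    coQ K t i * coE K t (tr i * g) := by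
  unfold coE coQ
  rw [Finset.sum_mul_sum, Finset.sum_mul_sum]
  refine Finset.sum_congr rfl fun k _ => ?_
  rw [Finset.sum_eq_single k, Finset.sum_eq_single k]
  · rw [mul_smul_comm, smul_mul_assoc, Algebra.TensorProduct.tmul_mul_tmul,
      Algebra.TensorProduct.tmul_mul_tmul, e_mul_x, isRep.mul_e, if_pos rfl, ← mul_assoc,
      tr_smul, mul_assoc]
  · intro h _ hh
    rw [smul_mul_assoc, Algebra.TensorProduct.tmul_mul_tmul, isRep.mul_e, if_neg hh.symm,
      TensorProduct.zero_tmul, smul_zero]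
  · simp
  · intro h _ hh
    rw [mul_smul_comm, Algebra.TensorProduct.tmul_mul_tmul, isRep.mul_e, if_neg hh.symm,
      TensorProduct.zero_tmul, smul_zero]
  · simp

theorem coX_mul_coX (i j : Fin 3) : coX K t i * coX K t j =
    (w K t i * w K t j) ⊗ₜ[K] 1 + (w K t i ⊗ₜ[K] 1) * coQ K t j -
      (w K t j ⊗ₜ[K] 1) * coQ K t (tr j i) + coQ K t i * coQ K t j := by
  unfold coX
  rw [add_mul, mul_add, mul_add, coQ_mul_x, Algebra.TensorProduct.tmul_mul_tmul, one_mul]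
  abel

theorem coIsRep : IsRep t (coE K t) (coX K t) where
  mul_e g h := by
    unfold coE
    rw [Finset.sum_mul_sum]
    have key : ∀ k : S3, ∑ l : S3, e K t k ⊗ₜ[K] e K 0 (k⁻¹ * g) * e K t l ⊗ₜ[K] e K 0 (l⁻¹ * h) =
        if g = h then e K t k ⊗ₜ[K] e K 0 (k⁻¹ * g) else 0 := by
      intro k
      rw [Finset.sum_eq_single k]
      · rw [Algebra.TensorProduct.tmul_mul_tmul, isRep.mul_e, isRep.mul_e, if_pos rfl]
        by_cases hgh : g = h
        · simp [hgh]
        · simp [hgh]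
      · intro l _ hl
        rw [Algebra.TensorProduct.tmul_mul_tmul, isRep.mul_e, if_neg hl.symm,
          TensorProduct.zero_tmul]
      · simp
    simp_rw [key]
    split_ifs <;> simp
  sum_e := by
    unfold coE
    rw [Finset.sum_comm]
    have : ∀ k : S3, ∑ g : S3, e K t k ⊗ₜ[K] e K 0 (k⁻¹ * g) = e K t k ⊗ₜ[K] (1 : H K) := by
      intro k
      rw [← TensorProduct.tmul_sum, ← isRep.sum_e]
      exact congrArg _ (Equiv.sum_comp (Equiv.mulLeft k⁻¹) (fun g => e K 0 g))
    simp_rw [this]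
    rw [← TensorProduct.sum_tmul, isRep.sum_e, Algebra.TensorProduct.one_def]
  comm g i := by
    unfold coX
    rw [mul_add, add_mul, coE_mul_x, coE_mul_coQ]
  sq i := by
    have h0 : ∀ j : Fin 3, w K 0 j * w K 0 j = 0 := fun j => by
      rw [isRep.sq]; simp
    have h1 : tr i i = i := by revert i; decide
    rw [coX_mul_coX, coQ_mul_coQ, h1]
    simp only [h0, TensorProduct.tmul_zero, Finset.sum_const_zero, isRep.sq]
    rw [Algebra.TensorProduct.algebraMap_apply]
    abel
  cyc := by
    have h1 : ∀ i, tr (i + 1) i = i + 2 := by decide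
    simp_rw [coX_mul_coX, coQ_mul_coQ, h1]
    rw [Finset.sum_add_distrib, Finset.sum_sub_distrib, Finset.sum_add_distrib,
      ← TensorProduct.sum_tmul, isRep.cyc, TensorProduct.zero_tmul, zero_add]
    have h2 : ∑ i, (w K t (i + 1) ⊗ₜ[K] (1 : H K)) * coQ K t (i + 2) =
        ∑ i, (w K t i ⊗ₜ[K] (1 : H K)) * coQ K t (i + 1) := by
      rw [← Equiv.sum_comp (Equiv.addRight (1 : Fin 3))
        (fun i => (w K t i ⊗ₜ[K] (1 : H K)) * coQ K t (i + 1))]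
      refine Finset.sum_congr rfl fun i _ => ?_
      have : i + 2 = i + 1 + 1 := by revert i; decide
      simp [this]
    rw [h2, sub_self, zero_add, Finset.sum_comm]
    refine Finset.sum_eq_zero fun g _ => ?_
    rw [← TensorProduct.tmul_sum, cyc_perm (fun i j => w K 0 i * w K 0 j) isRep.cyc isRep.cyc' g⁻¹,
      TensorProduct.tmul_zero]
  cyc' := by
    have h1 : ∀ i, tr i (i + 1) = i + 2 := by decide
    simp_rw [coX_mul_coX, coQ_mul_coQ, h1]
    rw [Finset.sum_add_distrib, Finset.sum_sub_distrib, Finset.sum_add_distrib,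
      ← TensorProduct.sum_tmul, isRep.cyc', TensorProduct.zero_tmul, zero_add]
    have h2 : ∑ i, (w K t (i + 1) ⊗ₜ[K] (1 : H K)) * coQ K t i =
        ∑ i, (w K t i ⊗ₜ[K] (1 : H K)) * coQ K t (i + 2) := by
      rw [← Equiv.sum_comp (Equiv.addRight (1 : Fin 3))
        (fun i => (w K t i ⊗ₜ[K] (1 : H K)) * coQ K t (i + 2))]
      refine Finset.sum_congr rfl fun i _ => ?_
      have : i + 1 + 2 = i := by revert i; decide
      simp [this]
    rw [h2, sub_self, zero_add, Finset.sum_comm]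
    refine Finset.sum_eq_zero fun g _ => ?_
    rw [← TensorProduct.tmul_sum, cyc_perm (fun i j => w K 0 j * w K 0 i) isRep.cyc' isRep.cyc g⁻¹,
      TensorProduct.tmul_zero]

variable (K t) in
/-- The coaction of `H` on `W_λ`. -/
def coaction : W K t →ₐ[K] W K t ⊗[K] H K := lift coIsRep

variable (K) in
/-- The counit of `H`. -/
def counit : H K →ₐ[K] K :=
  lift (t := 0) (E := fun g => if g = 1 then 1 else 0) (X := fun _ => 0)
    { mul_e := fun g h => by
        by_cases h1 : g = h
        · subst h1; by_cases h2 : g = 1 <;> simp [h2]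
        · have h2 : ¬(g = 1 ∧ h = 1) := fun h2 => h1 (h2.1.trans h2.2.symm)
          rw [if_neg h1, ite_zero_mul_ite_zero, if_neg h2]
      sum_e := by simp
      comm := fun g i => by simp
      sq := fun i => by simp
      cyc := by simp
      cyc' := by simp }

@[simp] theorem coaction_e (g : S3) : coaction K t (e K t g) = coE K t g := lift_e _ g

@[simp] theorem coaction_x (i : Fin 3) : coaction K t (w K t i) = coX K t i := lift_x _ i

@[simp] theorem counit_e (g : S3) : counit K (e K 0 g) = if g = 1 then 1 else 0 := lift_e _ g

@[simp] theorem counit_x (i : Fin 3) : counit K (w K 0 i) = 0 := lift_x _ i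

/-- The bialgebra structure of `H`. -/
instance : Bialgebra K (H K) :=
  Bialgebra.ofAlgHom (coaction K 0) (counit K)
    (by
      refine hom_ext (fun g => ?_) (fun i => ?_)
      · simp only [AlgHom.comp_apply, coaction_e, coE, map_sum, Algebra.TensorProduct.map_tmul,
          AlgHom.id_apply, TensorProduct.sum_tmul, TensorProduct.tmul_sum]
        rw [Finset.sum_comm]
        refine Finset.sum_congr rfl fun k _ => ?_
        rw [← Equiv.sum_comp (Equiv.mulLeft k)]
        refine Finset.sum_congr rfl fun l _ => ?_
        simp [mul_assoc]
      · simp only [AlgHom.comp_apply, coaction_x, coaction_e, coX, coQ, coE, map_sum, map_add,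
          map_smul, Algebra.TensorProduct.map_tmul, AlgHom.id_apply, map_one,
          TensorProduct.add_tmul, TensorProduct.tmul_add, TensorProduct.sum_tmul,
          TensorProduct.tmul_sum, TensorProduct.smul_tmul', Finset.smul_sum,
          Finset.sum_add_distrib, add_assoc]
        congr 1
        congr 1
        rw [Finset.sum_comm]
        refine Finset.sum_congr rfl fun k _ => ?_
        rw [← Equiv.sum_comp (Equiv.mulLeft k)]
        refine Finset.sum_congr rfl fun l _ => ?_
        simp only [Equiv.coe_mulLeft, inv_mul_cancel_left, sgn_mul, mul_inv_rev,
          Equiv.Perm.mul_apply, ← TensorProduct.smul_tmul', TensorProduct.tmul_smul, smul_smul]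
        rw [mul_comm (sgn K l)]
        rfl)
    (by
      refine hom_ext (fun g => ?_) (fun i => ?_)
      · simp [coE, TensorProduct.ite_tmul]
      · simp [coX, coQ, TensorProduct.ite_tmul, sgn]
        rfl)
    (by
      refine hom_ext (fun g => ?_) (fun i => ?_)
      · simp [coE, TensorProduct.tmul_ite, inv_mul_eq_one]
      · simp [coX, coQ])

theorem comul_eq (h : H K) : Coalgebra.comul (R := K) h = coaction K 0 h := rfl

theorem counit_eq (h : H K) : Coalgebra.counit (R := K) h = counit K h := rfl

variable (K) in
/-- The value of the antipode of `H` at `w_i`: minus the sum of all `e_{g⁻¹} (g⁻¹ · w_i)`. -/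
def apX (i : Fin 3) : H K := -∑ g : S3, sgn K g • (e K 0 g * w K 0 (g i))

theorem w_mul_e (i : Fin 3) (g : S3) : w K t i * e K t g = e K t (tr i * g) * w K t i := x_mul_e i g

theorem apX_mul_apX (i j : Fin 3) : apX K j * apX K i =
    -∑ g : S3, e K 0 g * (w K 0 (g j) * w K 0 (g (tr j i))) := by
  unfold apX
  rw [neg_mul_neg, Finset.sum_mul_sum, ← Finset.sum_neg_distrib]
  refine Finset.sum_congr rfl fun g _ => ?_
  rw [Finset.sum_eq_single (g * tr j)]
  · rw [smul_mul_smul_comm, sgn_mul, ← mul_assoc, sgn_mul_self, one_mul, sgn_tr, mul_assoc,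
      ← mul_assoc (w K 0 (g j)), w_mul_e, ← mul_assoc (tr (g j)), tr_smul, mul_assoc g, tr_mul_self,
      mul_one, ← mul_assoc, ← mul_assoc, isRep.mul_e, if_pos rfl, neg_smul, one_smul, mul_assoc]
    rfl
  · intro h _ hh
    have : g ≠ tr (g j) * h := by
      intro h'
      apply hh
      rw [← tr_smul, h', ← mul_assoc, ← h', tr_mul_self, one_mul]
    rw [smul_mul_smul_comm, mul_assoc, ← mul_assoc (w K 0 (g j)), w_mul_e, ← mul_assoc, ← mul_assoc,
      isRep.mul_e, if_neg this, zero_mul, zero_mul, smul_zero]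
  · simp

variable (K) in
theorem apIsRep : IsRep (0 : Fin 3 → K) (fun g => MulOpposite.op (e K 0 g⁻¹))
    (fun i => MulOpposite.op (apX K i)) where
  mul_e g h := by
    rw [← MulOpposite.op_mul, isRep.mul_e]
    by_cases hgh : g = h
    · simp [hgh]
    · have : h ≠ g := fun h' => hgh h'.symm
      simp [hgh, this]
  sum_e := by
    rw [← MulOpposite.op_one, ← isRep.sum_e (t := (0 : Fin 3 → K)), Finset.op_sum]
    exact Equiv.sum_comp (Equiv.inv S3) fun g => MulOpposite.op (e K 0 g)
  comm g i := by
    rw [← MulOpposite.op_mul, ← MulOpposite.op_mul]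
    congr 1
    unfold apX
    rw [neg_mul, mul_neg, Finset.sum_mul, Finset.mul_sum]
    congr 1
    have key : ∀ k : S3, k = g⁻¹ * tr i ↔ tr (k i) * g⁻¹ = k := by
      intro k
      have h : (tr i)⁻¹ = tr i := by simp [tr]
      have : tr (k i) = k * tr i * k⁻¹ := by rw [← tr_smul, mul_inv_cancel_right]
      rw [this]
      constructor
      · rintro rfl
        simp [mul_assoc, tr_mul_self, h]
      · intro h'
        have h2 : tr i * k⁻¹ * g⁻¹ = 1 := by
          apply mul_left_cancel (a := k)
          rw [mul_one, ← mul_assoc, ← mul_assoc, h']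
        have h3 : k⁻¹ = tr i * g := by
          rw [mul_inv_eq_one] at h2
          rw [← h2, ← mul_assoc, tr_mul_self, one_mul]
        rw [← inv_inj, h3, mul_inv_rev, inv_inv, h]
    refine Finset.sum_congr rfl fun k _ => ?_
    have h : (tr i)⁻¹ = tr i := by simp [tr]
    rw [smul_mul_assoc, mul_smul_comm, mul_assoc, w_mul_e, ← mul_assoc, ← mul_assoc, isRep.mul_e,
      isRep.mul_e, mul_inv_rev, h]
    by_cases hk : k = g⁻¹ * tr i
    · rw [if_pos ((key k).1 hk).symm, if_pos hk.symm, ← hk]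
    · rw [if_neg (fun h' => hk ((key k).2 h'.symm)), if_neg (fun h' => hk h'.symm)]
  sq i := by
    have h1 : tr i i = i := by revert i; decide
    have h0 : ∀ j : Fin 3, w K 0 j * w K 0 j = 0 := fun j => by
      rw [isRep.sq]; simp
    rw [← MulOpposite.op_mul, apX_mul_apX, h1]
    simp [h0]
  cyc := by
    have h1 : ∀ i, tr (i + 1) i = i + 2 := by decide
    have h2 : ∀ i : Fin 3, i + 2 = i + 1 + 1 := by decide
    simp_rw [← MulOpposite.op_mul, apX_mul_apX, h1, h2]
    rw [← Finset.op_sum, Finset.sum_neg_distrib, Finset.sum_comm]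
    rw [Finset.sum_eq_zero, neg_zero, MulOpposite.op_zero]
    intro g _
    rw [← Finset.mul_sum]
    have := (Equiv.sum_comp (Equiv.addRight (1 : Fin 3))
      fun i => w K 0 (g i) * w K 0 (g (i + 1))).trans
        (cyc_perm (fun i j => w K 0 i * w K 0 j) isRep.cyc isRep.cyc' g)
    simp only [Equiv.coe_addRight] at this
    rw [this, mul_zero]
  cyc' := by
    have h1 : ∀ i, tr i (i + 1) = i + 1 + 1 := by decide
    have h2 : ∀ i : Fin 3, i = i + 1 + 1 + 1 := by decide
    simp_rw [← MulOpposite.op_mul, apX_mul_apX, h1]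
    rw [← Finset.op_sum, Finset.sum_neg_distrib, Finset.sum_comm]
    rw [Finset.sum_eq_zero, neg_zero, MulOpposite.op_zero]
    intro g _
    rw [← Finset.mul_sum]
    have := (Equiv.sum_comp ((Equiv.addRight (1 : Fin 3)).trans (Equiv.addRight (1 : Fin 3)))
      fun i => w K 0 (g (i + 1)) * w K 0 (g i)).trans
        (cyc_perm (fun i j => w K 0 j * w K 0 i) isRep.cyc' isRep.cyc g)
    simp only [Equiv.coe_addRight, Equiv.trans_apply, ← h2] at this
    rw [this, mul_zero]

variable (K) in
/-- The antipode of `H`, as a homomorphism to the opposite algebra. -/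
def antip : H K →ₐ[K] (H K)ᵐᵒᵖ := lift (apIsRep K)

variable (K) in
/-- The antipode of `H`. -/
def antipode : H K →ₗ[K] H K :=
  (MulOpposite.opLinearEquiv K).symm.toLinearMap ∘ₗ (antip K).toLinearMap

@[simp] theorem antipode_e (g : S3) : antipode K (e K 0 g) = e K 0 g⁻¹ := by
  simp [antipode, antip]

@[simp] theorem antipode_w (i : Fin 3) : antipode K (w K 0 i) = apX K i := by
  simp [antipode, antip]

theorem antipode_mul (a b : H K) : antipode K (a * b) = antipode K b * antipode K a := by
  simp [antipode]

@[simp] theorem antipode_one : antipode K 1 = 1 := by simp [antipode]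

/-- Induction on the generators of `H`. -/
theorem induct {P : H K → Prop} (he : ∀ g, P (e K 0 g)) (hw : ∀ i, P (w K 0 i))
    (hc : ∀ r : K, P (algebraMap K _ r)) (hm : ∀ a b, P a → P b → P (a * b))
    (ha : ∀ a b, P a → P b → P (a + b)) (h : H K) : P h := by
  obtain ⟨y, rfl⟩ := RingQuot.mkAlgHom_surjective K (Rel K 0) h
  change P (mk K 0 y)
  induction y using FreeAlgebra.induction with
  | grade0 r => rw [AlgHom.commutes]; exact hc r
  | grade1 s =>
    rcases s with g | i
    · exact he g
    · exact hw i
  | mul a b iha ihb => rw [map_mul]; exact hm _ _ iha ihb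
  | add a b iha ihb => rw [map_add]; exact ha _ _ iha ihb

/-- The Hopf algebra structure of `H`. -/
instance : HopfAlgebra K (H K) where
  antipode := antipode K
  mul_antipode_rTensor_comul := by
    refine LinearMap.ext fun h => ?_
    simp only [LinearMap.comp_apply, comul_eq, counit_eq, Algebra.linearMap_apply]
    induction h using induct with
    | he g =>
      simp only [coaction_e, coE, map_sum, LinearMap.rTensor_tmul, LinearMap.mul'_apply,
        antipode_e, isRep.mul_e, counit_e]
      by_cases hg : g = 1
      · subst hg
        simp only [mul_one, if_true, map_one]
        rw [← isRep.sum_e]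
        exact Equiv.sum_comp (Equiv.inv S3) (e K 0)
      · simp [hg]
    | hw i =>
      simp only [coaction_x, coX, coQ, map_add, map_sum, map_smul, LinearMap.rTensor_tmul,
        LinearMap.mul'_apply, antipode_e, antipode_w, counit_x, map_zero, mul_one]
      rw [apX, neg_add_eq_zero, ← Equiv.sum_comp (Equiv.inv S3)]
      refine Finset.sum_congr rfl fun g _ => ?_
      simp [sgn_inv]
    | hc r =>
      rw [AlgHom.commutes, AlgHom.commutes, Algebra.TensorProduct.algebraMap_apply]
      simp [Algebra.algebraMap_eq_smul_one]
    | ha a b iha ihb => simp only [map_add, iha, ihb]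
    | hm a b iha ihb =>
      have key : ∀ z u : H K ⊗[K] H K, ∀ c : K,
          LinearMap.mul' K (H K) ((antipode K).rTensor (H K) z) = algebraMap K _ c →
          LinearMap.mul' K (H K) ((antipode K).rTensor (H K) (z * u)) =
            c • LinearMap.mul' K (H K) ((antipode K).rTensor (H K) u) := by
        intro z u c hz
        induction u using TensorProduct.induction_on with
        | zero => simp
        | add u v hu hv => rw [mul_add, map_add, map_add, hu, hv, map_add, map_add, smul_add]
        | tmul p q =>
          have : ∀ z : H K ⊗[K] H K,
              LinearMap.mul' K (H K) ((antipode K).rTensor (H K) (z * p ⊗ₜ q)) =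
              antipode K p * LinearMap.mul' K (H K) ((antipode K).rTensor (H K) z) * q := by
            intro z
            induction z using TensorProduct.induction_on with
            | zero => simp
            | add u v hu hv => simp only [add_mul, map_add, hu, hv, mul_add]
            | tmul a b => simp [antipode_mul, mul_assoc]
          rw [this, hz]
          simp [Algebra.algebraMap_eq_smul_one]
      rw [map_mul, key _ _ _ iha, ihb, map_mul, map_mul, Algebra.smul_def]
  mul_antipode_lTensor_comul := by
    refine LinearMap.ext fun h => ?_
    simp only [LinearMap.comp_apply, comul_eq, counit_eq, Algebra.linearMap_apply]
    induction h using induct with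
    | he g =>
      simp only [coaction_e, coE, map_sum, LinearMap.lTensor_tmul, LinearMap.mul'_apply,
        antipode_e, isRep.mul_e, counit_e]
      by_cases hg : g = 1
      · subst hg
        simp [isRep.sum_e]
      · simp [hg]
    | hw i =>
      simp only [coaction_x, coX, coQ, map_add, map_sum, map_smul, LinearMap.lTensor_tmul,
        LinearMap.mul'_apply, antipode_one, antipode_w, counit_x, map_zero, mul_one]
      have h1 : ∀ g : S3, e K 0 g * apX K (g⁻¹ i) = -(sgn K g • (e K 0 g * w K 0 i)) := by
        intro g
        rw [apX, mul_neg, Finset.mul_sum, Finset.sum_eq_single g]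
        · rw [mul_smul_comm, ← mul_assoc, isRep.mul_e, if_pos rfl]; simp
        · intro h _ hh
          rw [mul_smul_comm, ← mul_assoc, isRep.mul_e, if_neg hh.symm, zero_mul, smul_zero]
        · simp
      simp only [h1, smul_neg, smul_smul, sgn_mul_self, one_smul, Finset.sum_neg_distrib]
      rw [← Finset.sum_mul, isRep.sum_e, one_mul, add_neg_cancel]
    | hc r =>
      rw [AlgHom.commutes, AlgHom.commutes, Algebra.TensorProduct.algebraMap_apply]
      simp [Algebra.algebraMap_eq_smul_one]
    | ha a b iha ihb => simp only [map_add, iha, ihb]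
    | hm a b iha ihb =>
      have key : ∀ z u : H K ⊗[K] H K, ∀ c : K,
          LinearMap.mul' K (H K) ((antipode K).lTensor (H K) u) = algebraMap K _ c →
          LinearMap.mul' K (H K) ((antipode K).lTensor (H K) (z * u)) =
            c • LinearMap.mul' K (H K) ((antipode K).lTensor (H K) z) := by
        intro z u c hu
        induction z using TensorProduct.induction_on with
        | zero => simp
        | add z v hz hv => rw [add_mul, map_add, map_add, hz, hv, map_add, map_add, smul_add]
        | tmul p q =>
          have : ∀ u : H K ⊗[K] H K,
              LinearMap.mul' K (H K) ((antipode K).lTensor (H K) (p ⊗ₜ q * u)) =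
              p * LinearMap.mul' K (H K) ((antipode K).lTensor (H K) u) * antipode K q := by
            intro u
            induction u using TensorProduct.induction_on with
            | zero => simp
            | add u v hu hv => simp only [add_mul, map_add, hu, hv, mul_add]
            | tmul a b => simp [antipode_mul, mul_assoc]
          rw [this, hu]
          simp [Algebra.algebraMap_eq_smul_one]
      rw [map_mul, key _ _ _ ihb, iha, map_mul, map_mul, Algebra.smul_def,
        Algebra.commutes]

end Coaction

/-! ### The quotient of affine 3-space by the symmetric group -/

section Quotient

variable (K : Type*) [CommRing K]

/-- Triples are identified if they differ by a permutation of the coordinates. -/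
def permSetoid : Setoid (Fin 3 → K) where
  r s t := ∃ σ : S3, t = s ∘ σ
  iseqv :=
    { refl := fun s => ⟨1, rfl⟩
      symm := by
        rintro s t ⟨σ, rfl⟩
        exact ⟨σ⁻¹, by funext i; simp⟩
      trans := by
        rintro r s t ⟨σ, rfl⟩ ⟨τ, rfl⟩
        exact ⟨σ * τ, rfl⟩ }

/-- The set `A³ / S3`. -/
abbrev A3S3 : Type _ := Quotient (permSetoid K)

variable {K}

/-- The regular functions on `A³ / S3`: those whose pullback to `A³` is polynomial. -/
def A3S3.IsRegular (f : A3S3 K → K) : Prop :=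
  (fun t : Fin 3 → K => f ⟦t⟧) ∈ polyFun K (Fin 3 → K)

/-- The elementary symmetric functions of three scalars. -/
def esymm3 (t : Fin 3 → K) : Fin 3 → K :=
  ![t 0 + t 1 + t 2, t 0 * t 1 + t 1 * t 2 + t 2 * t 0, t 0 * t 1 * t 2]

end Quotient

end

end FK

/-!
An algebra `W` with a coaction `ρ` of `H` is a cocycle deformation as soon as there is a comodule
isomorphism `H → W` that preserves the unit and the Galois map `x ⊗ y ↦ x y₁ ⊗ y₂` is bijective
(`isCocycleDeformation_of_bijective`). The reason is that, after the multiplication has been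
transported to `H`, the Galois map is that of `H` composed with the twist `c ↦ α(c₁) c₂` on `H ⊗ H`
(`can_comp_map_of_isDeformationBy`), and the twist by `α` is bijective if and only if `α` is
convolution invertible (`isUnit_toConv_iff`). Conversely, the Galois map of a cocycle deformation
is bijective (`can_bijective_of_isDeformationBy`).

*The algebras `W_λ` are cocycle deformations.* The parameter `λ` is denoted by `t` in the code. The
twelve words in `wordList` times the six idempotents `e_g` form a basis of `W_λ` (`coordEquiv`). To
see this, the relations are used to write a generator times a basis element as a combination of
basis elements, and the resulting operators are checked to satisfy the relations. A functional `θ`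
with `θ(1) = 1` and `θ(e_g x) = δ_{g,1} θ(x)` gives a comodule map `x ↦ θ(x₀) x₁` from `W_λ` to
`H`, which is unitriangular with respect to the length of words, hence bijective
(`slice_coaction_bijective`). The Galois map is surjective because explicit elements are mapped to
`1 ⊗ e_g` and `1 ⊗ x_i` (`can_translation_e`, `can_translation_w`), and bijective because the
dimensions agree.

*Every cocycle deformation `W` is some `W_λ`* (`exists_comodAlgIso`). The elements of `W` with
coaction in `W ⊗ span(e_g)` form a subalgebra of dimension `6` with an action of `S3`, the Galois
map of which is bijective. The preimage of the function `δ_1` under this Galois map is a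
separability idempotent, so the subalgebra is semisimple; having dimension `6` over an
algebraically closed field, it has a character, and it follows that it is the algebra of functions
on `S3` (`exists_idempotents`). This gives idempotents `E_g` in `W` with the coaction of the
`e_g`. The map `e_g ↦ E_g` extends to a comodule map `H → W` because `H` is cofree; the components
of degree `tr i` of the images of the `x_i` are elements `X_i` with the coaction and the
commutation relations of the `w_i`. The squares `X_i²` and the cyclic sums of products are
coinvariant, hence scalars, and the cyclic sums vanish because their degree in `S3` is not
trivial. So there is a homomorphism from some `W_λ` to `W`, and a comparison with `H` shows that
it is bijective.

*Isomorphisms.* A comodule algebra isomorphism from `W_λ` to `W_μ` maps `e_g` to `e_{kg}` for some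
`k` and, by the same argument with coinvariants, `w_i` to `sign(k) w_{k i}`. So `λ_i = μ_{k i}`
(`comodAlgIso_iff`).

*Regular functions.* For a triple `(m, T, A)` that presents `W_λ`, the unit and the elements
`T(1 ⊗ h)` depend polynomially on the triple, and they can be combined to `∑_k λ_{k i} e_k`
(`map_squareOf`). Sums and products of such elements give `∑_k g(λ ∘ k) e_k` for all polynomials
`g`. If `g` is symmetric this is `g(λ) 1`, and `g(λ)` is read off from the trace of the left
multiplication (`exists_polyFun_isModel`); here the characteristic is used. Conversely, in the
basis above the structure constants of `W_λ` are polynomials in `λ`. So are those of the inverse of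
the Galois map, by Cramer's rule and because a polynomial without zeros is a nonzero constant by
the Nullstellensatz. This gives a polynomial family of triples that present the `W_λ`
(`exists_presented_family`), along which a regular function becomes a polynomial in `λ`. The
isomorphism between the orbit space and the affine space is the theorem on symmetric polynomials.
-/

namespace FK

noncomputable section

/-! ### Twisting a coalgebra by a functional -/

section Twist

variable {K : Type*} [CommRing K] {C : Type*} [AddCommGroup C] [Module K C] [Coalgebra K C]

/-- The map `c ↦ a(c₁) c₂`. -/
def leftTwist (a : C →ₗ[K] K) : C →ₗ[K] C :=
  (TensorProduct.lid K C).toLinearMap ∘ₗ a.rTensor C ∘ₗ Coalgebra.comul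

theorem counit_comp_leftTwist (a : C →ₗ[K] K) : Coalgebra.counit ∘ₗ leftTwist a = a := by
  have h : ∀ z : C ⊗[K] C, Coalgebra.counit (R := K) (TensorProduct.lid K C (a.rTensor C z)) =
      a (TensorProduct.rid K C (Coalgebra.counit.lTensor C z)) := by
    intro z
    induction z using TensorProduct.induction_on with
    | zero => simp
    | add u v hu hv => simp only [map_add, hu, hv]
    | tmul x y => simp [mul_comm]
  ext c
  simp [leftTwist, h]

/-- The twist `c ↦ a(c₁) c₂` is a right comodule map. -/
theorem comul_comp_leftTwist (a : C →ₗ[K] K) :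
    Coalgebra.comul ∘ₗ leftTwist a = (leftTwist a).rTensor C ∘ₗ Coalgebra.comul := by
  have h1 : ∀ z : C ⊗[K] C, Coalgebra.comul (R := K) (TensorProduct.lid K C (a.rTensor C z)) =
      TensorProduct.lid K (C ⊗[K] C) (a.rTensor (C ⊗[K] C) (Coalgebra.comul.lTensor C z)) := by
    intro z
    induction z using TensorProduct.induction_on with
    | zero => simp
    | add u v hu hv => simp only [map_add, hu, hv]
    | tmul x y => simp
  have h2 : ∀ z : C ⊗[K] C, (leftTwist a).rTensor C z =
      TensorProduct.lid K (C ⊗[K] C) (a.rTensor (C ⊗[K] C)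
        (TensorProduct.assoc K C C C (Coalgebra.comul.rTensor C z))) := by
    intro z
    induction z using TensorProduct.induction_on with
    | zero => simp
    | add u v hu hv => simp only [map_add, hu, hv]
    | tmul x y =>
      simp only [LinearMap.rTensor_tmul, leftTwist, LinearMap.comp_apply, LinearEquiv.coe_coe]
      generalize Coalgebra.comul (R := K) x = u
      induction u using TensorProduct.induction_on with
      | zero => simp
      | add u v hu hv => simp only [map_add, TensorProduct.add_tmul, hu, hv]
      | tmul p q => simp [TensorProduct.smul_tmul']
  ext c
  rw [LinearMap.comp_apply, LinearMap.comp_apply, h2, Coalgebra.coassoc_apply, leftTwist,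
    LinearMap.comp_apply, LinearMap.comp_apply]
  exact h1 _

/-- A map that commutes with the comultiplication on the right is the twist by its counit. -/
theorem eq_leftTwist {L : C →ₗ[K] C} (hL : Coalgebra.comul ∘ₗ L = L.rTensor C ∘ₗ Coalgebra.comul) :
    L = leftTwist (Coalgebra.counit ∘ₗ L) := by
  ext c
  have := congrArg (fun z => TensorProduct.lid K C (Coalgebra.counit.rTensor C z))
    (LinearMap.congr_fun hL c)
  simp only [LinearMap.comp_apply, Coalgebra.rTensor_counit_comul, TensorProduct.lid_tmul,
    one_smul] at this
  rw [this, leftTwist, LinearMap.comp_apply, LinearMap.comp_apply, LinearMap.rTensor_comp]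
  rfl

theorem leftTwist_counit : leftTwist (K := K) (C := C) Coalgebra.counit = LinearMap.id := by
  ext c; simp [leftTwist]

/-- Twists compose by the convolution product, in the opposite order. -/
theorem leftTwist_comp (a b : C →ₗ[K] K) : leftTwist b ∘ₗ leftTwist a =
    leftTwist (WithConv.toConv a * WithConv.toConv b).ofConv := by
  have hL : Coalgebra.comul ∘ₗ (leftTwist b ∘ₗ leftTwist a) =
      (leftTwist b ∘ₗ leftTwist a).rTensor C ∘ₗ Coalgebra.comul := by
    rw [← LinearMap.comp_assoc, comul_comp_leftTwist, LinearMap.comp_assoc, comul_comp_leftTwist,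
      ← LinearMap.comp_assoc, LinearMap.rTensor_comp]
  rw [eq_leftTwist hL]
  congr 1
  rw [← LinearMap.comp_assoc, counit_comp_leftTwist]
  ext c
  simp only [leftTwist, LinearMap.comp_apply, LinearMap.convMul_def]
  generalize Coalgebra.comul (R := K) c = z
  induction z using TensorProduct.induction_on with
  | zero => simp
  | add u v hu hv => simp only [map_add, hu, hv]
  | tmul x y => simp

/-- A functional is invertible for the convolution product if and only if its twist is
bijective: the inverse of the twist is again a twist. -/
theorem isUnit_toConv_iff (a : C →ₗ[K] K) :
    IsUnit (WithConv.toConv a) ↔ Function.Bijective (leftTwist a) := by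
  have one : ((1 : WithConv (C →ₗ[K] K))).ofConv = Coalgebra.counit := by
    ext c; simp [LinearMap.convOne_def]
  constructor
  · rintro ⟨u, hu⟩
    have h1 := leftTwist_comp (u⁻¹.1).ofConv a
    have h2 := leftTwist_comp a (u⁻¹.1).ofConv
    rw [← hu] at h1 h2
    simp only [WithConv.toConv_ofConv, Units.inv_mul, Units.mul_inv, one, leftTwist_counit] at h1 h2
    exact Function.bijective_iff_has_inverse.2
      ⟨leftTwist (u⁻¹.1).ofConv, fun c => LinearMap.congr_fun h2 c,
        fun c => LinearMap.congr_fun h1 c⟩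
  · intro h
    set L := LinearEquiv.ofBijective (leftTwist a) h with hLd
    have e1 : leftTwist a ∘ₗ L.symm.toLinearMap = LinearMap.id := by
      ext c; exact L.apply_symm_apply c
    have e2 : L.symm.toLinearMap ∘ₗ leftTwist a = LinearMap.id := by
      ext c; exact L.symm_apply_apply c
    have hL : Coalgebra.comul ∘ₗ L.symm.toLinearMap =
        L.symm.toLinearMap.rTensor C ∘ₗ Coalgebra.comul := by
      have := congrArg (fun f => L.symm.toLinearMap.rTensor C ∘ₗ (f ∘ₗ L.symm.toLinearMap))
        (comul_comp_leftTwist a)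
      simp only [LinearMap.comp_assoc] at this
      rw [e1, LinearMap.comp_id, ← LinearMap.comp_assoc, ← LinearMap.rTensor_comp,
        e2, LinearMap.rTensor_id, LinearMap.id_comp] at this
      exact this.symm
    set b := Coalgebra.counit ∘ₗ L.symm.toLinearMap with hb
    have hLb : L.symm.toLinearMap = leftTwist b := eq_leftTwist hL
    rw [hLb, leftTwist_comp] at e1 e2
    have f1 := congrArg (fun f => Coalgebra.counit ∘ₗ f) e1
    have f2 := congrArg (fun f => Coalgebra.counit ∘ₗ f) e2
    simp only [counit_comp_leftTwist, LinearMap.comp_id] at f1 f2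
    refine isUnit_iff_exists.2 ⟨WithConv.toConv b, ?_, ?_⟩
    · apply WithConv.ofConv_injective; rw [f2, one]
    · apply WithConv.ofConv_injective; rw [f1, one]

end Twist

/-! ### The Galois map -/

section Galois

variable {K : Type*} [CommRing K] {H : Type*} [Ring H] [Bialgebra K H]

theorem twistMul_eq (α : H ⊗[K] H →ₗ[K] K) :
    twistMul α = LinearMap.mul' K H ∘ₗ leftTwist α := by
  refine LinearMap.ext fun z => ?_
  simp only [twistMul, leftTwist, LinearMap.comp_apply]
  generalize Coalgebra.comul (R := K) z = u
  induction u using TensorProduct.induction_on with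
  | zero => simp
  | add u v hu hv => simp only [map_add, hu, hv]
  | tmul x y => simp

theorem comul_comp_mul' : Coalgebra.comul ∘ₗ LinearMap.mul' K H =
    TensorProduct.map (LinearMap.mul' K H) (LinearMap.mul' K H) ∘ₗ Coalgebra.comul :=
  (Bialgebra.mulCoalgHom K H).map_comp_comul.symm

/-- The twisted multiplication is a comodule map, with the ordinary multiplication on the second
factor: `Δ(x ·_α y) = x₁ ·_α y₁ ⊗ x₂ y₂`. -/
theorem comul_comp_twistMul (α : H ⊗[K] H →ₗ[K] K) : Coalgebra.comul ∘ₗ twistMul α =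
    TensorProduct.map (twistMul α) (LinearMap.mul' K H) ∘ₗ Coalgebra.comul := by
  rw [twistMul_eq, ← LinearMap.comp_assoc, comul_comp_mul', LinearMap.comp_assoc,
    comul_comp_leftTwist, ← LinearMap.comp_assoc]
  congr 1
  apply TensorProduct.ext'
  intro x y
  simp

variable {W : Type*} [Ring W] [Algebra K W]

/-- The Galois map `x ⊗ y ↦ x y₁ ⊗ y₂` of an algebra with a coaction. -/
abbrev can (ρ : W →ₐ[K] W ⊗[K] H) : W ⊗[K] W →ₗ[K] W ⊗[K] H :=
  galoisMap (LinearMap.mul' K W) ρ.toLinearMap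

theorem can_tmul (ρ : W →ₐ[K] W ⊗[K] H) (x y : W) : can ρ (x ⊗ₜ y) = (x ⊗ₜ 1) * ρ y := by
  simp only [can, galoisMap, LinearMap.comp_apply, LinearMap.lTensor_tmul, AlgHom.toLinearMap_apply]
  generalize ρ y = z
  induction z using TensorProduct.induction_on with
  | zero => simp
  | add u v hu hv => simp only [TensorProduct.tmul_add, map_add, hu, hv, mul_add]
  | tmul p q => simp

theorem leftTwist_tmul (α : H ⊗[K] H →ₗ[K] K) (x y : H) {ι : Type*} (r : Coalgebra.Repr K x ι) :
    leftTwist α (x ⊗ₜ y) =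
      ∑ i ∈ r.index, r.right i ⊗ₜ leftTwist (α ∘ₗ TensorProduct.mk K H H (r.left i)) y := by
  simp only [leftTwist, LinearMap.comp_apply, TensorProduct.comul_tmul, LinearEquiv.coe_coe]
  rw [← r.eq]
  generalize Coalgebra.comul (R := K) y = z
  simp only [TensorProduct.sum_tmul, map_sum]
  refine Finset.sum_congr rfl fun i _ => ?_
  induction z using TensorProduct.induction_on with
  | zero => simp
  | add u v hu hv => simp only [TensorProduct.tmul_add, map_add, hu, hv]
  | tmul p q => simp

/-- The Galois map of a deformation is the Galois map of `H` composed with the twist by the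
cocycle. -/
theorem can_comp_map_of_isDeformationBy {α : H ⊗[K] H →ₗ[K] K} {ρ : W →ₐ[K] W ⊗[K] H}
    (φ : H ≃ₗ[K] W) (hm : ∀ x y : H, φ (twistMul α (x ⊗ₜ y)) = φ x * φ y)
    (hc : ∀ x : H, ρ (φ x) = φ.toLinearMap.rTensor H (Coalgebra.comul x)) :
    can ρ ∘ₗ TensorProduct.map φ.toLinearMap φ.toLinearMap =
      φ.toLinearMap.rTensor H ∘ₗ can (Bialgebra.comulAlgHom K H) ∘ₗ leftTwist α := by
  apply TensorProduct.ext'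
  intro x y
  simp only [LinearMap.comp_apply, TensorProduct.map_tmul, can_tmul, LinearEquiv.coe_coe, hc]
  have h1 : ∀ u : H ⊗[K] H, (φ x ⊗ₜ[K] (1 : H)) * φ.toLinearMap.rTensor H u =
      φ.toLinearMap.rTensor H ((twistMul α ∘ₗ TensorProduct.mk K H H x).rTensor H u) := by
    intro u
    induction u using TensorProduct.induction_on with
    | zero => simp
    | add u v hu hv => simp only [mul_add, map_add, hu, hv]
    | tmul p q => simp [hm]
  rw [h1]
  congr 1
  -- both sides are `α(x₁, y₁) x₂ y₂ ⊗ y₃`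
  have h2 : ∀ z : H ⊗[K] H, can (Bialgebra.comulAlgHom K H) z =
      (LinearMap.mul' K H).rTensor H ((TensorProduct.assoc K H H H).symm
        (Coalgebra.comul.lTensor H z)) := fun z => rfl
  have h3 : (TensorProduct.assoc K H H H).symm (Coalgebra.comul.lTensor H (leftTwist α (x ⊗ₜ y))) =
      (leftTwist α).rTensor H ((TensorProduct.assoc K H H H).symm
        (Coalgebra.comul.lTensor H (x ⊗ₜ y))) := by
    have r := Coalgebra.Repr.arbitrary K x
    have h4 : ∀ a : H →ₗ[K] K, Coalgebra.comul (R := K) (leftTwist a y) =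
        (leftTwist a).rTensor H (Coalgebra.comul y) := fun a =>
      LinearMap.congr_fun (comul_comp_leftTwist a) y
    rw [leftTwist_tmul α x y r]
    simp only [map_sum, LinearMap.lTensor_tmul, h4]
    generalize Coalgebra.comul (R := K) y = z
    induction z using TensorProduct.induction_on with
    | zero => simp
    | add u v hu hv =>
      simp only [TensorProduct.tmul_add, map_add, ← hu, ← hv, Finset.sum_add_distrib]
    | tmul p q => simp [leftTwist_tmul α x p r, TensorProduct.sum_tmul]
  rw [h2, h3, LinearMap.lTensor_tmul, twistMul_eq]
  generalize Coalgebra.comul (R := K) y = z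
  induction z using TensorProduct.induction_on with
  | zero => simp
  | add u v hu hv => simp only [TensorProduct.tmul_add, map_add, hu, hv]
  | tmul p q => simp

/-- If `w` is coinvariant then it is a scalar. -/
theorem exists_algebraMap_of_coinvariant {ρ : W →ₐ[K] W ⊗[K] H}
    (φ : H ≃ₗ[K] W) (h1 : φ 1 = 1)
    (hc : ∀ x : H, ρ (φ x) = φ.toLinearMap.rTensor H (Coalgebra.comul x)) {w : W}
    (hw : ρ w = w ⊗ₜ 1) : ∃ c : K, w = algebraMap K W c := by
  obtain ⟨x, rfl⟩ := φ.surjective w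
  refine ⟨Coalgebra.counit x, ?_⟩
  have h2 : φ.toLinearMap.rTensor H (Coalgebra.comul x) = φ.toLinearMap.rTensor H (x ⊗ₜ 1) := by
    rw [← hc, hw]; simp
  have h3 : Coalgebra.comul (R := K) x = x ⊗ₜ 1 := (φ.rTensor H).injective h2
  have h4 := Coalgebra.rTensor_counit_comul (R := K) x
  rw [h3, LinearMap.rTensor_tmul] at h4
  have h5 := congrArg (TensorProduct.lid K H) h4
  simp only [TensorProduct.lid_tmul, one_smul] at h5
  rw [Algebra.algebraMap_eq_smul_one, ← h1, ← map_smul, h5]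

/-- An algebra with a coaction that is isomorphic to `H` as a comodule, and whose Galois map is
bijective, is a cocycle deformation. -/
theorem isCocycleDeformation_of_bijective {ρ : W →ₐ[K] W ⊗[K] H} (φ : H ≃ₗ[K] W) (h1 : φ 1 = 1)
    (hc : ∀ x : H, ρ (φ x) = φ.toLinearMap.rTensor H (Coalgebra.comul x))
    (hH : Function.Bijective (can (Bialgebra.comulAlgHom K H)))
    (hcan : Function.Bijective (can ρ)) : IsCocycleDeformation ρ := by
  set M : H ⊗[K] H →ₗ[K] H := φ.symm.toLinearMap ∘ₗ LinearMap.mul' K W ∘ₗ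
    TensorProduct.map φ.toLinearMap φ.toLinearMap with hM
  have hMa : ∀ x y, M (x ⊗ₜ y) = φ.symm (φ x * φ y) := fun x y => rfl
  have hMc : Coalgebra.comul ∘ₗ M =
      TensorProduct.map M (LinearMap.mul' K H) ∘ₗ Coalgebra.comul := by
    apply TensorProduct.ext'
    intro x y
    have e1 : ∀ w : W, Coalgebra.comul (R := K) (φ.symm w) =
        φ.symm.toLinearMap.rTensor H (ρ w) := by
      intro w
      obtain ⟨x, rfl⟩ := φ.surjective w
      rw [hc, ← LinearMap.comp_apply, ← LinearMap.rTensor_comp, LinearEquiv.comp_coe,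
        LinearEquiv.self_trans_symm, LinearEquiv.symm_apply_apply, LinearEquiv.refl_toLinearMap,
        LinearMap.rTensor_id, LinearMap.id_apply]
    simp only [LinearMap.comp_apply, hMa, e1, map_mul, hc, TensorProduct.comul_tmul]
    generalize Coalgebra.comul (R := K) x = X
    generalize Coalgebra.comul (R := K) y = Y
    induction X using TensorProduct.induction_on with
    | zero => simp
    | add u v hu hv => simp only [TensorProduct.add_tmul, map_add, add_mul, hu, hv]
    | tmul p q =>
      induction Y using TensorProduct.induction_on with
      | zero => simp
      | add u v hu hv => simp only [TensorProduct.tmul_add, map_add, mul_add, hu, hv]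
      | tmul p' q' => simp [hMa]
  -- the multiplication of `W`, transported to `H`, is twisted by its composition with the counit
  have htw : twistMul (Coalgebra.counit ∘ₗ M) = M := by
    refine LinearMap.ext fun z => ?_
    have := congrArg (fun z => TensorProduct.lid K H (Coalgebra.counit.rTensor H z))
      (LinearMap.congr_fun hMc z)
    simp only [LinearMap.comp_apply, Coalgebra.rTensor_counit_comul, TensorProduct.lid_tmul,
      one_smul] at this
    rw [this, twistMul, ← LinearMap.comp_apply (LinearMap.rTensor H _), LinearMap.rTensor_comp_map]
    rfl
  -- the Galois maps of `W` and of `H` differ by the twist, which is therefore bijective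
  have hdef := can_comp_map_of_isDeformationBy (α := Coalgebra.counit ∘ₗ M) φ
    (fun x y => by rw [htw, hMa, LinearEquiv.apply_symm_apply]) hc
  refine ⟨Coalgebra.counit ∘ₗ M, ⟨?_, fun x y z => ?_, fun x => ?_, fun x => ?_⟩, φ, h1,
    fun x y => by rw [htw, hMa, LinearEquiv.apply_symm_apply], hc⟩
  · rw [isUnit_toConv_iff]
    have h2 : Function.Bijective (φ.toLinearMap.rTensor H ∘ₗ can (Bialgebra.comulAlgHom K H)) := by
      rw [LinearMap.coe_comp]
      exact (φ.rTensor H).bijective.comp hH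
    rw [← Function.Bijective.of_comp_iff' h2, ← LinearMap.coe_comp, LinearMap.comp_assoc, ← hdef,
      LinearMap.coe_comp]
    exact hcan.comp (TensorProduct.congr φ φ).bijective
  · rw [htw, LinearMap.comp_apply, LinearMap.comp_apply Coalgebra.counit, hMa, hMa, hMa, hMa]
    simp [mul_assoc]
  · rw [LinearMap.comp_apply, hMa]; simp [h1]
  · rw [LinearMap.comp_apply, hMa]; simp [h1]

/-- A cocycle deformation is a Galois object, because the twist by an invertible functional is
bijective. -/
theorem can_bijective_of_isDeformationBy {α : H ⊗[K] H →ₗ[K] K}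
    (hα : IsUnit (WithConv.toConv α)) {ρ : W →ₐ[K] W ⊗[K] H} (h : IsDeformationBy α ρ)
    (hH : Function.Bijective (can (Bialgebra.comulAlgHom K H))) : Function.Bijective (can ρ) := by
  obtain ⟨φ, h1, hm, hc⟩ := h
  have hdef := can_comp_map_of_isDeformationBy φ hm hc
  rw [← Function.Bijective.of_comp_iff (can ρ) (TensorProduct.congr φ φ).bijective]
  have : (can ρ ∘ₗ TensorProduct.map φ.toLinearMap φ.toLinearMap : H ⊗[K] H → W ⊗[K] H) =
      can ρ ∘ (TensorProduct.congr φ φ) := rfl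
  rw [← this, hdef, LinearMap.coe_comp, LinearMap.coe_comp]
  exact (φ.rTensor H).bijective.comp (hH.comp ((isUnit_toConv_iff α).1 hα))

end Galois

section Antipode

variable {K : Type*} [CommRing K] {H : Type*} [Ring H] [HopfAlgebra K H]

/-- The Galois map of a Hopf algebra is bijective, with inverse `x ⊗ y ↦ x S(y₁) ⊗ y₂`. -/
theorem can_comul_bijective : Function.Bijective (can (Bialgebra.comulAlgHom K H)) := by
  set G : (H →ₗ[K] H) → H ⊗[K] H →ₗ[K] H ⊗[K] H := fun f => (LinearMap.mul' K H).rTensor H ∘ₗ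
    (TensorProduct.assoc K H H H).symm.toLinearMap ∘ₗ (f.rTensor H ∘ₗ Coalgebra.comul).lTensor H
    with hG
  -- `f ↦ (x ⊗ y ↦ x f(y₁) ⊗ y₂)` turns convolution into composition
  have hGG : ∀ f g k : H →ₗ[K] H,
      LinearMap.mul' K H ∘ₗ TensorProduct.map f g ∘ₗ Coalgebra.comul = k → G g ∘ₗ G f = G k := by
    intro f g k hk
    apply TensorProduct.ext'
    intro x y
    -- `a ⊗ b ⊗ c ↦ x f(a) g(b) ⊗ c`
    set P : H ⊗[K] (H ⊗[K] H) →ₗ[K] H ⊗[K] H :=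
      (LinearMap.mulLeft K x ∘ₗ LinearMap.mul' K H ∘ₗ TensorProduct.map f g).rTensor H ∘ₗ
        (TensorProduct.assoc K H H H).symm.toLinearMap with hP
    have e1 : ∀ z : H ⊗[K] H, G g ((LinearMap.mulLeft K x ∘ₗ f).rTensor H z) =
        P (Coalgebra.comul.lTensor H z) := by
      intro z
      induction z using TensorProduct.induction_on with
      | zero => simp
      | add u v hu hv => simp only [map_add, hu, hv]
      | tmul p q =>
        simp only [hG, hP, LinearMap.comp_apply, LinearMap.rTensor_tmul, LinearMap.lTensor_tmul]
        generalize Coalgebra.comul (R := K) q = z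
        induction z using TensorProduct.induction_on with
        | zero => simp
        | add u v hu hv => simp only [TensorProduct.tmul_add, map_add, hu, hv]
        | tmul p q => simp [mul_assoc]
    have e2 : ∀ z : H ⊗[K] H, P (TensorProduct.assoc K H H H (Coalgebra.comul.rTensor H z)) =
        (LinearMap.mulLeft K x ∘ₗ k).rTensor H z := by
      intro z
      rw [hP, ← hk, LinearMap.comp_apply, LinearEquiv.coe_coe, LinearEquiv.symm_apply_apply,
        ← LinearMap.comp_apply, ← LinearMap.rTensor_comp]
      rfl
    have e3 : ∀ f, G f (x ⊗ₜ y) = (LinearMap.mulLeft K x ∘ₗ f).rTensor H (Coalgebra.comul y) := by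
      intro f
      simp only [hG, LinearMap.comp_apply, LinearMap.lTensor_tmul]
      generalize Coalgebra.comul (R := K) y = z
      induction z using TensorProduct.induction_on with
      | zero => simp
      | add u v hu hv => simp only [TensorProduct.tmul_add, map_add, hu, hv]
      | tmul p q => simp
    rw [LinearMap.comp_apply, e3 f, e1, ← Coalgebra.coassoc_apply, e2, e3 k]
  have hone : G (Algebra.linearMap K H ∘ₗ Coalgebra.counit) = LinearMap.id := by
    apply TensorProduct.ext'
    intro x y
    simp only [hG, LinearMap.comp_apply, LinearMap.lTensor_tmul, LinearMap.rTensor_comp,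
      Coalgebra.rTensor_counit_comul]
    simp
  have hid : can (Bialgebra.comulAlgHom K H) = G LinearMap.id := by
    simp only [hG, LinearMap.rTensor_id, LinearMap.id_comp]
    rfl
  have r1 := hGG (HopfAlgebra.antipode K) LinearMap.id _
    (HopfAlgebra.mul_antipode_rTensor_comul)
  have r2 := hGG LinearMap.id (HopfAlgebra.antipode K) _
    (HopfAlgebra.mul_antipode_lTensor_comul)
  rw [hone] at r1 r2
  rw [hid]
  exact Function.bijective_iff_has_inverse.2 ⟨G (HopfAlgebra.antipode K),
    fun z => LinearMap.congr_fun r2 z, fun z => LinearMap.congr_fun r1 z⟩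

end Antipode

/-! ### The algebra `^αH` -/

section Deformation

variable {K : Type*} [CommRing K] {H : Type*} [Ring H] [Bialgebra K H]

/-- The space `H` with the multiplication twisted by a 2-cocycle. -/
def Deformed (_α : TwoCocycle K H) : Type _ := H

namespace Deformed

variable (α : TwoCocycle K H)

instance : AddCommGroup (Deformed α) := inferInstanceAs (AddCommGroup H)

instance : Module K (Deformed α) := inferInstanceAs (Module K H)

/-- The identity map `H → ^αH`. -/
def of : H ≃ₗ[K] Deformed α := LinearEquiv.refl K H

theorem twistMul_tmul (x y : H) : twistMul α.1 (x ⊗ₜ y) =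
    TensorProduct.lid K H (TensorProduct.map α.1 (LinearMap.mul' K H)
      (TensorProduct.tensorTensorTensorComm K H H H H
        (Coalgebra.comul (R := K) x ⊗ₜ Coalgebra.comul (R := K) y))) := rfl

theorem comul_twistMul (x y : H) : Coalgebra.comul (R := K) (twistMul α.1 (x ⊗ₜ y)) =
    TensorProduct.map (twistMul α.1) (LinearMap.mul' K H)
      (TensorProduct.tensorTensorTensorComm K H H H H
        (Coalgebra.comul (R := K) x ⊗ₜ Coalgebra.comul (R := K) y)) :=
  LinearMap.congr_fun (comul_comp_twistMul α.1) (x ⊗ₜ y)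

theorem twistMul_assoc (x y z : H) : twistMul α.1 (twistMul α.1 (x ⊗ₜ y) ⊗ₜ z) =
    twistMul α.1 (x ⊗ₜ twistMul α.1 (y ⊗ₜ z)) := by
  rw [twistMul_tmul α (twistMul α.1 _) z, twistMul_tmul α x (twistMul α.1 _), comul_twistMul,
    comul_twistMul]
  generalize Coalgebra.comul (R := K) x = X
  generalize Coalgebra.comul (R := K) y = Y
  generalize Coalgebra.comul (R := K) z = Z
  induction X using TensorProduct.induction_on with
  | zero => simp
  | add u v hu hv => simp only [TensorProduct.add_tmul, map_add, hu, hv]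
  | tmul p q =>
    induction Y using TensorProduct.induction_on with
    | zero => simp
    | add u v hu hv =>
      simp only [TensorProduct.add_tmul, TensorProduct.tmul_add, map_add, hu, hv]
    | tmul p' q' =>
      induction Z using TensorProduct.induction_on with
      | zero => simp
      | add u v hu hv => simp only [TensorProduct.tmul_add, map_add, hu, hv]
      | tmul p'' q'' => simp [α.2.cocycle, mul_assoc]

theorem one_twistMul (x : H) : twistMul α.1 (1 ⊗ₜ x) = x := by
  rw [twistMul_tmul, Bialgebra.comul_one, Algebra.TensorProduct.one_def]
  have h : ∀ Z : H ⊗[K] H, TensorProduct.lid K H (TensorProduct.map α.1 (LinearMap.mul' K H)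
      (TensorProduct.tensorTensorTensorComm K H H H H (((1 : H) ⊗ₜ[K] (1 : H)) ⊗ₜ[K] Z))) =
      TensorProduct.lid K H (Coalgebra.counit.rTensor H Z) := by
    intro Z
    induction Z using TensorProduct.induction_on with
    | zero => simp
    | add u v hu hv => simp only [TensorProduct.tmul_add, map_add, hu, hv]
    | tmul p q => simp [α.2.one_left]
  rw [h, Coalgebra.rTensor_counit_comul, TensorProduct.lid_tmul, one_smul]

theorem twistMul_one (x : H) : twistMul α.1 (x ⊗ₜ 1) = x := by
  rw [twistMul_tmul, Bialgebra.comul_one, Algebra.TensorProduct.one_def]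
  have h : ∀ Z : H ⊗[K] H, TensorProduct.lid K H (TensorProduct.map α.1 (LinearMap.mul' K H)
      (TensorProduct.tensorTensorTensorComm K H H H H (Z ⊗ₜ[K] ((1 : H) ⊗ₜ[K] (1 : H))))) =
      TensorProduct.lid K H (Coalgebra.counit.rTensor H Z) := by
    intro Z
    induction Z using TensorProduct.induction_on with
    | zero => simp
    | add u v hu hv => simp only [TensorProduct.add_tmul, map_add, hu, hv]
    | tmul p q => simp [α.2.one_right]
  rw [h, Coalgebra.rTensor_counit_comul, TensorProduct.lid_tmul, one_smul]

instance : Ring (Deformed α) where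
  __ := (inferInstance : AddCommGroup (Deformed α))
  mul x y := of α (twistMul α.1 ((of α).symm x ⊗ₜ (of α).symm y))
  one := of α 1
  left_distrib x y z := by
    change of α _ = of α _ + of α _
    rw [map_add, TensorProduct.tmul_add, map_add, map_add]
  right_distrib x y z := by
    change of α _ = of α _ + of α _
    rw [map_add, TensorProduct.add_tmul, map_add, map_add]
  zero_mul x := by
    change of α _ = 0
    rw [map_zero, TensorProduct.zero_tmul, map_zero, map_zero]
  mul_zero x := by
    change of α _ = 0
    rw [map_zero, TensorProduct.tmul_zero, map_zero, map_zero]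
  mul_assoc x y z := congrArg (of α) (twistMul_assoc α _ _ _)
  one_mul x := congrArg (of α) (one_twistMul α _)
  mul_one x := congrArg (of α) (twistMul_one α _)

theorem of_mul (x y : H) : of α (twistMul α.1 (x ⊗ₜ y)) = of α x * of α y := rfl

theorem of_one : of α 1 = 1 := rfl

theorem smul_mul (r : K) (x y : H) : (r • of α x) * of α y = r • (of α x * of α y) := by
  rw [← map_smul, ← of_mul, ← of_mul, ← TensorProduct.smul_tmul', map_smul, map_smul]

theorem mul_smul (r : K) (x y : H) : of α x * (r • of α y) = r • (of α x * of α y) := by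
  rw [← map_smul, ← of_mul, ← of_mul, TensorProduct.tmul_smul, map_smul, map_smul]

instance : Algebra K (Deformed α) :=
  Algebra.ofModule (R := K) (A := Deformed α) (fun r x y => smul_mul α r x y)
    (fun r x y => mul_smul α r x y)

/-- The coaction on `^αH`, which is the comultiplication of `H`. -/
def coaction : Deformed α →ₐ[K] Deformed α ⊗[K] H :=
  AlgHom.ofLinearMap ((of α).toLinearMap.rTensor H ∘ₗ Coalgebra.comul ∘ₗ (of α).symm.toLinearMap)
    (by
      change (of α).toLinearMap.rTensor H (Coalgebra.comul (1 : H)) = 1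
      rw [Bialgebra.comul_one]
      rfl)
    (by
      intro x y
      obtain ⟨x, rfl⟩ := (of α).surjective x
      obtain ⟨y, rfl⟩ := (of α).surjective y
      rw [← of_mul]
      simp only [LinearMap.comp_apply, LinearEquiv.coe_coe, LinearEquiv.symm_apply_apply,
        comul_twistMul]
      generalize Coalgebra.comul (R := K) x = X
      generalize Coalgebra.comul (R := K) y = Y
      induction X using TensorProduct.induction_on with
      | zero => simp
      | add u v hu hv => simp only [TensorProduct.add_tmul, map_add, add_mul, hu, hv]
      | tmul p q =>
        induction Y using TensorProduct.induction_on with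
        | zero => simp
        | add u v hu hv => simp only [TensorProduct.tmul_add, map_add, mul_add, hu, hv]
        | tmul p' q' => simp [of_mul])

theorem isDeformationBy : IsDeformationBy α.1 (coaction α) :=
  ⟨of α, of_one α, of_mul α, fun _ => rfl⟩

end Deformed

end Deformation

/-! ### Polynomial maps between vector spaces -/

section PolyMap

variable {K : Type*} [Field K]
variable {V : Type*} [AddCommGroup V] [Module K V]
variable {V₁ : Type*} [AddCommGroup V₁] [Module K V₁]
variable {V₂ : Type*} [AddCommGroup V₂] [Module K V₂]
variable {V₃ : Type*} [AddCommGroup V₃] [Module K V₃]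

variable (K) in
/-- A map between vector spaces is polynomial if its composition with every linear form is a
polynomial function. -/
def IsPolyMap (f : V → V₁) : Prop := ∀ φ : Module.Dual K V₁, (fun v => φ (f v)) ∈ polyFun K V

theorem mem_polyFun_iff {f : V → K} : f ∈ polyFun K V ↔ IsPolyMap K f := by
  constructor
  · intro hf φ
    have : (fun v => φ (f v)) = φ 1 • f := by
      funext v
      rw [Pi.smul_apply, smul_eq_mul, mul_comm, ← smul_eq_mul, ← map_smul, smul_eq_mul, mul_one]
    rw [this]
    exact Subalgebra.smul_mem _ hf _
  · intro hf
    exact hf LinearMap.id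

namespace IsPolyMap

theorem const (c : V₁) : IsPolyMap K (fun _ : V => c) := fun φ =>
  (polyFun K V).algebraMap_mem (φ c)

theorem linear (L : V →ₗ[K] V₁) : IsPolyMap K L := fun φ =>
  Algebra.subset_adjoin ⟨φ ∘ₗ L, rfl⟩

theorem add {f g : V → V₁} (hf : IsPolyMap K f) (hg : IsPolyMap K g) :
    IsPolyMap K (fun v => f v + g v) := fun φ => by
  simp only [map_add]
  exact (polyFun K V).add_mem (hf φ) (hg φ)

theorem sum {ι : Type*} (s : Finset ι) {f : ι → V → V₁} (hf : ∀ i ∈ s, IsPolyMap K (f i)) :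
    IsPolyMap K (fun v => ∑ i ∈ s, f i v) := fun φ => by
  simp only [map_sum]
  have := (polyFun K V).sum_mem (fun i hi => hf i hi φ)
  convert this using 1
  funext v
  simp

theorem linear_comp (L : V₁ →ₗ[K] V₂) {f : V → V₁} (hf : IsPolyMap K f) :
    IsPolyMap K (fun v => L (f v)) := fun φ => hf (φ ∘ₗ L)

theorem bilinear [FiniteDimensional K V₁] (B : V₁ →ₗ[K] V₂ →ₗ[K] V₃) {f : V → V₁} {g : V → V₂}
    (hf : IsPolyMap K f) (hg : IsPolyMap K g) : IsPolyMap K (fun v => B (f v) (g v)) := fun φ => by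
  set b := Module.finBasis K V₁
  have : (fun v => φ (B (f v) (g v))) =
      ∑ i, (fun v => b.coord i (f v)) * (fun v => (φ ∘ₗ B (b i)) (g v)) := by
    funext v
    conv_lhs => rw [← b.sum_repr (f v)]
    simp only [map_sum, LinearMap.sum_apply, map_smul, LinearMap.smul_apply, Finset.sum_apply,
      Pi.mul_apply, smul_eq_mul, Module.Basis.coord_apply, LinearMap.comp_apply]
  rw [this]
  exact (polyFun K V).sum_mem fun i _ => (polyFun K V).mul_mem (hf _) (hg _)

theorem smul {f : V → K} {g : V → V₁} (hf : f ∈ polyFun K V) (hg : IsPolyMap K g) :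
    IsPolyMap K (fun v => f v • g v) :=
  bilinear (LinearMap.lsmul K V₁) (mem_polyFun_iff.1 hf) hg

/-- The composition of a polynomial function with a polynomial map. -/
theorem comp {F : V₁ → K} (hF : F ∈ polyFun K V₁) {f : V → V₁} (hf : IsPolyMap K f) :
    (fun v => F (f v)) ∈ polyFun K V := by
  induction hF using Algebra.adjoin_induction with
  | mem x hx =>
    obtain ⟨φ, rfl⟩ := hx
    exact hf φ
  | algebraMap r => exact (polyFun K V).algebraMap_mem r
  | add x y _ _ hx hy => exact (polyFun K V).add_mem hx hy
  | mul x y _ _ hx hy => exact (polyFun K V).mul_mem hx hy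

theorem of_basis {ι : Type*} [Finite ι] (b : Module.Basis ι K V₁) {f : V → V₁}
    (h : ∀ i, (fun v => b.repr (f v) i) ∈ polyFun K V) : IsPolyMap K f := by
  have := Fintype.ofFinite ι
  have e : f = fun v => ∑ i, b.repr (f v) i • b i := by
    funext v; rw [b.sum_repr]
  rw [e]
  exact sum _ fun i _ => smul (h i) (const _)

theorem pi {ι : Type*} [Finite ι] {f : V → ι → V₁} (h : ∀ i, IsPolyMap K (fun v => f v i)) :
    IsPolyMap K f := by
  have := Fintype.ofFinite ι
  classical
  have e : f = fun v => ∑ i, LinearMap.single K (fun _ => V₁) i (f v i) := by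
    funext v
    exact (LinearMap.sum_single_apply (φ := fun _ => V₁) (f v)).symm
  rw [e]
  exact sum _ fun i _ => linear_comp _ (h i)

theorem prodMk {f : V → V₁} {g : V → V₂} (hf : IsPolyMap K f) (hg : IsPolyMap K g) :
    IsPolyMap K (fun v => (f v, g v)) := by
  have := add (linear_comp (LinearMap.inl K V₁ V₂) hf) (linear_comp (LinearMap.inr K V₁ V₂) hg)
  simpa using this

/-- A linear map depends polynomially on a parameter if its values on a basis do. -/
theorem of_apply_basis {ι : Type*} [Finite ι] (b : Module.Basis ι K V₁)
    {f : V → V₁ →ₗ[K] V₂} (h : ∀ i, IsPolyMap K (fun v => f v (b i))) : IsPolyMap K f := by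
  have e : f = fun v => (b.constr K) (fun i => f v (b i)) := by
    funext v
    exact (b.constr_self K (f v)).symm
  rw [e]
  exact linear_comp (b.constr K).toLinearMap (pi h)

theorem apply [FiniteDimensional K V₁] {f : V → V₁ →ₗ[K] V₂} {g : V → V₁} (hf : IsPolyMap K f)
    (hg : IsPolyMap K g) : IsPolyMap K (fun v => f v (g v)) :=
  bilinear (LinearMap.flip (LinearMap.id (R := K) (M := V₁ →ₗ[K] V₂))) hg hf

theorem linearMap_comp [FiniteDimensional K V₁] [FiniteDimensional K V₂]
    {f : V → V₁ →ₗ[K] V₂} {g : V → V₂ →ₗ[K] V₃}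
    (hf : IsPolyMap K f) (hg : IsPolyMap K g) : IsPolyMap K (fun v => g v ∘ₗ f v) :=
  bilinear ((LinearMap.llcomp K V₁ V₂ V₃).flip) hf hg

end IsPolyMap

/-- On a space of functions, the polynomial functions are the evaluations of polynomials in the
coordinates. -/
theorem mem_polyFun_pi_iff {ι : Type*} [Finite ι] {f : (ι → K) → K} :
    f ∈ polyFun K (ι → K) ↔ ∃ p : MvPolynomial ι K, ∀ t, f t = MvPolynomial.eval t p := by
  have := Fintype.ofFinite ι
  classical
  constructor
  · intro hf
    induction hf using Algebra.adjoin_induction with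
    | mem x hx =>
      obtain ⟨φ, rfl⟩ := hx
      refine ⟨∑ i, MvPolynomial.C (φ (Pi.single i 1)) * MvPolynomial.X i, fun t => ?_⟩
      conv_lhs => rw [← (Pi.basisFun K ι).sum_repr t]
      simp [mul_comm]
    | algebraMap r => exact ⟨MvPolynomial.C r, fun t => by simp⟩
    | add x y _ _ hx hy =>
      obtain ⟨p, hp⟩ := hx
      obtain ⟨q, hq⟩ := hy
      exact ⟨p + q, fun t => by simp [hp, hq]⟩
    | mul x y _ _ hx hy =>
      obtain ⟨p, hp⟩ := hx
      obtain ⟨q, hq⟩ := hy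
      exact ⟨p * q, fun t => by simp [hp, hq]⟩
  · rintro ⟨p, hp⟩
    obtain rfl : f = fun t => MvPolynomial.eval t p := funext hp
    clear hp
    induction p using MvPolynomial.induction_on with
    | C a =>
      simp only [MvPolynomial.eval_C]
      exact (polyFun K (ι → K)).algebraMap_mem a
    | add p q hp hq =>
      simp only [map_add]
      exact (polyFun K (ι → K)).add_mem hp hq
    | mul_X p i hp =>
      simp only [map_mul, MvPolynomial.eval_X]
      exact (polyFun K (ι → K)).mul_mem hp (Algebra.subset_adjoin ⟨LinearMap.proj i, rfl⟩)

/-- By the Nullstellensatz, a polynomial function without zeros is invertible. -/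
theorem inv_mem_polyFun [IsAlgClosed K] {ι : Type*} [Finite ι] {f : (ι → K) → K}
    (hf : f ∈ polyFun K (ι → K)) (h0 : ∀ t, f t ≠ 0) : (fun t => (f t)⁻¹) ∈ polyFun K (ι → K) := by
  obtain ⟨p, hp⟩ := mem_polyFun_pi_iff.1 hf
  have h1 : MvPolynomial.zeroLocus K (Ideal.span {p}) = ∅ := by
    ext t
    simp only [MvPolynomial.mem_zeroLocus_iff, Set.mem_empty_iff_false, iff_false]
    intro h
    apply h0 t
    rw [hp]
    simpa using h p (Ideal.mem_span_singleton_self p)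
  have h2 := MvPolynomial.vanishingIdeal_zeroLocus_eq_radical (K := K) (Ideal.span {p})
  rw [h1, MvPolynomial.vanishingIdeal_empty, eq_comm, Ideal.radical_eq_top,
    Ideal.span_singleton_eq_top] at h2
  obtain ⟨q, hq⟩ := h2.exists_right_inv
  refine mem_polyFun_pi_iff.2 ⟨q, fun t => ?_⟩
  rw [hp]
  refine inv_eq_of_mul_eq_one_right ?_
  rw [← map_mul, hq, map_one]

/-- The pointwise inverse of a polynomial family of invertible linear maps is a polynomial family,
by Cramer's rule. -/
theorem IsPolyMap.inverse [IsAlgClosed K] {ι : Type*} [Finite ι]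
    [FiniteDimensional K V₁] [FiniteDimensional K V₂] {f : (ι → K) → V₁ →ₗ[K] V₂}
    {g : (ι → K) → V₂ →ₗ[K] V₁}
    (hf : IsPolyMap K f) (hfg : ∀ t, f t ∘ₗ g t = LinearMap.id)
    (hgf : ∀ t, g t ∘ₗ f t = LinearMap.id) :
    IsPolyMap K g := by
  have e0 : V₁ ≃ₗ[K] V₂ := LinearEquiv.ofLinearMap (f 0) (g 0) (hfg 0) (hgf 0)
  set b := Module.finBasis K V₁
  set b' := b.map e0
  set M : (ι → K) → Matrix _ _ K := fun t => LinearMap.toMatrix b b' (f t) with hM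
  have hMp : ∀ i j, (fun t => M t i j) ∈ polyFun K (ι → K) := by
    intro i j
    have := hf ((b'.coord i) ∘ₗ LinearMap.applyₗ (b j))
    convert this using 1
    funext t
    simp [hM, LinearMap.toMatrix_apply]
  have hdet : ∀ N : (ι → K) → Matrix (Fin (Module.finrank K V₁)) (Fin (Module.finrank K V₁)) K,
      (∀ i j, (fun t => N t i j) ∈ polyFun K (ι → K)) →
      (fun t => (N t).det) ∈ polyFun K (ι → K) := by
    intro N hN
    simp only [Matrix.det_apply]
    have := (polyFun K (ι → K)).sum_mem (t := Finset.univ) (f := fun σ : Equiv.Perm _ =>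
      Equiv.Perm.sign σ • ∏ i, fun t => N t (σ i) i) fun σ _ => by
        rw [Units.smul_def]
        exact (polyFun K (ι → K)).zsmul_mem ((polyFun K (ι → K)).prod_mem fun i _ => hN _ _) _
    convert this using 1
    funext t
    simp [Finset.sum_apply, Finset.prod_apply, Units.smul_def]
  have hMg : ∀ t, M t * LinearMap.toMatrix b' b (g t) = 1 := by
    intro t
    rw [hM, ← LinearMap.toMatrix_comp, hfg, LinearMap.toMatrix_id]
  have hu : ∀ t, (M t).det ≠ 0 := fun t => (Matrix.isUnit_det_of_right_inverse (hMg t)).ne_zero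
  have hinv : ∀ t, LinearMap.toMatrix b' b (g t) = (M t).det⁻¹ • (M t).adjugate := by
    intro t
    rw [← Matrix.inv_eq_right_inv (hMg t), Matrix.inv_def, Ring.inverse_eq_inv']
  refine IsPolyMap.of_apply_basis b' fun j => IsPolyMap.of_basis b fun i => ?_
  have e1 : (fun t => b.repr (g t (b' j)) i) = fun t => (M t).det⁻¹ * (M t).adjugate i j := by
    funext t
    rw [← LinearMap.toMatrix_apply, hinv]
    rfl
  rw [e1]
  refine (polyFun K (ι → K)).mul_mem (inv_mem_polyFun (hdet M hMp) hu) ?_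
  simp only [Matrix.adjugate_apply]
  refine hdet _ fun i' j' => ?_
  by_cases h : i' = j
  · subst h
    simp only [Matrix.updateRow_self]
    exact (polyFun K (ι → K)).algebraMap_mem _
  · simp only [ne_eq, h, not_false_eq_true, Matrix.updateRow_ne]
    exact hMp _ _

end PolyMap

/-! ### Symmetric functions of three scalars -/

section Symmetric

variable {K : Type*} [Field K]

theorem esymm3_comp (t : Fin 3 → K) (σ : S3) : esymm3 (t ∘ σ) = esymm3 t := by
  have h : (σ 0 = 0 ∧ σ 1 = 1 ∧ σ 2 = 2) ∨ (σ 0 = 0 ∧ σ 1 = 2 ∧ σ 2 = 1) ∨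
      (σ 0 = 1 ∧ σ 1 = 0 ∧ σ 2 = 2) ∨ (σ 0 = 1 ∧ σ 1 = 2 ∧ σ 2 = 0) ∨
      (σ 0 = 2 ∧ σ 1 = 0 ∧ σ 2 = 1) ∨ (σ 0 = 2 ∧ σ 1 = 1 ∧ σ 2 = 0) := by
    revert σ; decide
  unfold esymm3
  simp only [Function.comp_apply]
  rcases h with ⟨h0, h1, h2⟩ | ⟨h0, h1, h2⟩ | ⟨h0, h1, h2⟩ | ⟨h0, h1, h2⟩ | ⟨h0, h1, h2⟩ |
    ⟨h0, h1, h2⟩ <;> simp only [h0, h1, h2] <;>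
    (congr 1; · ring) <;> (congr 1; · ring) <;> (congr 1; ring)

/-- Triples with the same elementary symmetric functions are permutations of each other. -/
theorem exists_perm_of_esymm3_eq {s t : Fin 3 → K} (h : esymm3 s = esymm3 t) :
    ∃ σ : S3, t = s ∘ σ := by
  have e1 : s 0 + s 1 + s 2 = t 0 + t 1 + t 2 := congrFun h 0
  have e2 : s 0 * s 1 + s 1 * s 2 + s 2 * s 0 = t 0 * t 1 + t 1 * t 2 + t 2 * t 0 := congrFun h 1
  have e3 : s 0 * s 1 * s 2 = t 0 * t 1 * t 2 := congrFun h 2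
  -- `t 0` is a root of the cubic with roots `s i`
  have key : ∀ j, (t 0 - s j = 0) → ∃ σ : S3, t = s ∘ σ := by
    intro j hj
    have hj := sub_eq_zero.1 hj
    have hs : ∃ τ : S3, τ 0 = j := ⟨Equiv.swap 0 j, by simp⟩
    obtain ⟨τ, hτ⟩ := hs
    have hst := esymm3_comp s τ
    set u := s ∘ τ with hu
    have hu0 : u 0 = t 0 := by simp [hu, hτ, hj]
    have f : esymm3 u = esymm3 t := hst.trans h
    have f1 : u 0 + u 1 + u 2 = t 0 + t 1 + t 2 := congrFun f 0
    have f2 : u 0 * u 1 + u 1 * u 2 + u 2 * u 0 = t 0 * t 1 + t 1 * t 2 + t 2 * t 0 := congrFun f 1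
    have f3 : (t 1 - u 1) * (t 1 - u 2) = 0 := by
      have g1 : u 1 + u 2 = t 1 + t 2 := by linear_combination f1 - hu0
      have g2 : u 1 * u 2 = t 1 * t 2 := by
        linear_combination f2 - (t 1 + t 2) * hu0 - u 0 * g1
      linear_combination g2 - t 1 * g1
    rcases mul_eq_zero.1 f3 with f3 | f3
    · refine ⟨τ, ?_⟩
      rw [← hu]
      funext i
      fin_cases i
      · exact hu0.symm
      · exact sub_eq_zero.1 f3
      · change t 2 = u 2
        linear_combination -f3 - f1 + hu0
    · refine ⟨τ * (Equiv.swap 1 2 : S3), ?_⟩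
      funext i
      have : ∀ i, (s ∘ ⇑(τ * (Equiv.swap 1 2 : S3))) i = u ((Equiv.swap 1 2 : S3) i) := fun i => rfl
      rw [this]
      fin_cases i
      · exact hu0.symm
      · simpa using sub_eq_zero.1 f3
      · change t 2 = u (Equiv.swap 1 2 2)
        rw [Equiv.swap_apply_right]
        linear_combination -f3 - f1 + hu0
  have hc : (t 0 - s 0) * ((t 0 - s 1) * (t 0 - s 2)) = 0 := by
    linear_combination (-t 0 ^ 2) * e1 + t 0 * e2 - e3
  rcases mul_eq_zero.1 hc with hc | hc
  · exact key 0 hc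
  rcases mul_eq_zero.1 hc with hc | hc
  · exact key 1 hc
  · exact key 2 hc

theorem esymm3_surjective [IsAlgClosed K] : Function.Surjective (esymm3 (K := K)) := by
  intro c
  obtain ⟨x, hx⟩ := IsAlgClosed.exists_root
    (Polynomial.X ^ 3 - Polynomial.C (c 0) * Polynomial.X ^ 2 + Polynomial.C (c 1) * Polynomial.X -
      Polynomial.C (c 2)) (by
        have : (Polynomial.X ^ 3 - Polynomial.C (c 0) * Polynomial.X ^ 2 +
          Polynomial.C (c 1) * Polynomial.X - Polynomial.C (c 2)).degree = 3 := by compute_degree!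
        rw [this]; decide)
  obtain ⟨y, hy⟩ := IsAlgClosed.exists_root
    (Polynomial.X ^ 2 - Polynomial.C (c 0 - x) * Polynomial.X +
      Polynomial.C (c 1 - x * (c 0 - x))) (by
        have : (Polynomial.X ^ 2 - Polynomial.C (c 0 - x) * Polynomial.X +
          Polynomial.C (c 1 - x * (c 0 - x))).degree = 2 := by compute_degree!
        rw [this]; decide)
  simp only [Polynomial.IsRoot.def, Polynomial.eval_sub, Polynomial.eval_add, Polynomial.eval_mul,
    Polynomial.eval_pow, Polynomial.eval_X, Polynomial.eval_C] at hx hy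
  refine ⟨![x, y, c 0 - x - y], ?_⟩
  funext i
  fin_cases i
  · change x + y + (c 0 - x - y) = c 0
    ring
  · change x * y + y * (c 0 - x - y) + (c 0 - x - y) * x = c 1
    linear_combination -hy
  · change x * y * (c 0 - x - y) = c 2
    linear_combination hx - x * hy

/-- A function on triples whose composition with the elementary symmetric functions is polynomial
is itself polynomial. -/
theorem mem_polyFun_of_comp_esymm3 [IsAlgClosed K] {F : (Fin 3 → K) → K}
    (hF : (fun t => F (esymm3 t)) ∈ polyFun K (Fin 3 → K)) : F ∈ polyFun K (Fin 3 → K) := by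
  obtain ⟨p, hp⟩ := mem_polyFun_pi_iff.1 hF
  have hsym : p.IsSymmetric := by
    intro σ
    apply MvPolynomial.funext
    intro t
    rw [MvPolynomial.eval_rename, ← hp, ← hp, esymm3_comp]
  obtain ⟨q, hq⟩ := (MvPolynomial.esymmAlgEquiv (Fin 3) K (n := 3) rfl).surjective ⟨p, hsym⟩
  refine mem_polyFun_pi_iff.2 ⟨q, fun c => ?_⟩
  obtain ⟨t, rfl⟩ := esymm3_surjective c
  have h1 : MvPolynomial.aeval (fun i : Fin 3 => MvPolynomial.esymm (Fin 3) K (i + 1)) q = p := by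
    have := congrArg Subtype.val hq
    exact (MvPolynomial.esymmAlgHom_apply q).symm.trans this
  have h2 : ∀ i : Fin 3, MvPolynomial.eval t (MvPolynomial.esymm (Fin 3) K (i + 1)) =
      esymm3 t i := by
    have e1 : (Finset.univ : Finset (Fin 3)).powersetCard 1 = {{0}, {1}, {2}} := by decide
    have e2 : (Finset.univ : Finset (Fin 3)).powersetCard 2 = {{0, 1}, {1, 2}, {2, 0}} := by decide
    have e3 : (Finset.univ : Finset (Fin 3)).powersetCard 3 = {{0, 1, 2}} := by decide
    have n1 : ({0} : Finset (Fin 3)) ∉ ({{1}, {2}} : Finset (Finset (Fin 3))) := by decide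
    have n2 : ({1} : Finset (Fin 3)) ∉ ({{2}} : Finset (Finset (Fin 3))) := by decide
    have n3 : ({0, 1} : Finset (Fin 3)) ∉ ({{1, 2}, {2, 0}} : Finset (Finset (Fin 3))) := by decide
    have n4 : ({1, 2} : Finset (Fin 3)) ∉ ({{2, 0}} : Finset (Finset (Fin 3))) := by decide
    intro i
    fin_cases i
    · simp [MvPolynomial.esymm, e1, Finset.sum_insert n1, Finset.sum_insert n2, esymm3, add_assoc]
    · simp [MvPolynomial.esymm, e2, Finset.sum_insert n3, Finset.sum_insert n4, esymm3, add_assoc]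
    · simp [MvPolynomial.esymm, e3, esymm3, mul_assoc]
  rw [hp, ← h1]
  clear hq h1
  induction q using MvPolynomial.induction_on with
  | C a => simp
  | add p q hp hq => rw [map_add, map_add, hp, hq, map_add]
  | mul_X p i hp =>
    rw [map_mul, map_mul, hp, MvPolynomial.aeval_X, h2, map_mul, MvPolynomial.eval_X]

theorem comp_esymm3_mem_polyFun {F : (Fin 3 → K) → K} (hF : F ∈ polyFun K (Fin 3 → K)) :
    (fun t => F (esymm3 t)) ∈ polyFun K (Fin 3 → K) := by
  refine IsPolyMap.comp hF (IsPolyMap.pi fun i => mem_polyFun_iff.1 (mem_polyFun_pi_iff.2 ?_))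
  fin_cases i
  · exact ⟨.X 0 + .X 1 + .X 2, fun t => by simp [esymm3]⟩
  · exact ⟨.X 0 * .X 1 + .X 1 * .X 2 + .X 2 * .X 0, fun t => by simp [esymm3]⟩
  · exact ⟨.X 0 * .X 1 * .X 2, fun t => by simp [esymm3]⟩

end Symmetric

/-! ### A basis of `W_λ` -/

section Basis

variable {K : Type*} [CommRing K]

/-- The words in the generators `w_0, w_1, w_2` that give a basis of `W_λ` over the subalgebra
spanned by the `e_g`. -/
def wordList : Fin 12 → List (Fin 3) :=
  ![[], [0], [1], [0, 1], [1, 0], [0, 1, 0], [2], [0, 2], [1, 2], [0, 1, 2], [1, 0, 2],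
    [0, 1, 0, 2]]

/-- The degree in `S3` of a basis word: the product `x` of the word satisfies
`e_g x = x e_{d⁻¹ g}`, where `d` is the degree. -/
def wordDeg (u : Fin 12) : S3 := ((wordList u).map tr).prod

/-- The coordinates of `w_i * x` in terms of the coordinates `v` of `x`, with respect to the basis
words in the order of `wordList`. The three rows belong to `i = 0, 1, 2`. -/
def leftMulFun (t : Fin 3 → K) (i : Fin 3) (v : Fin 12 → K) : Fin 12 → K :=
  (![![t 0 * v 1, v 0, t 0 * v 3, v 2, t 0 * v 5, v 4,
      t 0 * v 7, v 6, t 0 * v 9, v 8, t 0 * v 11, v 10],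
    ![t 1 * v 2 + (t 0 - t 1) * t 2 * v 9, t 1 * v 4, v 0 - (t 0 - t 1) * t 2 * v 11, t 1 * v 5,
      v 1, v 3, (t 0 - t 1) * v 3 + t 1 * v 8, t 1 * v 10, v 6 - (t 0 - t 1) * v 5, t 1 * v 11,
      v 7, v 9],
    ![-(t 0 * t 1 + (t 0 - t 1) * t 2) * v 5 + t 2 * v 6, -(t 2 * v 8), -(t 2 * v 7),
      -v 1 + t 2 * v 10, -v 2 + t 2 * v 9, -(t 2 * v 11),
      v 0 - (t 0 * t 1 + (t 0 - t 1) * t 2) * v 11, -v 2, -v 1, v 4 - v 7, v 3 - v 8, -v 5]] :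
    Fin 3 → Fin 12 → K) i

/-- Left multiplication by `w_i` in terms of the basis words. -/
def leftMul (t : Fin 3 → K) (i : Fin 3) : (Fin 12 → K) →ₗ[K] (Fin 12 → K) where
  toFun := leftMulFun t i
  map_add' v v' := by
    fin_cases i <;> funext u <;> fin_cases u <;>
      simp only [leftMulFun, Fin.mk_one, Fin.zero_eta, Fin.reduceFinMk, Pi.add_apply,
        Matrix.cons_val] <;> ring
  map_smul' r v := by
    fin_cases i <;> funext u <;> fin_cases u <;>
      simp only [leftMulFun, Fin.mk_one, Fin.zero_eta, Fin.reduceFinMk, Pi.smul_apply, smul_eq_mul,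
        Matrix.cons_val, RingHom.id_apply] <;> ring

theorem leftMul_apply (t : Fin 3 → K) (i : Fin 3) (v : Fin 12 → K) :
    leftMul t i v = leftMulFun t i v := rfl

theorem leftMul_sq (t : Fin 3 → K) (i : Fin 3) (v : Fin 12 → K) :
    leftMul t i (leftMul t i v) = t i • v := by
  change leftMulFun t i (leftMulFun t i v) = t i • v
  fin_cases i <;> funext u <;> fin_cases u <;>
    simp only [leftMulFun, Fin.mk_one, Fin.zero_eta, Fin.reduceFinMk, Pi.smul_apply, smul_eq_mul,
      Matrix.cons_val] <;> ring

theorem leftMul_cyc (t : Fin 3 → K) (v : Fin 12 → K) :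
    leftMul t 0 (leftMul t 1 v) + leftMul t 1 (leftMul t 2 v) + leftMul t 2 (leftMul t 0 v) =
      0 := by
  change leftMulFun t 0 (leftMulFun t 1 v) + leftMulFun t 1 (leftMulFun t 2 v) +
    leftMulFun t 2 (leftMulFun t 0 v) = 0
  funext u
  fin_cases u <;>
    simp only [leftMulFun, Fin.mk_one, Fin.zero_eta, Fin.reduceFinMk, Pi.add_apply, Pi.zero_apply,
      Matrix.cons_val] <;> ring

theorem leftMul_cyc' (t : Fin 3 → K) (v : Fin 12 → K) :
    leftMul t 1 (leftMul t 0 v) + leftMul t 2 (leftMul t 1 v) + leftMul t 0 (leftMul t 2 v) =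
      0 := by
  change leftMulFun t 1 (leftMulFun t 0 v) + leftMulFun t 2 (leftMulFun t 1 v) +
    leftMulFun t 0 (leftMulFun t 2 v) = 0
  funext u
  fin_cases u <;>
    simp only [leftMulFun, Fin.mk_one, Fin.zero_eta, Fin.reduceFinMk, Pi.add_apply, Pi.zero_apply,
      Matrix.cons_val] <;> ring

/-- Left multiplication by `w_i` changes the degree by the transposition `tr i`. -/
theorem leftMul_restrict (t : Fin 3 → K) (i : Fin 3) (v : Fin 12 → K) (k : S3) (u : Fin 12) :
    leftMul t i (fun u' => if wordDeg u' = tr i * k then v u' else 0) u =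
      if wordDeg u = k then leftMul t i v u else 0 := by
  have hc : ∀ u', wordDeg u' = tr i * k ↔ tr i * wordDeg u' = k := fun u' => by
    constructor
    · intro h; rw [h, ← mul_assoc, tr_mul_self, one_mul]
    · intro h; rw [← h, ← mul_assoc, tr_mul_self, one_mul]
  have hc' : (fun u' => if wordDeg u' = tr i * k then v u' else 0) =
      fun u' => if tr i * wordDeg u' = k then v u' else 0 := by
    funext u'
    simp only [hc]
  rw [hc']
  -- each of the six degrees is represented by one of the words `0, 1, 2, 3, 4, 6`
  have d : wordDeg 5 = wordDeg 6 ∧ wordDeg 7 = wordDeg 4 ∧ wordDeg 8 = wordDeg 3 ∧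
      wordDeg 9 = wordDeg 2 ∧ wordDeg 10 = wordDeg 1 ∧ wordDeg 11 = wordDeg 0 := by decide
  have d0 : tr 0 * wordDeg 0 = wordDeg 1 ∧ tr 0 * wordDeg 1 = wordDeg 0 ∧
      tr 0 * wordDeg 2 = wordDeg 3 ∧ tr 0 * wordDeg 3 = wordDeg 2 ∧
      tr 0 * wordDeg 4 = wordDeg 6 ∧ tr 0 * wordDeg 6 = wordDeg 4 := by decide
  have d1 : tr 1 * wordDeg 0 = wordDeg 2 ∧ tr 1 * wordDeg 1 = wordDeg 4 ∧
      tr 1 * wordDeg 2 = wordDeg 0 ∧ tr 1 * wordDeg 3 = wordDeg 6 ∧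
      tr 1 * wordDeg 4 = wordDeg 1 ∧ tr 1 * wordDeg 6 = wordDeg 3 := by decide
  have d2 : tr 2 * wordDeg 0 = wordDeg 6 ∧ tr 2 * wordDeg 1 = wordDeg 3 ∧
      tr 2 * wordDeg 2 = wordDeg 4 ∧ tr 2 * wordDeg 3 = wordDeg 1 ∧
      tr 2 * wordDeg 4 = wordDeg 2 ∧ tr 2 * wordDeg 6 = wordDeg 0 := by decide
  change leftMulFun t i (fun u' => if tr i * wordDeg u' = k then v u' else 0) u =
    if wordDeg u = k then leftMulFun t i v u else 0
  fin_cases i <;> fin_cases u <;>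
    simp only [leftMulFun, Fin.mk_one, Fin.zero_eta, Fin.reduceFinMk, Matrix.cons_val, d, d0, d1,
      d2] <;> split_ifs <;> ring

/-- The generator `e_g` acting on six copies, indexed by `h`, of the span of the basis words: the
copy `h` stands for the multiples of `e_h`. -/
def repE (g : S3) : (S3 → Fin 12 → K) →ₗ[K] (S3 → Fin 12 → K) where
  toFun c h u := if wordDeg u * h = g then c h u else 0
  map_add' c c' := by
    funext h u
    simp only [Pi.add_apply]
    split_ifs <;> simp
  map_smul' r c := by
    funext h u
    simp only [Pi.smul_apply, RingHom.id_apply]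
    split_ifs <;> simp

/-- The generator `w_i` acting on six copies of the span of the basis words. -/
def repX (t : Fin 3 → K) (i : Fin 3) : (S3 → Fin 12 → K) →ₗ[K] (S3 → Fin 12 → K) :=
  LinearMap.pi fun h => leftMul t i ∘ₗ LinearMap.proj h

theorem repX_apply (t : Fin 3 → K) (i : Fin 3) (c : S3 → Fin 12 → K) (h : S3) :
    repX t i c h = leftMul t i (c h) := rfl

theorem repE_apply (g : S3) (c : S3 → Fin 12 → K) (h : S3) (u : Fin 12) :
    repE g c h u = if wordDeg u * h = g then c h u else 0 := rfl

/-- The operators `repE` and `repX` satisfy the relations of `W_λ`. The linear independence of the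
basis elements follows from this. -/
theorem rep_isRep (t : Fin 3 → K) :
    IsRep t (B := Module.End K (S3 → Fin 12 → K)) repE (repX t) where
  mul_e g g' := by
    refine LinearMap.ext fun c => ?_
    funext h u
    rw [Module.End.mul_apply, repE_apply, repE_apply]
    by_cases hg : g = g'
    · subst hg
      rw [if_pos rfl, repE_apply]
      split_ifs <;> rfl
    · rw [if_neg hg]
      split_ifs with h1 h2
      · exact absurd (h1.symm.trans h2) hg
      · rfl
      · rfl
  sum_e := by
    refine LinearMap.ext fun c => ?_
    funext h u
    simp [LinearMap.sum_apply, Finset.sum_apply, repE_apply]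
  comm g i := by
    refine LinearMap.ext fun c => ?_
    funext h u
    have h1 : repE (tr i * g) c h =
        fun u' => if wordDeg u' = tr i * (g * h⁻¹) then c h u' else 0 := by
      funext u'
      simp only [repE_apply, ← mul_assoc, eq_mul_inv_iff_mul_eq]
    rw [Module.End.mul_apply, Module.End.mul_apply, repE_apply, repX_apply, repX_apply, h1,
      leftMul_restrict]
    simp only [eq_mul_inv_iff_mul_eq]
  sq i := by
    refine LinearMap.ext fun c => ?_
    funext h
    rw [Module.End.mul_apply, repX_apply, repX_apply, leftMul_sq]
    rfl
  cyc := by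
    refine LinearMap.ext fun c => ?_
    funext h
    rw [Fin.sum_univ_three]
    exact leftMul_cyc t (c h)
  cyc' := by
    refine LinearMap.ext fun c => ?_
    funext h
    rw [Fin.sum_univ_three]
    exact leftMul_cyc' t (c h)

/-- The regular representation of `W_λ` in coordinates. -/
def rep (t : Fin 3 → K) : W K t →ₐ[K] Module.End K (S3 → Fin 12 → K) := lift (rep_isRep t)

@[simp] theorem rep_e (t : Fin 3 → K) (g : S3) : rep t (e K t g) = repE g := lift_e _ g

@[simp] theorem rep_w (t : Fin 3 → K) (i : Fin 3) : rep t (w K t i) = repX t i := lift_x _ i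

/-- The coordinates of `1`, which is the sum of all `e_h`. -/
def coordOne : S3 → Fin 12 → K := fun _ => Pi.single 0 1

/-- The coordinates of an element of `W_λ` with respect to the products of a basis word and some
`e_h`. -/
def coord (t : Fin 3 → K) : W K t →ₗ[K] (S3 → Fin 12 → K) :=
  LinearMap.applyₗ coordOne ∘ₗ (rep t).toLinearMap

theorem coord_apply (t : Fin 3 → K) (x : W K t) : coord t x = rep t x coordOne := rfl

theorem coord_mul (t : Fin 3 → K) (x y : W K t) : coord t (x * y) = rep t x (coord t y) := by
  simp [coord_apply]

/-- The product of the generators `w_i` along a basis word. -/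
def word (t : Fin 3 → K) (u : Fin 12) : W K t := ((wordList u).map (w K t)).prod

/-- The sum of the basis words with coefficients `v`. -/
def comb (t : Fin 3 → K) : (Fin 12 → K) →ₗ[K] W K t := Fintype.linearCombination K (word t)

/-- The formulas in `leftMulFun` are what the relations of `W_λ` force: every product of a generator
and a basis word is rewritten as a combination of basis words. -/
theorem w_mul_comb (t : Fin 3 → K) (i : Fin 3) (v : Fin 12 → K) :
    w K t i * comb t v = comb t (leftMul t i v) := by
  have hsq : ∀ i, w K t i * w K t i = t i • 1 := fun i => by
    rw [isRep.sq, Algebra.algebraMap_eq_smul_one]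
  set a := w K t 0 with ha
  set b := w K t 1 with hb
  set c := w K t 2 with hc
  have aa : a * a = t 0 • 1 := hsq 0
  have bb : b * b = t 1 • 1 := hsq 1
  have cc : c * c = t 2 • 1 := hsq 2
  have aa' : ∀ x, a * (a * x) = t 0 • x := fun x => by rw [← mul_assoc, aa, smul_one_mul]
  have bb' : ∀ x, b * (b * x) = t 1 • x := fun x => by rw [← mul_assoc, bb, smul_one_mul]
  have ca : c * a = -(a * b) - b * c := by
    have := isRep.cyc (t := t)
    rw [Fin.sum_univ_three] at this
    have h : a * b + b * c + c * a = 0 := this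
    rw [eq_comm, ← sub_eq_zero, ← neg_eq_zero, ← h]
    abel
  have cb : c * b = -(a * c) - b * a := by
    have := isRep.cyc' (t := t)
    rw [Fin.sum_univ_three] at this
    have h : b * a + c * b + a * c = 0 := this
    rw [eq_comm, ← sub_eq_zero, ← neg_eq_zero, ← h]
    abel
  have ca' : ∀ x, c * (a * x) = -(a * (b * x)) - b * (c * x) := fun x => by
    rw [← mul_assoc, ca, sub_mul, neg_mul, mul_assoc, mul_assoc]
  have cb' : ∀ x, c * (b * x) = -(a * (c * x)) - b * (a * x) := fun x => by
    rw [← mul_assoc, cb, sub_mul, neg_mul, mul_assoc, mul_assoc]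
  -- computing `c a a` in two ways gives one more relation, which shortens words
  have bab : b * (a * b) = a * (b * a) + (t 0 - t 1) • c := by
    have h := ca' a
    rw [aa, ca] at h
    simp only [mul_smul_comm, mul_one, mul_sub, mul_neg, bb'] at h
    rw [sub_smul, h]
    abel
  have bab' : ∀ x, b * (a * (b * x)) = a * (b * (a * x)) + (t 0 - t 1) • (c * x) := fun x => by
    have := congrArg (· * x) bab
    simpa only [add_mul, mul_assoc, smul_mul_assoc] using this
  have hw : ∀ u, word t u = ![1, a, b, a * b, b * a, a * (b * a), c, a * c, b * c, a * (b * c),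
      b * (a * c), a * (b * (a * c))] u := by
    intro u
    fin_cases u <;> simp [word, wordList, ha, hb, hc]
  have hcomb : ∀ v, comb t v = ∑ u, v u • (![1, a, b, a * b, b * a, a * (b * a), c, a * c, b * c,
      a * (b * c), b * (a * c), a * (b * (a * c))] : Fin 12 → W K t) u := by
    intro v
    rw [comb, Fintype.linearCombination_apply]
    exact Finset.sum_congr rfl fun u _ => by rw [hw]
  rw [hcomb, hcomb]
  change _ = ∑ u, leftMulFun t i v u • _
  fin_cases i
  all_goals
    simp only [Fin.sum_univ_succ, Fin.sum_univ_zero, leftMulFun, Fin.mk_one, Fin.zero_eta,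
      Fin.reduceFinMk, Matrix.cons_val, Fin.reduceSucc, ← ha, ← hb, ← hc, mul_add, mul_smul_comm,
      mul_one, aa, bb, cc, aa', bb', ca, cb, ca', cb', bab, bab', mul_neg, mul_sub, mul_zero]
  · module
  · module
  · module

theorem tr_inv (i : Fin 3) : (tr i)⁻¹ = tr i := inv_eq_of_mul_eq_one_right (tr_mul_self i)

theorem e_mul_prod (t : Fin 3 → K) (g : S3) (l : List (Fin 3)) :
    e K t g * (l.map (w K t)).prod = (l.map (w K t)).prod * e K t ((l.map tr).prod⁻¹ * g) := by
  induction l generalizing g with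
  | nil => simp
  | cons i l ih =>
    rw [List.map_cons, List.prod_cons, List.map_cons, List.prod_cons, ← mul_assoc, e_mul_x,
      mul_assoc, ih, mul_inv_rev, tr_inv, mul_assoc, mul_assoc]

/-- Induction on the generators of `W_λ`. -/
theorem W_induction {t : Fin 3 → K} {P : W K t → Prop} (he : ∀ g, P (e K t g))
    (hw : ∀ i, P (w K t i)) (hc : ∀ r : K, P (algebraMap K _ r))
    (hm : ∀ a b, P a → P b → P (a * b)) (ha : ∀ a b, P a → P b → P (a + b)) (h : W K t) : P h := by
  obtain ⟨y, rfl⟩ := RingQuot.mkAlgHom_surjective K (Rel K t) h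
  change P (mk K t y)
  induction y using FreeAlgebra.induction with
  | grade0 r => rw [AlgHom.commutes]; exact hc r
  | grade1 s =>
    rcases s with g | i
    · exact he g
    · exact hw i
  | mul a b iha ihb => rw [map_mul]; exact hm _ _ iha ihb
  | add a b iha ihb => rw [map_add]; exact ha _ _ iha ihb

/-- The element of `W_λ` with given coordinates. -/
def uncoord (t : Fin 3 → K) : (S3 → Fin 12 → K) →ₗ[K] W K t :=
  ∑ h, LinearMap.mulRight K (e K t h) ∘ₗ comb t ∘ₗ LinearMap.proj h

theorem uncoord_apply (t : Fin 3 → K) (c : S3 → Fin 12 → K) :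
    uncoord t c = ∑ h, comb t (c h) * e K t h := by
  simp [uncoord, LinearMap.sum_apply]

theorem mul_uncoord (t : Fin 3 → K) (x : W K t) (c : S3 → Fin 12 → K) :
    x * uncoord t c = uncoord t (rep t x c) := by
  induction x using W_induction generalizing c with
  | he g =>
    rw [rep_e, uncoord_apply, uncoord_apply, Finset.mul_sum]
    refine Finset.sum_congr rfl fun h _ => ?_
    rw [comb, Fintype.linearCombination_apply, Fintype.linearCombination_apply, Finset.sum_mul,
      Finset.mul_sum, Finset.sum_mul]
    refine Finset.sum_congr rfl fun u _ => ?_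
    rw [smul_mul_assoc, smul_mul_assoc, mul_smul_comm, ← mul_assoc, word, e_mul_prod, mul_assoc,
      isRep.mul_e, repE_apply]
    have : (List.map tr (wordList u)).prod⁻¹ * g = h ↔ wordDeg u * h = g := by
      rw [inv_mul_eq_iff_eq_mul, eq_comm]
      rfl
    by_cases hg : wordDeg u * h = g
    · rw [if_pos hg, if_pos (this.2 hg), this.2 hg]
    · rw [if_neg hg, if_neg (fun h' => hg (this.1 h')), mul_zero, smul_zero, zero_smul]
  | hw i =>
    rw [rep_w, uncoord_apply, uncoord_apply, Finset.mul_sum]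
    refine Finset.sum_congr rfl fun h _ => ?_
    rw [← mul_assoc, w_mul_comb, repX_apply]
  | hc r => simp [← Algebra.smul_def]
  | hm a b iha ihb => rw [mul_assoc, ihb, iha, map_mul]; rfl
  | ha a b iha ihb => rw [add_mul, iha, ihb, map_add, LinearMap.add_apply, map_add]

theorem uncoord_coordOne (t : Fin 3 → K) : uncoord t coordOne = 1 := by
  rw [uncoord_apply, ← isRep.sum_e (t := t)]
  refine Finset.sum_congr rfl fun h _ => ?_
  have : comb t (coordOne (K := K) h) = 1 := by
    rw [comb, coordOne, Fintype.linearCombination_apply_single]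
    simp [word, wordList]
  rw [this, one_mul]

theorem uncoord_coord (t : Fin 3 → K) (x : W K t) : uncoord t (coord t x) = x := by
  rw [coord_apply, ← mul_uncoord, uncoord_coordOne, mul_one]

theorem coord_e (t : Fin 3 → K) (h : S3) :
    coord t (e K t h) = Pi.single h (Pi.single 0 1) := by
  rw [coord_apply, rep_e]
  funext h' u
  rw [repE_apply]
  by_cases hu : u = 0
  · subst hu
    have : wordDeg 0 = 1 := rfl
    by_cases hh : h' = h
    · subst hh; simp [this, coordOne]
    · simp [this, hh]
  · by_cases hh : h' = h
    · subst hh; simp [coordOne, hu]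
    · simp [hh, hu, coordOne]

theorem leftMul_single (t : Fin 3 → K) :
    leftMul t 0 (Pi.single 0 1) = Pi.single 1 1 ∧ leftMul t 1 (Pi.single 0 1) = Pi.single 2 1 ∧
    leftMul t 2 (Pi.single 0 1) = Pi.single 6 1 ∧ leftMul t 0 (Pi.single 2 1) = Pi.single 3 1 ∧
    leftMul t 1 (Pi.single 1 1) = Pi.single 4 1 ∧ leftMul t 0 (Pi.single 4 1) = Pi.single 5 1 ∧
    leftMul t 0 (Pi.single 6 1) = Pi.single 7 1 ∧ leftMul t 1 (Pi.single 6 1) = Pi.single 8 1 ∧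
    leftMul t 0 (Pi.single 8 1) = Pi.single 9 1 ∧ leftMul t 1 (Pi.single 7 1) = Pi.single 10 1 ∧
    leftMul t 0 (Pi.single 10 1) = Pi.single 11 1 := by
  refine ⟨?_, ?_, ?_, ?_, ?_, ?_, ?_, ?_, ?_, ?_, ?_⟩ <;> funext u <;> rw [leftMul_apply] <;>
    fin_cases u <;> simp [leftMulFun]

/-- A basis word sends the coordinates of `e_h` to the coordinates of its product with `e_h`: each
word is built up letter by letter by the formulas of `leftMul_single`. -/
theorem rep_word (t : Fin 3 → K) (h : S3) (u : Fin 12) :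
    rep t (word t u) (Pi.single h (Pi.single 0 1)) = Pi.single h (Pi.single u 1) := by
  have h1 : ∀ i v, repX t i (Pi.single h v) = Pi.single h (leftMul t i v) := by
    intro i v
    funext h'
    rw [repX_apply]
    by_cases hh : h' = h
    · subst hh; simp
    · simp [hh]
  fin_cases u <;>
    simp only [word, wordList, Fin.mk_one, Fin.zero_eta, Fin.reduceFinMk, Matrix.cons_val,
      List.map_cons, List.map_nil, List.prod_cons, List.prod_nil, mul_one, map_mul, map_one, rep_w,
      Module.End.mul_apply, Module.End.one_apply, h1, leftMul_single t]

theorem coord_uncoord (t : Fin 3 → K) (c : S3 → Fin 12 → K) : coord t (uncoord t c) = c := by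
  rw [uncoord_apply, map_sum]
  conv_rhs => rw [← Finset.univ_sum_single c]
  refine Finset.sum_congr rfl fun h _ => ?_
  rw [comb, Fintype.linearCombination_apply, Finset.sum_mul, map_sum]
  have : ∀ u, coord t (c h u • word t u * e K t h) = c h u • Pi.single h (Pi.single u 1) := by
    intro u
    rw [smul_mul_assoc, map_smul, coord_mul, coord_e, rep_word]
  simp_rw [this]
  funext h' u
  by_cases hh : h' = h
  · subst hh; simp [Finset.sum_apply, Pi.single_apply]
  · simp [Finset.sum_apply, hh]

/-- The products `word u * e h` form a basis of `W_λ`: the coordinates are a linear isomorphism. -/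
def coordEquiv (t : Fin 3 → K) : W K t ≃ₗ[K] (S3 → Fin 12 → K) :=
  LinearEquiv.ofLinearMap (coord t) (uncoord t) (LinearMap.ext (coord_uncoord t))
    (LinearMap.ext (uncoord_coord t))

theorem e_ne_zero [Nontrivial K] (t : Fin 3 → K) (g : S3) : e K t g ≠ 0 := by
  intro h
  have := coord_e t g
  rw [h, map_zero] at this
  simpa using (congrFun (congrFun this g) 0).symm

theorem e_linearIndependent (t : Fin 3 → K) : LinearIndependent K (e K t) := by
  rw [Fintype.linearIndependent_iff]
  intro f hf g
  have := congrArg (coord t) hf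
  rw [map_sum, map_zero] at this
  simp only [map_smul, coord_e] at this
  simpa [Finset.sum_apply, Pi.single_apply, ite_apply] using congrFun (congrFun this g) 0

end Basis

section FiniteDim

variable {K : Type*} [Field K]

instance (t : Fin 3 → K) : FiniteDimensional K (W K t) :=
  Module.Finite.equiv (coordEquiv t).symm

theorem finrank_W (t : Fin 3 → K) : Module.finrank K (W K t) = 72 := by
  rw [(coordEquiv t).finrank_eq]
  rw [Module.finrank_pi_fintype, Finset.sum_const, Finset.card_univ, Fintype.card_perm,
    Module.finrank_fin_fun]
  rfl

end FiniteDim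

/-! ### The algebras `W_λ` are cocycle deformations -/

section Slice

variable {K : Type*} [CommRing K] {H : Type*} [Ring H] [Algebra K H]
variable {W : Type*} [Ring W] [Algebra K W]

/-- The map `x ⊗ h ↦ θ(x) h`. -/
def slice (θ : W →ₗ[K] K) : W ⊗[K] H →ₗ[K] H := (TensorProduct.lid K H).toLinearMap ∘ₗ θ.rTensor H

@[simp] theorem slice_tmul (θ : W →ₗ[K] K) (x : W) (h : H) : slice θ (x ⊗ₜ h) = θ x • h := by
  simp [slice]

theorem slice_tmul_mul (θ : W →ₗ[K] K) (x : W) (h : H) (z : W ⊗[K] H) :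
    slice θ ((x ⊗ₜ h) * z) = h * slice (θ ∘ₗ LinearMap.mulLeft K x) z := by
  induction z using TensorProduct.induction_on with
  | zero => simp
  | add u v hu hv => simp only [mul_add, map_add, hu, hv]
  | tmul p q => simp

end Slice

section Comodule

variable {K : Type*} [CommRing K] {H : Type*} [Ring H] [Bialgebra K H]
variable {W : Type*} [Ring W] [Algebra K W]

/-- For a coassociative coaction, the map `w ↦ θ(w₀) w₁` to `H` is a comodule map. -/
theorem comul_slice_coaction {ρ : W →ₐ[K] W ⊗[K] H}
    (hρ : ∀ w, TensorProduct.assoc K W H H (ρ.toLinearMap.rTensor H (ρ w)) =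
      Coalgebra.comul.lTensor W (ρ w)) (θ : W →ₗ[K] K) (w : W) :
    Coalgebra.comul (R := K) (slice θ (ρ w)) = (slice θ ∘ₗ ρ.toLinearMap).rTensor H (ρ w) := by
  have h1 : ∀ z : W ⊗[K] H, Coalgebra.comul (R := K) (slice θ z) =
      slice θ (Coalgebra.comul.lTensor W z) := by
    intro z
    induction z using TensorProduct.induction_on with
    | zero => simp
    | add u v hu hv => simp only [map_add, hu, hv]
    | tmul p q => simp
  have h2 : ∀ z : W ⊗[K] H, (slice θ ∘ₗ ρ.toLinearMap).rTensor H z =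
      slice θ (TensorProduct.assoc K W H H (ρ.toLinearMap.rTensor H z)) := by
    intro z
    induction z using TensorProduct.induction_on with
    | zero => simp
    | add u v hu hv => simp only [map_add, hu, hv]
    | tmul p q =>
      simp only [LinearMap.rTensor_tmul, LinearMap.comp_apply, AlgHom.toLinearMap_apply]
      generalize ρ p = z
      induction z using TensorProduct.induction_on with
      | zero => simp
      | add u v hu hv => simp only [map_add, TensorProduct.add_tmul, hu, hv]
      | tmul p q => simp [TensorProduct.smul_tmul']
  rw [h1, h2, hρ]

/-- The elements `h` such that `1 ⊗ h` is in the image of the Galois map are closed under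
multiplication. -/
theorem can_surjective_of_generators {ρ : W →ₐ[K] W ⊗[K] H} {S : Set H}
    (hS : Algebra.adjoin K S = ⊤) (h : ∀ s ∈ S, ∃ z, can ρ z = 1 ⊗ₜ s) :
    Function.Surjective (can ρ) := by
  have hmap : ∀ (a b : W) (z : W ⊗[K] W),
      can ρ (TensorProduct.map (LinearMap.mulLeft K a) (LinearMap.mulRight K b) z) =
        (a ⊗ₜ 1) * can ρ z * ρ b := by
    intro a b z
    induction z using TensorProduct.induction_on with
    | zero => simp
    | add u v hu hv => simp only [map_add, hu, hv, mul_add, add_mul]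
    | tmul p q =>
      rw [TensorProduct.map_tmul, can_tmul, can_tmul, LinearMap.mulLeft_apply,
        LinearMap.mulRight_apply, map_mul, ← mul_assoc, ← mul_assoc,
        Algebra.TensorProduct.tmul_mul_tmul, one_mul]
  have key : ∀ x : H, ∃ z, can ρ z = 1 ⊗ₜ x := by
    intro x
    have hx : x ∈ Algebra.adjoin K S := by rw [hS]; trivial
    induction hx using Algebra.adjoin_induction with
    | mem x hx => exact h x hx
    | algebraMap r =>
      refine ⟨r • (1 ⊗ₜ 1), ?_⟩
      rw [map_smul, can_tmul, map_one, mul_one, Algebra.algebraMap_eq_smul_one,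
        TensorProduct.tmul_smul]
    | add x y _ _ hx hy =>
      obtain ⟨z, hz⟩ := hx
      obtain ⟨z', hz'⟩ := hy
      exact ⟨z + z', by rw [map_add, hz, hz', TensorProduct.tmul_add]⟩
    | mul x y _ _ hx hy =>
      obtain ⟨z, hz⟩ := hx
      obtain ⟨z', hz'⟩ := hy
      have : ∀ z' : W ⊗[K] W, ∃ z'', can ρ z'' = (1 ⊗ₜ x) * can ρ z' := by
        intro z'
        induction z' using TensorProduct.induction_on with
        | zero => exact ⟨0, by simp⟩
        | add u v hu hv =>
          obtain ⟨u', hu⟩ := hu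
          obtain ⟨v', hv⟩ := hv
          exact ⟨u' + v', by rw [map_add, hu, hv, map_add, mul_add]⟩
        | tmul p q =>
          refine ⟨_, (hmap p q z).trans ?_⟩
          rw [hz, can_tmul, ← mul_assoc, Algebra.TensorProduct.tmul_mul_tmul,
            Algebra.TensorProduct.tmul_mul_tmul]
          simp
      obtain ⟨z'', hz''⟩ := this z'
      exact ⟨z'', by rw [hz'', hz', Algebra.TensorProduct.tmul_mul_tmul, one_mul]⟩
  intro y
  induction y using TensorProduct.induction_on with
  | zero => exact ⟨0, map_zero _⟩
  | add u v hu hv =>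
    obtain ⟨u', hu⟩ := hu
    obtain ⟨v', hv⟩ := hv
    exact ⟨u' + v', by rw [map_add, hu, hv]⟩
  | tmul p q =>
    obtain ⟨z, hz⟩ := key q
    refine ⟨_, (hmap p 1 z).trans ?_⟩
    rw [hz, map_one, mul_one, Algebra.TensorProduct.tmul_mul_tmul, mul_one, one_mul]

end Comodule

section Translation

variable {K : Type*} [CommRing K] (t : Fin 3 → K)

/-- The coaction on `W_λ` is coassociative, with the comultiplication of `H` as the coaction on
`W_0`. -/
theorem coassoc_coaction_W (x : W K t) :
    TensorProduct.assoc K (W K t) (H K) (H K)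
      ((coaction K t).toLinearMap.rTensor (H K) (coaction K t x)) =
      Coalgebra.comul.lTensor (W K t) (coaction K t x) := by
  have key : (Algebra.TensorProduct.assoc K K K (W K t) (H K) (H K)).toAlgHom.comp
      ((Algebra.TensorProduct.map (coaction K t) (AlgHom.id K (H K))).comp (coaction K t)) =
      (Algebra.TensorProduct.map (AlgHom.id K (W K t)) (coaction K 0)).comp (coaction K t) := by
    refine hom_ext (fun g => ?_) (fun i => ?_)
    · simp only [AlgHom.comp_apply, coaction_e, coE, map_sum, Algebra.TensorProduct.map_tmul,
        AlgHom.id_apply, TensorProduct.sum_tmul, TensorProduct.tmul_sum]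
      rw [Finset.sum_comm]
      refine Finset.sum_congr rfl fun k _ => ?_
      rw [← Equiv.sum_comp (Equiv.mulLeft k)]
      refine Finset.sum_congr rfl fun l _ => ?_
      simp [mul_assoc]
    · simp only [AlgHom.comp_apply, coaction_x, coaction_e, coX, coQ, coE, map_sum, map_add,
        map_smul, Algebra.TensorProduct.map_tmul, AlgHom.id_apply, map_one,
        TensorProduct.add_tmul, TensorProduct.tmul_add, TensorProduct.sum_tmul,
        TensorProduct.tmul_sum, TensorProduct.smul_tmul', Finset.smul_sum,
        Finset.sum_add_distrib, add_assoc]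
      congr 1
      congr 1
      rw [Finset.sum_comm]
      refine Finset.sum_congr rfl fun k _ => ?_
      rw [← Equiv.sum_comp (Equiv.mulLeft k)]
      refine Finset.sum_congr rfl fun l _ => ?_
      simp only [Equiv.coe_mulLeft, inv_mul_cancel_left, sgn_mul, mul_inv_rev,
        Equiv.Perm.mul_apply, ← TensorProduct.smul_tmul', TensorProduct.tmul_smul, smul_smul]
      rw [mul_comm (sgn K l)]
      rfl
  exact DFunLike.congr_fun key x

/-- The value of the translation map at `e_g`. -/
theorem can_translation_e (g : S3) :
    can (coaction K t) (∑ k, e K t k ⊗ₜ e K t (k * g)) = 1 ⊗ₜ e K 0 g := by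
  rw [map_sum, ← isRep.sum_e (t := t), TensorProduct.sum_tmul]
  refine Finset.sum_congr rfl fun k _ => ?_
  rw [can_tmul, coaction_e, coE, Finset.mul_sum, Finset.sum_eq_single k]
  · rw [Algebra.TensorProduct.tmul_mul_tmul, isRep.mul_e, if_pos rfl, one_mul, inv_mul_cancel_left]
  · intro l _ hl
    rw [Algebra.TensorProduct.tmul_mul_tmul, isRep.mul_e, if_neg hl.symm, TensorProduct.zero_tmul]
  · simp

/-- The value of the translation map at `x_i`. -/
theorem can_translation_w (i : Fin 3) :
    can (coaction K t) (∑ k, sgn K k • (e K t k ⊗ₜ w K t (k i) - (e K t k * w K t (k i)) ⊗ₜ 1)) =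
      1 ⊗ₜ w K 0 i := by
  conv_rhs => rw [← isRep.sum_e (t := t), TensorProduct.sum_tmul]
  rw [map_sum]
  refine Finset.sum_congr rfl fun k _ => ?_
  rw [map_smul, map_sub, can_tmul, can_tmul, coaction_x, coX, mul_add, map_one, mul_one,
    Algebra.TensorProduct.tmul_mul_tmul, mul_one, add_sub_cancel_left, coQ, Finset.mul_sum,
    Finset.sum_eq_single k]
  · rw [mul_smul_comm, Algebra.TensorProduct.tmul_mul_tmul, isRep.mul_e, if_pos rfl, one_mul,
      smul_smul, sgn_mul_self, one_smul]
    simp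
  · intro l _ hl
    rw [mul_smul_comm, Algebra.TensorProduct.tmul_mul_tmul, isRep.mul_e, if_neg hl.symm,
      TensorProduct.zero_tmul, smul_zero]
  · simp

theorem adjoin_generators :
    Algebra.adjoin K (Set.range (e K t) ∪ Set.range (w K t)) = ⊤ := by
  rw [eq_top_iff]
  intro x _
  induction x using W_induction with
  | he g => exact Algebra.subset_adjoin (Or.inl ⟨g, rfl⟩)
  | hw i => exact Algebra.subset_adjoin (Or.inr ⟨i, rfl⟩)
  | hc r => exact Subalgebra.algebraMap_mem _ r
  | hm a b ha hb => exact Subalgebra.mul_mem _ (ha trivial) (hb trivial)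
  | ha a b ha hb => exact Subalgebra.add_mem _ (ha trivial) (hb trivial)

theorem can_coaction_surjective : Function.Surjective (can (coaction K t)) := by
  refine can_surjective_of_generators (adjoin_generators (0 : Fin 3 → K)) ?_
  rintro _ (⟨g, rfl⟩ | ⟨i, rfl⟩)
  · exact ⟨_, can_translation_e t g⟩
  · exact ⟨_, can_translation_w t i⟩

end Translation

section Field

variable {K : Type*} [Field K] (t : Fin 3 → K)

/-- The Galois map of `W_λ` is surjective between spaces of the same dimension. -/
theorem can_coaction_bijective : Function.Bijective (can (coaction K t)) := by
  refine ⟨(LinearMap.injective_iff_surjective_of_finrank_eq_finrank ?_).2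
    (can_coaction_surjective t), can_coaction_surjective t⟩
  rw [Module.finrank_tensorProduct, Module.finrank_tensorProduct, finrank_W, finrank_W]

variable (K) in
/-- The span of the products of an `e_g` and less than `n` of the generators `x_i` of `H`. -/
def lowDegree (n : ℕ) : Submodule K (H K) :=
  Submodule.span K {x | ∃ (l : List (Fin 3)) (g : S3), l.length < n ∧
    x = (l.map (w K 0)).prod * e K 0 g}

theorem lowDegree_mono {m n : ℕ} (h : m ≤ n) : lowDegree K m ≤ lowDegree K n := by
  refine Submodule.span_mono ?_
  rintro _ ⟨l, g, hl, rfl⟩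
  exact ⟨l, g, hl.trans_le h, rfl⟩

theorem w_mul_mem_lowDegree {n : ℕ} (i : Fin 3) {x : H K} (hx : x ∈ lowDegree K n) :
    w K 0 i * x ∈ lowDegree K (n + 1) := by
  induction hx using Submodule.span_induction with
  | mem x hx =>
    obtain ⟨l, g, hl, rfl⟩ := hx
    refine Submodule.subset_span ⟨i :: l, g, by simpa using hl, ?_⟩
    rw [List.map_cons, List.prod_cons, mul_assoc]
  | zero => simp
  | add x y _ _ hx hy => rw [mul_add]; exact Submodule.add_mem _ hx hy
  | smul r x _ hx => rw [mul_smul_comm]; exact Submodule.smul_mem _ _ hx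

theorem slice_coaction_w_mul (θ : W K t →ₗ[K] K) (i : Fin 3) (x : W K t) :
    slice θ (coaction K t (w K t i * x)) =
      slice (θ ∘ₗ LinearMap.mulLeft K (w K t i)) (coaction K t x) +
      ∑ g : S3, sgn K g • (w K 0 (g⁻¹ i) *
        slice (θ ∘ₗ LinearMap.mulLeft K (e K t g)) (coaction K t x)) := by
  rw [map_mul, coaction_x, coX, add_mul, map_add, slice_tmul_mul, one_mul, coQ, Finset.sum_mul,
    map_sum]
  congr 1
  refine Finset.sum_congr rfl fun g _ => ?_
  rw [smul_mul_assoc, map_smul, slice_tmul_mul]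

/-- The comodule map `x ↦ θ(x₀) x₁` does not raise the length of words. -/
theorem slice_coaction_mem (θ : W K t →ₗ[K] K) (l : List (Fin 3)) (g : S3) :
    slice θ (coaction K t ((l.map (w K t)).prod * e K t g)) ∈ lowDegree K (l.length + 1) := by
  induction l generalizing θ with
  | nil =>
    simp only [List.map_nil, List.prod_nil, one_mul, coaction_e, coE, map_sum, slice_tmul]
    exact Submodule.sum_mem _ fun k _ => Submodule.smul_mem _ _
      (Submodule.subset_span ⟨[], k⁻¹ * g, by simp, by simp⟩)
  | cons i l ih =>
    rw [List.map_cons, List.prod_cons, mul_assoc, slice_coaction_w_mul]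
    refine Submodule.add_mem _ (lowDegree_mono (by simp) (ih _)) (Submodule.sum_mem _ fun k _ => ?_)
    exact Submodule.smul_mem _ _ (w_mul_mem_lowDegree _ (ih _))

/-- If `θ(e_g x) = δ_{g,1} θ(x)` and `θ(1) = 1`, then the comodule map `x ↦ θ(x₀) x₁` from `W_λ` to
`H` is the identity in top degree. -/
theorem slice_coaction_sub_mem {θ : W K t →ₗ[K] K} (h1 : θ 1 = 1)
    (hθ : ∀ g x, θ (e K t g * x) = if g = 1 then θ x else 0) (l : List (Fin 3)) (g : S3) :
    slice θ (coaction K t ((l.map (w K t)).prod * e K t g)) - (l.map (w K 0)).prod * e K 0 g ∈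
      lowDegree K l.length := by
  have hE : ∀ k, θ ∘ₗ LinearMap.mulLeft K (e K t k) = if k = 1 then θ else 0 := by
    intro k
    refine LinearMap.ext fun x => ?_
    rw [LinearMap.comp_apply, LinearMap.mulLeft_apply, hθ]
    split_ifs <;> rfl
  induction l with
  | nil =>
    have : ∀ k, θ (e K t k) = if k = 1 then 1 else 0 := fun k => by
      rw [← mul_one (e K t k), hθ, h1]
    simp [coE, this]
  | cons i l ih =>
    have h2 : ∀ k : S3, slice (H := H K) (if k = 1 then θ else 0) =
        if k = 1 then slice θ else 0 := by
      intro k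
      split_ifs
      · rfl
      · ext; simp
    rw [List.map_cons, List.prod_cons, mul_assoc, slice_coaction_w_mul, List.map_cons,
      List.prod_cons, mul_assoc, Finset.sum_eq_single 1]
    · rw [hE, if_pos rfl, add_sub_assoc]
      refine Submodule.add_mem _ (slice_coaction_mem t _ l g) ?_
      have : sgn K (1 : S3) = 1 := by simp [sgn]
      rw [this, one_smul, inv_one, Equiv.Perm.one_apply, ← mul_sub]
      exact w_mul_mem_lowDegree _ ih
    · intro k _ hk
      rw [hE, h2, if_neg hk, LinearMap.zero_apply, mul_zero, smul_zero]
    · simp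

/-- A comodule map `W_λ → H` as in `slice_coaction_sub_mem` is bijective. -/
theorem slice_coaction_bijective {θ : W K t →ₗ[K] K} (h1 : θ 1 = 1)
    (hθ : ∀ g x, θ (e K t g * x) = if g = 1 then θ x else 0) :
    Function.Bijective (slice θ ∘ₗ (coaction K t).toLinearMap) := by
  have hr : ∀ n, lowDegree K n ≤ LinearMap.range (slice θ ∘ₗ (coaction K t).toLinearMap) := by
    intro n
    induction n with
    | zero =>
      refine Submodule.span_le.2 ?_
      rintro _ ⟨l, g, hl, rfl⟩
      exact absurd hl (Nat.not_lt_zero _)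
    | succ n ih =>
      refine Submodule.span_le.2 ?_
      rintro _ ⟨l, g, hl, rfl⟩
      have := ih (lowDegree_mono (Nat.lt_succ_iff.1 hl) (slice_coaction_sub_mem t h1 hθ l g))
      have h2 := Submodule.sub_mem _ (LinearMap.mem_range_self
        (slice θ ∘ₗ (coaction K t).toLinearMap) ((l.map (w K t)).prod * e K t g)) this
      rw [LinearMap.comp_apply, AlgHom.toLinearMap_apply, sub_sub_cancel] at h2
      exact h2
  have hs : Function.Surjective (slice θ ∘ₗ (coaction K t).toLinearMap) := by
    intro x
    rw [← LinearMap.mem_range]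
    -- the basis words have length at most `4`
    refine hr 5 ?_
    rw [← uncoord_coord 0 x, uncoord_apply]
    refine Submodule.sum_mem _ fun h _ => ?_
    rw [comb, Fintype.linearCombination_apply, Finset.sum_mul]
    refine Submodule.sum_mem _ fun u _ => ?_
    rw [smul_mul_assoc]
    refine Submodule.smul_mem _ _ (Submodule.subset_span ⟨wordList u, h, ?_, rfl⟩)
    revert u; decide
  refine ⟨(LinearMap.injective_iff_surjective_of_finrank_eq_finrank ?_).2 hs, hs⟩
  rw [finrank_W, finrank_W]

/-- A functional that takes the value `1` at `e_1`, applied after left multiplication by `e_1`. -/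
theorem exists_functional {A : Type*} [Ring A] [Algebra K A] {E : S3 → A}
    (hE : ∀ g h, E g * E h = if g = h then E g else 0) (h0 : E 1 ≠ 0) :
    ∃ θ : A →ₗ[K] K, θ 1 = 1 ∧ ∀ g x, θ (E g * x) = if g = 1 then θ x else 0 := by
  obtain ⟨θ, hθ⟩ := Module.Projective.exists_dual_eq_one K h0
  refine ⟨θ ∘ₗ LinearMap.mulLeft K (E 1), by simp [hθ], fun g x => ?_⟩
  rw [LinearMap.comp_apply, LinearMap.mulLeft_apply, ← mul_assoc, hE]
  by_cases hg : g = 1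
  · subst hg; simp
  · rw [if_neg (Ne.symm hg), if_neg hg, zero_mul, map_zero]

/-- For every `λ`, the algebra `W_λ` is a cocycle deformation of `H`. -/
theorem isCocycleDeformation_coaction : IsCocycleDeformation (coaction K t) := by
  obtain ⟨θ, h1, hθ⟩ := exists_functional (K := K) (isRep (t := t)).mul_e (e_ne_zero t 1)
  set ψ := LinearEquiv.ofBijective _ (slice_coaction_bijective t h1 hθ) with hψ
  have hψa : ∀ x, ψ x = slice θ (coaction K t x) := fun x => rfl
  refine isCocycleDeformation_of_bijective ψ.symm ?_ ?_ can_comul_bijective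
    (can_coaction_bijective t)
  · rw [LinearEquiv.symm_apply_eq, hψa, map_one, Algebra.TensorProduct.one_def, slice_tmul, h1,
      one_smul]
  · intro x
    obtain ⟨y, rfl⟩ := ψ.surjective x
    rw [LinearEquiv.symm_apply_apply, hψa, comul_slice_coaction (coassoc_coaction_W t)]
    exact ((ψ.rTensor (H K)).symm_apply_apply _).symm

end Field

/-! ### Galois extensions of an algebraically closed field with group `S3` -/

section Separable

variable {K : Type*} [Field K] {B : Type*} [Ring B] [Algebra K B]

/-- An algebra with a separability idempotent is semisimple: linear projections can be averaged. -/
theorem isSemisimpleRing_of_separabilityIdempotent (z : B ⊗[K] B)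
    (hz : ∀ b : B, (b ⊗ₜ 1) * z = z * (1 ⊗ₜ b)) (h1 : LinearMap.mul' K B z = 1) :
    IsSemisimpleRing B := by
  refine isSemisimpleModule_iff B B |>.2 ⟨fun p => ?_⟩
  obtain ⟨π, hπ⟩ := (p.restrictScalars K).subtype.exists_leftInverse_of_injective
    (LinearMap.ker_eq_bot.2 (Submodule.injective_subtype _))
  have hπ' : ∀ x (hx : x ∈ p), ((p.restrictScalars K).subtype ∘ₗ π) x = x := fun x hx =>
    congrArg Subtype.val (LinearMap.congr_fun hπ ⟨x, hx⟩)
  -- `x ⊗ y ↦ x π(y b)`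
  set Q : B → B ⊗[K] B →ₗ[K] B := fun b => LinearMap.mul' K B ∘ₗ
    (((p.restrictScalars K).subtype ∘ₗ π) ∘ₗ LinearMap.mulRight K b).lTensor B with hQ
  have hQt : ∀ b x y, Q b (x ⊗ₜ y) = x * ((p.restrictScalars K).subtype ∘ₗ π) (y * b) :=
    fun b x y => rfl
  have hmem : ∀ b u, Q b u ∈ p := by
    intro b u
    induction u using TensorProduct.induction_on with
    | zero => simp
    | add u v hu hv => rw [map_add]; exact p.add_mem hu hv
    | tmul x y => rw [hQt]; exact p.smul_mem x (π (y * b)).2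
  have hadd : ∀ b b' u, Q (b + b') u = Q b u + Q b' u := by
    intro b b' u
    induction u using TensorProduct.induction_on with
    | zero => simp
    | add u v hu hv => rw [map_add, hu, hv, map_add, map_add]; abel
    | tmul x y => rw [hQt, hQt, hQt, mul_add, map_add, mul_add]
  have hmul : ∀ b b' u, Q (b' * b) u = Q b (u * (1 ⊗ₜ b')) := by
    intro b b' u
    induction u using TensorProduct.induction_on with
    | zero => simp
    | add u v hu hv => rw [map_add, hu, hv, add_mul, map_add]
    | tmul x y => rw [Algebra.TensorProduct.tmul_mul_tmul, hQt, hQt, mul_one, mul_assoc]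
  have hmul' : ∀ b b' u, Q b ((b' ⊗ₜ 1) * u) = b' * Q b u := by
    intro b b' u
    induction u using TensorProduct.induction_on with
    | zero => simp
    | add u v hu hv => rw [mul_add, map_add, hu, hv, map_add, mul_add]
    | tmul x y => rw [Algebra.TensorProduct.tmul_mul_tmul, hQt, hQt, one_mul, mul_assoc]
  have hid : ∀ b ∈ p, ∀ u, Q b u = LinearMap.mul' K B u * b := by
    intro b hb u
    induction u using TensorProduct.induction_on with
    | zero => simp
    | add u v hu hv => rw [map_add, hu, hv, map_add, add_mul]
    | tmul x y =>
      have hyb : y * b ∈ p := p.smul_mem y hb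
      rw [hQt, hπ' _ hyb, LinearMap.mul'_apply, mul_assoc]
  let f : B →ₗ[B] p :=
    { toFun := fun b => ⟨Q b z, hmem b z⟩
      map_add' := fun b b' => Subtype.ext (hadd b b' z)
      map_smul' := fun b' b => Subtype.ext (by
        change Q (b' * b) z = b' * Q b z
        rw [hmul, ← hz, hmul']) }
  refine ⟨LinearMap.ker f, LinearMap.isCompl_of_proj (f := f) fun x => Subtype.ext ?_⟩
  change Q x z = x
  rw [hid x x.2, h1, one_mul]

/-- A sum of squares of positive integers can only be `6` if one of the integers is `1`. -/
theorem exists_algHom_of_finrank_eq_six [IsAlgClosed K] [IsSemisimpleRing B]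
    (h6 : Module.finrank K B = 6) : Nonempty (B →ₐ[K] K) := by
  have : FiniteDimensional K B := FiniteDimensional.of_finrank_pos (by omega)
  obtain ⟨n, d, hd, ⟨F⟩⟩ := IsSemisimpleRing.exists_algEquiv_pi_matrix_of_isAlgClosed K B
  have hsum : ∑ i, d i * d i = 6 := by
    rw [← h6, F.toLinearEquiv.finrank_eq, Module.finrank_pi_fintype]
    refine Finset.sum_congr rfl fun i _ => ?_
    rw [Module.finrank_matrix]
    simp
  have h1 : ∃ i, d i = 1 := by
    by_contra! hne
    have h2 : ∀ i, d i = 2 := by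
      intro i
      have h0 : d i ≠ 0 := (hd i).out
      have hle : d i * d i ≤ 6 := hsum ▸ Finset.single_le_sum
        (f := fun i => d i * d i) (fun _ _ => Nat.zero_le _) (Finset.mem_univ i)
      have : d i < 3 := by
        by_contra! h3
        nlinarith
      have := hne i
      omega
    simp only [h2, Finset.sum_const, Finset.card_univ, Fintype.card_fin, smul_eq_mul] at hsum
    omega
  obtain ⟨i, hi⟩ := h1
  have j : Fin (d i) := ⟨0, by omega⟩
  have hj : ∀ k : Fin (d i), k = j := fun k => by
    apply Fin.ext
    have := k.2
    have := j.2
    omega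
  refine ⟨((AlgHom.ofLinearMap (Matrix.entryLinearMap K K j j) (by simp) ?_).comp
    (Pi.evalAlgHom K _ i)).comp F.toAlgHom⟩
  intro M N
  simp only [Matrix.entryLinearMap_apply, Matrix.mul_apply]
  rw [Finset.sum_eq_single j (fun k _ hk => absurd (hj k) hk) (by simp)]

/-- The Galois map `x ⊗ y ↦ (s ↦ x · s(y))` of an algebra with an action of `S3`. -/
def groupCan (act : S3 → B →ₐ[K] B) : B ⊗[K] B →ₗ[K] (S3 → B) :=
  LinearMap.pi fun s => LinearMap.mul' K B ∘ₗ (act s).toLinearMap.lTensor B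

theorem groupCan_tmul (act : S3 → B →ₐ[K] B) (x y : B) (s : S3) :
    groupCan act (x ⊗ₜ y) s = x * act s y := rfl

theorem groupCan_left (act : S3 → B →ₐ[K] B) (b : B) (z : B ⊗[K] B) (s : S3) :
    groupCan act ((b ⊗ₜ 1) * z) s = b * groupCan act z s := by
  induction z using TensorProduct.induction_on with
  | zero => simp
  | add u v hu hv => rw [mul_add, map_add, map_add, Pi.add_apply, Pi.add_apply, hu, hv, mul_add]
  | tmul x y => rw [Algebra.TensorProduct.tmul_mul_tmul, groupCan_tmul, groupCan_tmul, one_mul,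
      mul_assoc]

theorem groupCan_right (act : S3 → B →ₐ[K] B) (b : B) (z : B ⊗[K] B) (s : S3) :
    groupCan act (z * (1 ⊗ₜ b)) s = groupCan act z s * act s b := by
  induction z using TensorProduct.induction_on with
  | zero => simp
  | add u v hu hv => rw [add_mul, map_add, map_add, Pi.add_apply, Pi.add_apply, hu, hv, add_mul]
  | tmul x y => rw [Algebra.TensorProduct.tmul_mul_tmul, groupCan_tmul, groupCan_tmul, mul_one,
      map_mul, mul_assoc]

/-- A Galois extension of an algebraically closed field with group `S3` is the algebra of functions
on `S3`. It is separable and has dimension `6`, so it has a character. -/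
theorem exists_idempotents [IsAlgClosed K] (h6 : Module.finrank K B = 6) (act : S3 → B →ₐ[K] B)
    (h1 : act 1 = AlgHom.id K B) (hm : ∀ s t b, act s (act t b) = act (s * t) b)
    (hinj : Function.Injective (groupCan act)) :
    ∃ E : S3 → B, (∀ g h, E g * E h = if g = h then E g else 0) ∧ ∑ g, E g = 1 ∧
      ∀ s g, act s (E g) = E (g * s⁻¹) := by
  have hfd : FiniteDimensional K B := FiniteDimensional.of_finrank_pos (by omega)
  have hsurj : Function.Surjective (groupCan act) := by
    refine (LinearMap.injective_iff_surjective_of_finrank_eq_finrank ?_).1 hinj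
    rw [Module.finrank_tensorProduct, Module.finrank_pi_fintype, Finset.sum_const,
      Finset.card_univ, Fintype.card_perm, h6]
    rfl
  -- `z 1` is a separability idempotent, and the `E g` are obtained from the `z g` by applying a
  -- character to the left tensor factor
  choose z hz using fun s : S3 => hsurj (Pi.single s 1)
  have : IsSemisimpleRing B := by
    refine isSemisimpleRing_of_separabilityIdempotent (z 1) (fun b => hinj ?_) ?_
    · funext s
      rw [groupCan_left, groupCan_right, hz]
      by_cases hs : s = 1
      · subst hs; simp [h1]
      · simp [hs]
    · have : groupCan act (z 1) 1 = 1 := by rw [hz]; simp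
      rw [← this]
      simp only [groupCan, LinearMap.pi_apply, h1, LinearMap.comp_apply]
      exact congrArg _ (LinearMap.congr_fun (LinearMap.lTensor_id B B) (z 1)).symm
  obtain ⟨χ⟩ := exists_algHom_of_finrank_eq_six (K := K) (B := B) h6
  set P : B ⊗[K] B →ₗ[K] B := slice χ.toLinearMap with hP
  have hPl : ∀ a u, P ((a ⊗ₜ 1) * u) = χ a • P u := by
    intro a u
    induction u using TensorProduct.induction_on with
    | zero => simp
    | add u v hu hv => rw [mul_add, map_add, map_add, hu, hv, smul_add]
    | tmul x y => simp [hP, mul_smul]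
  have hrec : ∀ b, b = ∑ s, χ (act s b) • P (z s) := by
    intro b
    have : ∑ s, (act s b ⊗ₜ[K] (1 : B)) * z s = 1 ⊗ₜ b := by
      apply hinj
      funext s'
      rw [groupCan_tmul, map_sum, Finset.sum_apply, Finset.sum_eq_single s']
      · rw [groupCan_left, hz]; simp
      · intro s _ hs
        rw [groupCan_left, hz, Pi.single_eq_of_ne hs.symm, mul_zero]
      · simp
    have h2 := congrArg P this
    rw [map_sum] at h2
    simp_rw [hPl] at h2
    rw [h2]
    simp [hP]
  -- the isomorphism with the algebra of functions on `S3`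
  set Ψ : B →ₗ[K] (S3 → K) := LinearMap.pi fun s => χ.toLinearMap ∘ₗ (act s).toLinearMap with hΨ
  have hΨa : ∀ b s, Ψ b s = χ (act s b) := fun b s => rfl
  have hΨi : Function.Injective Ψ := by
    intro b b' hb
    rw [hrec b, hrec b']
    exact Finset.sum_congr rfl fun s _ => by rw [← hΨa, ← hΨa, hb]
  have hΨs : Function.Surjective Ψ := by
    refine (LinearMap.injective_iff_surjective_of_finrank_eq_finrank ?_).1 hΨi
    rw [h6, Module.finrank_fintype_fun_eq_card, Fintype.card_perm]
    rfl
  have hE : ∀ g s, χ (act s (P (z g))) = if s = g then 1 else 0 := by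
    intro g s
    obtain ⟨b, hb⟩ := hΨs (Pi.single g 1)
    have h2 := hrec b
    simp_rw [← hΨa, hb] at h2
    rw [Finset.sum_eq_single g (fun s _ hs => by rw [Pi.single_eq_of_ne hs, zero_smul]) (by simp),
      Pi.single_eq_same, one_smul] at h2
    rw [← h2, ← hΨa, hb, Pi.single_apply]
  refine ⟨fun g => P (z g), fun g h => hΨi ?_, hΨi ?_, fun s g => hΨi ?_⟩
  · funext s
    rw [hΨa, map_mul, map_mul, hE, hE]
    by_cases hg : g = h
    · subst hg
      rw [if_pos rfl, hΨa, hE]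
      split_ifs <;> simp
    · rw [if_neg hg, map_zero]
      split_ifs with h3 h4
      · exact absurd (h3.symm.trans h4) hg
      all_goals simp
  · funext s
    rw [hΨa, map_sum, map_sum]
    simp_rw [hE]
    simp [hΨa]
  · funext r
    rw [hΨa, hm, hE, hΨa, hE]
    simp only [eq_mul_inv_iff_mul_eq]

end Separable

/-! ### Every cocycle deformation is some `W_λ` -/

section Classification

variable {K : Type*} [Field K] {W : Type*} [Ring W] [Algebra K W]

variable (K) in
/-- The character of `H` that sends `e_g` to `δ_{g,s}` and `x_i` to `0`. -/
def evalAt (s : S3) : H K →ₐ[K] K :=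
  lift (t := 0) (E := fun g => if g = s then 1 else 0) (X := fun _ => 0)
    { mul_e := fun g h => by
        by_cases h1 : g = h
        · subst h1; by_cases h2 : g = s <;> simp [h2]
        · have h2 : ¬(g = s ∧ h = s) := fun h2 => h1 (h2.1.trans h2.2.symm)
          rw [if_neg h1, ite_zero_mul_ite_zero, if_neg h2]
      sum_e := by simp
      comm := fun g i => by simp
      sq := fun i => by simp
      cyc := by simp
      cyc' := by simp }

@[simp] theorem evalAt_e (s g : S3) : evalAt K s (e K 0 g) = if g = s then 1 else 0 := lift_e _ g

@[simp] theorem evalAt_w (s : S3) (i : Fin 3) : evalAt K s (w K 0 i) = 0 := lift_x _ i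

/-- The action of `S3` on a comodule algebra through the characters `evalAt s` of `H`. -/
def charAct (ρ : W →ₐ[K] W ⊗[K] H K) (s : S3) : W →ₐ[K] W :=
  (Algebra.TensorProduct.rid K K W).toAlgHom.comp
    ((Algebra.TensorProduct.map (AlgHom.id K W) (evalAt K s)).comp ρ)

theorem charAct_apply_of_eq {ρ : W →ₐ[K] W ⊗[K] H K} {x : W} {y : S3 → W}
    (h : ρ x = ∑ s, y s ⊗ₜ e K 0 s) (s : S3) : charAct ρ s x = y s := by
  simp [charAct, h]

/-- The subalgebra of the elements with coaction in the tensor product with the span of the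
`e_s`. -/
def baseAlg (ρ : W →ₐ[K] W ⊗[K] H K) : Subalgebra K W where
  carrier := {x | ρ x = ∑ s, charAct ρ s x ⊗ₜ e K 0 s}
  mul_mem' {x y} hx hy := by
    rw [Set.mem_ofPred_eq] at *
    rw [map_mul, hx, hy, Finset.sum_mul_sum]
    refine Finset.sum_congr rfl fun s _ => ?_
    rw [Finset.sum_eq_single s]
    · rw [Algebra.TensorProduct.tmul_mul_tmul, isRep.mul_e, if_pos rfl, map_mul]
    · intro s' _ hs
      rw [Algebra.TensorProduct.tmul_mul_tmul, isRep.mul_e, if_neg hs.symm, TensorProduct.tmul_zero]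
    · simp
  add_mem' {x y} hx hy := by
    rw [Set.mem_ofPred_eq] at *
    simp only [map_add, TensorProduct.add_tmul, Finset.sum_add_distrib, hx.symm, hy.symm]
  algebraMap_mem' r := by
    rw [Set.mem_ofPred_eq]
    simp only [AlgHom.commutes]
    rw [← TensorProduct.tmul_sum, isRep.sum_e, Algebra.TensorProduct.algebraMap_apply]

theorem mem_baseAlg {ρ : W →ₐ[K] W ⊗[K] H K} {x : W} :
    x ∈ baseAlg ρ ↔ ρ x = ∑ s, charAct ρ s x ⊗ₜ e K 0 s := Iff.rfl

section

variable {ρ : W →ₐ[K] W ⊗[K] H K} {φ : H K ≃ₗ[K] W}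
  (hc : ∀ x : H K, ρ (φ x) = φ.toLinearMap.rTensor (H K) (Coalgebra.comul x))
include hc

theorem coaction_map_e (g : S3) : ρ (φ (e K 0 g)) = ∑ s, φ (e K 0 (g * s⁻¹)) ⊗ₜ e K 0 s := by
  rw [hc, comul_eq, coaction_e, coE, map_sum,
    ← Equiv.sum_comp ((Equiv.inv S3).trans (Equiv.mulLeft g))]
  refine Finset.sum_congr rfl fun s _ => ?_
  simp

theorem charAct_map_e (s g : S3) : charAct ρ s (φ (e K 0 g)) = φ (e K 0 (g * s⁻¹)) :=
  charAct_apply_of_eq (coaction_map_e hc g) s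

theorem map_e_mem_baseAlg (g : S3) : φ (e K 0 g) ∈ baseAlg ρ := by
  rw [mem_baseAlg, coaction_map_e hc]
  simp only [charAct_map_e hc]

/-- The identity `x = ε(x₁) x₂`, transported from `H`. -/
theorem eq_sum_of_coaction_eq {x : W} {y : S3 → W} (h : ρ x = ∑ s, y s ⊗ₜ e K 0 s) :
    φ.symm x = ∑ s, counit K (φ.symm (y s)) • e K 0 s := by
  obtain ⟨v, rfl⟩ := φ.surjective x
  have h2 := congrArg (φ.symm.toLinearMap.rTensor (H K)) h
  rw [hc, ← LinearMap.comp_apply, ← LinearMap.rTensor_comp, map_sum] at h2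
  have h3 : φ.symm.toLinearMap ∘ₗ φ.toLinearMap = LinearMap.id := by ext; simp
  rw [h3, LinearMap.rTensor_id, LinearMap.id_apply] at h2
  have h4 := congrArg (fun z => TensorProduct.lid K (H K) (Coalgebra.counit.rTensor (H K) z)) h2
  simp only [Coalgebra.rTensor_counit_comul, map_sum, LinearMap.rTensor_tmul,
    TensorProduct.lid_tmul, one_smul] at h4
  rw [LinearEquiv.symm_apply_apply, h4]
  rfl

theorem baseAlg_toSubmodule :
    Subalgebra.toSubmodule (baseAlg ρ) = Submodule.span K (Set.range fun g => φ (e K 0 g)) := by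
  refine le_antisymm (fun x hx => ?_) (Submodule.span_le.2 ?_)
  · have h := eq_sum_of_coaction_eq hc (mem_baseAlg.1 hx)
    rw [LinearEquiv.symm_apply_eq] at h
    rw [h, map_sum]
    refine Submodule.sum_mem _ fun s _ => ?_
    rw [map_smul]
    exact Submodule.smul_mem _ _ (Submodule.subset_span ⟨s, rfl⟩)
  · rintro _ ⟨g, rfl⟩
    exact map_e_mem_baseAlg hc g

/-- The subalgebra `baseAlg ρ` corresponds to the span of the `e_g` in `H`, hence has dimension
`6`. -/
theorem finrank_baseAlg : Module.finrank K (baseAlg ρ) = 6 := by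
  have h : LinearIndependent K (fun g => φ (e K 0 g)) :=
    (e_linearIndependent (0 : Fin 3 → K)).map' φ.toLinearMap φ.ker
  rw [← Subalgebra.finrank_toSubmodule, baseAlg_toSubmodule hc, finrank_span_eq_card h,
    Fintype.card_perm]
  rfl

theorem baseAlg_induction {P : W → Prop} (he : ∀ g, P (φ (e K 0 g)))
    (ha : ∀ x y, P x → P y → P (x + y)) (hs : ∀ (r : K) x, P x → P (r • x)) {x : W}
    (hx : x ∈ baseAlg ρ) : P x := by
  rw [← Subalgebra.mem_toSubmodule, baseAlg_toSubmodule hc] at hx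
  induction hx using Submodule.span_induction with
  | mem x hx => obtain ⟨g, rfl⟩ := hx; exact he g
  | zero => simpa using hs 0 _ (he 1)
  | add x y _ _ hx hy => exact ha x y hx hy
  | smul r x _ hx => exact hs r x hx

theorem charAct_mem_baseAlg (s : S3) {x : W} (hx : x ∈ baseAlg ρ) : charAct ρ s x ∈ baseAlg ρ := by
  refine baseAlg_induction hc (P := fun x => charAct ρ s x ∈ baseAlg ρ) (fun g => ?_)
    (fun x y hx hy => ?_) (fun r x hx => ?_) hx
  · rw [charAct_map_e hc]; exact map_e_mem_baseAlg hc _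
  · rw [map_add]; exact add_mem hx hy
  · rw [map_smul]; exact Subalgebra.smul_mem _ hx r

/-- The subalgebra `baseAlg ρ` is the algebra of functions on an `S3`-torsor, which is trivial. -/
theorem exists_idempotents_coaction [IsAlgClosed K] (hinj : Function.Injective (can ρ)) :
    ∃ E : S3 → W, (∀ g h, E g * E h = if g = h then E g else 0) ∧ ∑ g, E g = 1 ∧
      ∀ g, ρ (E g) = ∑ k, E k ⊗ₜ e K 0 (k⁻¹ * g) := by
  obtain ⟨act, hacta⟩ : ∃ act : S3 → baseAlg ρ →ₐ[K] baseAlg ρ,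
      ∀ s x, (act s x : W) = charAct ρ s x :=
    ⟨fun s => ((charAct ρ s).comp (baseAlg ρ).val).codRestrict (baseAlg ρ)
      fun x => charAct_mem_baseAlg hc s x.2, fun s x => rfl⟩
  have h6 := finrank_baseAlg hc
  have hact1 : act 1 = AlgHom.id K (baseAlg ρ) := by
    refine AlgHom.ext fun x => Subtype.ext ?_
    rw [hacta, AlgHom.id_apply]
    refine baseAlg_induction hc (P := fun x => charAct ρ 1 x = x) (fun g => ?_)
      (fun x y hx hy => ?_) (fun r x hx => ?_) x.2
    · rw [charAct_map_e hc, inv_one, mul_one]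
    · rw [map_add, hx, hy]
    · rw [map_smul, hx]
  have hactm : ∀ s t b, act s (act t b) = act (s * t) b := by
    intro s t x
    apply Subtype.ext
    rw [hacta, hacta, hacta]
    refine baseAlg_induction hc
      (P := fun x => charAct ρ s (charAct ρ t x) = charAct ρ (s * t) x) (fun g => ?_)
      (fun x y hx hy => ?_) (fun r x hx => ?_) x.2
    · rw [charAct_map_e hc, charAct_map_e hc, charAct_map_e hc, mul_inv_rev, mul_assoc]
    · simp only [map_add, hx, hy]
    · simp only [map_smul, hx]
  have hactc : Function.Injective (groupCan act) := by
    have hcan : ∀ z, can ρ (TensorProduct.map (baseAlg ρ).val.toLinearMap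
        (baseAlg ρ).val.toLinearMap z) = ∑ s, (groupCan act z s : W) ⊗ₜ e K 0 s := by
      intro z
      induction z using TensorProduct.induction_on with
      | zero => simp
      | add u v hu hv =>
        simp only [map_add, hu, hv, Pi.add_apply, Subalgebra.coe_add, TensorProduct.add_tmul,
          Finset.sum_add_distrib]
      | tmul x y =>
        rw [TensorProduct.map_tmul, can_tmul]
        change _ * ρ (y : W) = _
        rw [mem_baseAlg.1 y.2, Finset.mul_sum]
        refine Finset.sum_congr rfl fun s _ => ?_
        rw [Algebra.TensorProduct.tmul_mul_tmul, one_mul, groupCan_tmul, Subalgebra.coe_mul, hacta]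
        rfl
    have hval : Function.Injective (baseAlg ρ).val.toLinearMap := Subtype.val_injective
    refine LinearMap.ker_eq_bot.1 (LinearMap.ker_eq_bot'.2 fun z hz => ?_)
    have h0 := hcan z
    rw [hz] at h0
    refine TensorProduct.map_injective_of_flat_flat _ _ hval hval (hinj ?_)
    rw [h0, map_zero, map_zero]
    simp
  obtain ⟨E, hE, hE1, hEs⟩ := exists_idempotents (B := baseAlg ρ) h6 act hact1 hactm hactc
  refine ⟨fun g => E g, fun g h => ?_, ?_, fun g => ?_⟩
  · rw [← Subalgebra.coe_mul, hE]
    split_ifs <;> rfl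
  · rw [← AddSubmonoidClass.coe_finsetSum, hE1]
    rfl
  · rw [mem_baseAlg.1 (E g).2, ← Equiv.sum_comp ((Equiv.inv S3).trans (Equiv.mulRight g))]
    refine Finset.sum_congr rfl fun s _ => ?_
    rw [← hacta, hEs]
    simp

/-- A comodule map on the span of the `e_g` extends to `H`. -/
theorem exists_comodule_map {E : S3 → W} (hE : ∀ g, ρ (E g) = ∑ k, E k ⊗ₜ e K 0 (k⁻¹ * g)) :
    ∃ F : H K →ₗ[K] W, (∀ g, F (e K 0 g) = E g) ∧
      ∀ x, ρ (F x) = F.rTensor (H K) (Coalgebra.comul x) := by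
  set η : H K →ₗ[K] K := ∑ g, counit K (φ.symm (E g)) •
    (LinearMap.proj 0 ∘ₗ LinearMap.proj g ∘ₗ coord (0 : Fin 3 → K)) with hη
  have hηe : ∀ g, η (e K 0 g) = counit K (φ.symm (E g)) := by
    intro g
    simp only [hη, LinearMap.sum_apply, LinearMap.smul_apply, LinearMap.comp_apply, coord_e,
      LinearMap.proj_apply]
    rw [Finset.sum_eq_single g]
    · simp
    · intro h _ hh
      simp [hh]
    · simp
  refine ⟨φ.toLinearMap ∘ₗ leftTwist η, fun g => ?_, fun x => ?_⟩
  · rw [LinearMap.comp_apply, LinearEquiv.coe_coe, ← LinearEquiv.eq_symm_apply,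
      eq_sum_of_coaction_eq hc (y := fun s => E (g * s⁻¹)) (x := E g)]
    · simp only [leftTwist, LinearMap.comp_apply, comul_eq, coaction_e, coE, map_sum,
        LinearMap.rTensor_tmul, hηe, LinearEquiv.coe_coe, TensorProduct.lid_tmul]
      rw [← Equiv.sum_comp ((Equiv.inv S3).trans (Equiv.mulLeft g))]
      refine Finset.sum_congr rfl fun s _ => ?_
      simp
    · rw [hE, ← Equiv.sum_comp ((Equiv.inv S3).trans (Equiv.mulLeft g))]
      refine Finset.sum_congr rfl fun s _ => ?_
      simp
  · have h := LinearMap.congr_fun (comul_comp_leftTwist η) x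
    rw [LinearMap.comp_apply, LinearMap.comp_apply] at h
    rw [LinearMap.comp_apply, LinearEquiv.coe_coe, hc, h, LinearMap.rTensor_comp,
      LinearMap.comp_apply]

end

/-- The sum of all `E_k ⊗ e_l` with `k l = g`. -/
def genE (E : S3 → W) (g : S3) : W ⊗[K] H K := ∑ k : S3, E k ⊗ₜ[K] e K 0 (k⁻¹ * g)

/-- The sum over `g` of `E_g ⊗ (g⁻¹ · x_i)`. -/
def genQ (E : S3 → W) (i : Fin 3) : W ⊗[K] H K := ∑ g : S3, sgn K g • (E g ⊗ₜ[K] w K 0 (g⁻¹ i))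

/-- Moving the first order part of a coaction past `X j` reflects its index by `tr j`, with the sign
of the braiding. -/
theorem genQ_mul_tmul {E : S3 → W} {X : Fin 3 → W}
    (hcomm : ∀ g i, E g * X i = X i * E (tr i * g)) (i j : Fin 3) :
    genQ (K := K) E i * (X j ⊗ₜ[K] 1) = -((X j ⊗ₜ[K] 1) * genQ E (tr j i)) := by
  unfold genQ
  rw [Finset.sum_mul, Finset.mul_sum, ← Finset.sum_neg_distrib,
    ← Equiv.sum_comp (Equiv.mulLeft (tr j))]
  refine Finset.sum_congr rfl fun g _ => ?_
  simp only [Equiv.coe_mulLeft, smul_mul_assoc, mul_smul_comm,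
    Algebra.TensorProduct.tmul_mul_tmul, hcomm, one_mul, mul_one, sgn_mul, sgn_tr]
  rw [← mul_assoc (tr j), tr_mul_self, one_mul, mul_inv_rev, neg_mul, one_mul, neg_smul, tr_inv,
    Equiv.Perm.mul_apply]

theorem coaction_mul {E : S3 → W} {X : Fin 3 → W}
    (hcomm : ∀ g i, E g * X i = X i * E (tr i * g)) {ρ : W →ₐ[K] W ⊗[K] H K}
    (hX : ∀ i, ρ (X i) = X i ⊗ₜ 1 + genQ E i) (i j : Fin 3) : ρ (X i * X j) =
    (X i * X j) ⊗ₜ[K] 1 + (X i ⊗ₜ[K] 1) * genQ E j -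
      (X j ⊗ₜ[K] 1) * genQ E (tr j i) + genQ E i * genQ E j := by
  rw [map_mul, hX, hX, add_mul, mul_add, mul_add, genQ_mul_tmul hcomm,
    Algebra.TensorProduct.tmul_mul_tmul, one_mul]
  abel

section

variable {E : S3 → W} (hE : ∀ g h, E g * E h = if g = h then E g else 0)
include hE

theorem genQ_mul_genQ (i j : Fin 3) : genQ (K := K) E i * genQ E j =
    ∑ g : S3, E g ⊗ₜ[K] (w K 0 (g⁻¹ i) * w K 0 (g⁻¹ j)) := by
  unfold genQ
  rw [Finset.sum_mul_sum]
  refine Finset.sum_congr rfl fun g _ => ?_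
  rw [Finset.sum_eq_single g]
  · rw [smul_mul_smul_comm, sgn_mul_self, one_smul, Algebra.TensorProduct.tmul_mul_tmul,
      hE, if_pos rfl]
  · intro h _ hh
    rw [smul_mul_smul_comm, Algebra.TensorProduct.tmul_mul_tmul, hE, if_neg hh.symm,
      TensorProduct.zero_tmul, smul_zero]
  · simp

theorem genE_mul_genQ (i : Fin 3) (g : S3) : genE (K := K) E g * genQ E i =
    genQ E i * genE E (tr i * g) := by
  unfold genE genQ
  rw [Finset.sum_mul_sum, Finset.sum_mul_sum]
  refine Finset.sum_congr rfl fun k _ => ?_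
  rw [Finset.sum_eq_single k, Finset.sum_eq_single k]
  · rw [mul_smul_comm, smul_mul_assoc, Algebra.TensorProduct.tmul_mul_tmul,
      Algebra.TensorProduct.tmul_mul_tmul, e_mul_x, hE, if_pos rfl, ← mul_assoc,
      tr_smul, mul_assoc]
  · intro h _ hh
    rw [smul_mul_assoc, Algebra.TensorProduct.tmul_mul_tmul, hE, if_neg hh.symm,
      TensorProduct.zero_tmul, smul_zero]
  · simp
  · intro h _ hh
    rw [mul_smul_comm, Algebra.TensorProduct.tmul_mul_tmul, hE, if_neg hh.symm,
      TensorProduct.zero_tmul, smul_zero]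
  · simp

/-- The elements `Σ_g E_g X E_{tr i g}` have the coaction of the generators `w_i`. -/
theorem coaction_homogenized {ρ : W →ₐ[K] W ⊗[K] H K} (hE1 : ∑ g, E g = 1)
    (hρ : ∀ g, ρ (E g) = genE E g) {i : Fin 3} {X : W} (hX : ρ X = X ⊗ₜ 1 + genQ E i) :
    ρ (∑ g, E g * X * E (tr i * g)) = (∑ g, E g * X * E (tr i * g)) ⊗ₜ 1 + genQ E i := by
  have hEE : ∀ g, genE (K := K) E g * genE E g = genE E g := fun g => by
    rw [← hρ, ← map_mul, hE, if_pos rfl]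
  have hE1' : ∑ g, genE (K := K) E (tr i * g) = 1 := by
    refine (Equiv.sum_comp (Equiv.mulLeft (tr i)) (genE (K := K) E)).trans ?_
    rw [← map_one ρ, ← hE1, map_sum]
    exact Finset.sum_congr rfl fun g _ => (hρ _).symm
  simp only [map_sum, map_mul, hρ, hX, mul_add, add_mul, Finset.sum_add_distrib]
  congr 1
  · rw [TensorProduct.sum_tmul]
    have key : ∀ g, genE E g * X ⊗ₜ[K] (1 : H K) * genE E (tr i * g) =
        ∑ k, (E k * X * E (tr i * k)) ⊗ₜ e K 0 (k⁻¹ * g) := by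
      intro g
      unfold genE
      rw [Finset.sum_mul, Finset.sum_mul_sum]
      refine Finset.sum_congr rfl fun k _ => ?_
      rw [Finset.sum_eq_single (tr i * k)]
      · rw [Algebra.TensorProduct.tmul_mul_tmul, Algebra.TensorProduct.tmul_mul_tmul, mul_one,
          isRep.mul_e, if_pos (by rw [mul_inv_rev, mul_assoc, inv_mul_cancel_left])]
      · intro l _ hl
        rw [Algebra.TensorProduct.tmul_mul_tmul, Algebra.TensorProduct.tmul_mul_tmul, mul_one,
          isRep.mul_e, if_neg, TensorProduct.tmul_zero]
        intro h
        apply hl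
        rw [← mul_assoc, mul_left_inj, inv_eq_iff_eq_inv, mul_inv_rev, inv_inv, tr_inv] at h
        rw [h, ← mul_assoc, tr_mul_self, one_mul]
      · simp
    simp_rw [key]
    rw [Finset.sum_comm]
    refine Finset.sum_congr rfl fun k _ => ?_
    rw [← TensorProduct.tmul_sum, ← isRep.sum_e (t := (0 : Fin 3 → K))]
    congr 1
    exact Equiv.sum_comp (Equiv.mulLeft k⁻¹) (e K 0)
  · simp_rw [genE_mul_genQ hE, mul_assoc, hEE]
    rw [← Finset.mul_sum, hE1', mul_one]

variable {X : Fin 3 → W} (hcomm : ∀ g i, E g * X i = X i * E (tr i * g))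
include hcomm

variable {ρ : W →ₐ[K] W ⊗[K] H K} (hX : ∀ i, ρ (X i) = X i ⊗ₜ 1 + genQ E i)
include hX

/-- The squares of the generators are coinvariant, as the braided commutators in `coaction_mul`
cancel. -/
theorem coaction_sq (i : Fin 3) : ρ (X i * X i) = (X i * X i) ⊗ₜ 1 := by
  have h0 : ∀ j : Fin 3, w K 0 j * w K 0 j = 0 := fun j => by
    rw [isRep.sq]; simp
  have h1 : tr i i = i := by revert i; decide
  rw [coaction_mul hcomm hX, genQ_mul_genQ hE, h1]
  simp only [h0, TensorProduct.tmul_zero, Finset.sum_const_zero]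
  abel

/-- In the sum of the coactions over a cyclic relation, the two mixed terms cancel each other and
the second order term vanishes by the cyclic relations in `H`. -/
theorem coaction_cyc : ρ (∑ i, X i * X (i + 1)) = (∑ i, X i * X (i + 1)) ⊗ₜ 1 := by
  have h1 : ∀ i, tr (i + 1) i = i + 2 := by decide
  simp_rw [map_sum, coaction_mul hcomm hX, genQ_mul_genQ hE, h1]
  rw [Finset.sum_add_distrib, Finset.sum_sub_distrib, Finset.sum_add_distrib,
    ← TensorProduct.sum_tmul]
  have h2 : ∑ i, (X (i + 1) ⊗ₜ[K] (1 : H K)) * genQ E (i + 2) =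
      ∑ i, (X i ⊗ₜ[K] (1 : H K)) * genQ E (i + 1) := by
    rw [← Equiv.sum_comp (Equiv.addRight (1 : Fin 3))
      (fun i => (X i ⊗ₜ[K] (1 : H K)) * genQ E (i + 1))]
    refine Finset.sum_congr rfl fun i _ => ?_
    have : i + 2 = i + 1 + 1 := by revert i; decide
    simp [this]
  rw [h2, add_sub_cancel_right, add_eq_left, Finset.sum_comm]
  refine Finset.sum_eq_zero fun g _ => ?_
  rw [← TensorProduct.tmul_sum, cyc_perm (fun i j => w K 0 i * w K 0 j) isRep.cyc isRep.cyc' g⁻¹,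
    TensorProduct.tmul_zero]

theorem coaction_cyc' : ρ (∑ i, X (i + 1) * X i) = (∑ i, X (i + 1) * X i) ⊗ₜ 1 := by
  have h1 : ∀ i, tr i (i + 1) = i + 2 := by decide
  simp_rw [map_sum, coaction_mul hcomm hX, genQ_mul_genQ hE, h1]
  rw [Finset.sum_add_distrib, Finset.sum_sub_distrib, Finset.sum_add_distrib,
    ← TensorProduct.sum_tmul]
  have h2 : ∑ i, (X (i + 1) ⊗ₜ[K] (1 : H K)) * genQ E i =
      ∑ i, (X i ⊗ₜ[K] (1 : H K)) * genQ E (i + 2) := by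
    rw [← Equiv.sum_comp (Equiv.addRight (1 : Fin 3))
      (fun i => (X i ⊗ₜ[K] (1 : H K)) * genQ E (i + 2))]
    refine Finset.sum_congr rfl fun i _ => ?_
    have : i + 1 + 2 = i := by revert i; decide
    simp [this]
  rw [h2, add_sub_cancel_right, add_eq_left, Finset.sum_comm]
  refine Finset.sum_eq_zero fun g _ => ?_
  rw [← TensorProduct.tmul_sum, cyc_perm (fun i j => w K 0 j * w K 0 i) isRep.cyc' isRep.cyc g⁻¹,
    TensorProduct.tmul_zero]

end

/-- A scalar of nontrivial degree in `S3` is zero. -/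
theorem algebraMap_eq_zero_of_degree {E : S3 → W}
    (hE : ∀ g h, E g * E h = if g = h then E g else 0) (hE0 : E 1 ≠ 0) {r : S3} (hr : r ≠ 1)
    {x : W} (hx : ∀ g, E g * x = x * E (r * g)) {c : K} (hxc : x = algebraMap K W c) : x = 0 := by
  have h1 : E 1 * x = 0 := by
    have h2 : E 1 * (E 1 * x) = E 1 * x := by rw [← mul_assoc, hE, if_pos rfl]
    have hr' : (1 : S3) ≠ r * 1 := by rw [mul_one]; exact hr.symm
    rw [← h2, hx, hxc, Algebra.commutes, ← mul_assoc, hE, if_neg hr', zero_mul]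
  rw [hxc, ← Algebra.commutes, ← Algebra.smul_def, smul_eq_zero] at h1
  rw [hxc, h1.resolve_right hE0, map_zero]

/-- A comodule algebra that is isomorphic to `H` as a comodule, and for which the Galois map is
injective, is isomorphic to some `W_λ`. -/
theorem exists_comodAlgIso [IsAlgClosed K] {ρ : W →ₐ[K] W ⊗[K] H K} (φ : H K ≃ₗ[K] W)
    (h1 : φ 1 = 1)
    (hc : ∀ x : H K, ρ (φ x) = φ.toLinearMap.rTensor (H K) (Coalgebra.comul x))
    (hinj : Function.Injective (can ρ)) : ∃ t : Fin 3 → K, ComodAlgIso (coaction K t) ρ := by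
  obtain ⟨E, hE, hE1, hρE⟩ := exists_idempotents_coaction hc hinj
  obtain ⟨F, hFe, hF⟩ := exists_comodule_map hc hρE
  -- if one of the `E g` is zero then all are, as `S3` permutes them
  have hE0 : E 1 ≠ 0 := by
    intro h0
    have hE0 : ∀ g, E g = 0 := by
      intro g
      have h2 := congrArg (charAct ρ g⁻¹) h0
      rw [charAct_apply_of_eq (y := fun s => E s⁻¹) (x := E 1), map_zero, inv_inv] at h2
      · exact h2
      · rw [hρE, ← Equiv.sum_comp (Equiv.inv S3)]
        simp
    have h10 : (1 : W) = 0 := by rw [← hE1, Finset.sum_eq_zero fun g _ => hE0 g]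
    rw [← h1, map_eq_zero_iff φ φ.injective, ← isRep.sum_e (t := (0 : Fin 3 → K))] at h10
    refine e_ne_zero (0 : Fin 3 → K) 1 ?_
    have := congrArg (e K 0 1 * ·) h10
    simpa [Finset.mul_sum, isRep.mul_e] using this
  -- the images of the `x_i` have the right coaction; their components of degree `tr i` also have
  -- the right commutation relations with the `E g`
  set X : Fin 3 → W := fun i => ∑ g, E g * F (w K 0 i) * E (tr i * g) with hXdef
  have hcomm : ∀ g i, E g * X i = X i * E (tr i * g) := by
    intro g i
    rw [hXdef]
    simp only [Finset.mul_sum, Finset.sum_mul]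
    rw [Finset.sum_eq_single g, Finset.sum_eq_single g]
    · rw [← mul_assoc, ← mul_assoc, hE, if_pos rfl, mul_assoc (E g * _), hE, if_pos rfl]
    · intro h _ hh
      rw [mul_assoc, hE, if_neg, mul_zero]
      simpa using hh
    · simp
    · intro h _ hh
      rw [← mul_assoc, ← mul_assoc, hE, if_neg hh.symm, zero_mul, zero_mul]
    · simp
  have hX : ∀ i, ρ (X i) = X i ⊗ₜ 1 + genQ E i := by
    intro i
    refine coaction_homogenized hE hE1 hρE ?_
    rw [hF, comul_eq, coaction_x, coX, map_add, LinearMap.rTensor_tmul, coQ, genQ, map_sum]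
    congr 1
    refine Finset.sum_congr rfl fun g _ => ?_
    rw [map_smul, LinearMap.rTensor_tmul, hFe]
  have hXX : ∀ g i j, E g * (X i * X j) = X i * X j * E (tr j * tr i * g) := by
    intro g i j
    rw [← mul_assoc, hcomm, mul_assoc, hcomm, mul_assoc, mul_assoc]
  -- coinvariants are scalars; those of nontrivial degree, as the cyclic sums, are zero
  choose t ht using fun i =>
    exists_algebraMap_of_coinvariant φ h1 hc (coaction_sq hE hcomm hX i)
  have hrep : IsRep t E X :=
    { mul_e := hE
      sum_e := hE1
      comm := hcomm
      sq := ht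
      cyc := by
        obtain ⟨c, hc⟩ := exists_algebraMap_of_coinvariant φ h1 hc (coaction_cyc hE hcomm hX)
        refine algebraMap_eq_zero_of_degree hE hE0 (r := tr 1 * tr 0) (by decide) (fun g => ?_) hc
        have : ∀ i, tr (i + 1) * tr i = tr 1 * tr 0 := by decide
        simp only [Finset.mul_sum, Finset.sum_mul, hXX, this]
      cyc' := by
        obtain ⟨c, hc⟩ := exists_algebraMap_of_coinvariant φ h1 hc (coaction_cyc' hE hcomm hX)
        refine algebraMap_eq_zero_of_degree hE hE0 (r := tr 0 * tr 1) (by decide) (fun g => ?_) hc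
        have : ∀ i, tr i * tr (i + 1) = tr 0 * tr 1 := by decide
        simp only [Finset.mul_sum, Finset.sum_mul, hXX, this] }
  set f : FK.W K t →ₐ[K] W := lift hrep with hf
  have hfc : ∀ x, ρ (f x) = f.toLinearMap.rTensor (H K) (coaction K t x) := by
    have key : ρ.comp f =
        (Algebra.TensorProduct.map f (AlgHom.id K (H K))).comp (coaction K t) := by
      refine hom_ext (fun g => ?_) (fun i => ?_)
      · simp [hf, hρE, coE]
      · simp [hf, hX, coX, coQ, genQ]
    exact DFunLike.congr_fun key
  -- `f` is injective because its composition with a comodule map `W → H` is bijective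
  obtain ⟨θ, hθ1, hθ⟩ := exists_functional (K := K) hE hE0
  have hbij := slice_coaction_bijective t (θ := θ ∘ₗ f.toLinearMap) (by simp [hθ1])
    (fun g x => by simp [hf, hθ])
  have hslice : ∀ z, slice (H := H K) (θ ∘ₗ f.toLinearMap) z =
      slice θ (f.toLinearMap.rTensor (H K) z) := by
    intro z
    induction z using TensorProduct.induction_on with
    | zero => simp
    | add u v hu hv => simp only [map_add, hu, hv]
    | tmul x y => simp
  have hfi : Function.Injective f := by
    intro x y hxy
    apply hbij.1
    simp only [LinearMap.comp_apply, AlgHom.toLinearMap_apply, hslice, ← hfc, hxy]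
  have : FiniteDimensional K W := Module.Finite.equiv φ
  have hfb : Function.Bijective f := ⟨hfi,
    (LinearMap.injective_iff_surjective_of_finrank_eq_finrank (f := f.toLinearMap)
      (by rw [finrank_W, ← φ.finrank_eq, finrank_W])).1 hfi⟩
  exact ⟨t, AlgEquiv.ofBijective f hfb, hfc⟩

theorem exists_comodAlgIso_of_isCocycleDeformation [IsAlgClosed K] {ρ : W →ₐ[K] W ⊗[K] H K}
    (h : IsCocycleDeformation ρ) : ∃ t : Fin 3 → K, ComodAlgIso (coaction K t) ρ := by
  obtain ⟨α, hα, hdef⟩ := h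
  have hcan := can_bijective_of_isDeformationBy hα.isUnit_conv hdef can_comul_bijective
  obtain ⟨φ, h1, -, hc⟩ := hdef
  exact exists_comodAlgIso φ h1 hc hcan.1

end Classification

/-! ### Isomorphisms between the algebras `W_λ` -/

section Isomorphisms

theorem inv_mul_apply (k m : S3) (i : Fin 3) : (k * m)⁻¹ (k i) = m⁻¹ i := by simp

section PermHom

variable {K : Type*} [CommRing K]

/-- The generators `e_{kg}` and `k · w_i` of `W_λ` satisfy the relations of `W_{λ ∘ k}`. -/
theorem isRep_perm {s t : Fin 3 → K} (k : S3) (h : ∀ i, s i = t (k i)) :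
    IsRep s (fun g => e K t (k * g)) (fun i => sgn K k • w K t (k i)) where
  mul_e g g' := by
    rw [isRep.mul_e]
    simp only [mul_right_inj]
  sum_e := by
    rw [← isRep.sum_e (t := t)]
    exact Equiv.sum_comp (Equiv.mulLeft k) (e K t)
  comm g i := by
    rw [mul_smul_comm, smul_mul_assoc, isRep.comm, ← mul_assoc, tr_smul, mul_assoc]
  sq i := by rw [smul_mul_smul_comm, sgn_mul_self, one_smul, isRep.sq, h]
  cyc := by
    simp_rw [smul_mul_smul_comm, sgn_mul_self, one_smul]
    exact cyc_perm (fun i j => w K t i * w K t j) isRep.cyc isRep.cyc' k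
  cyc' := by
    simp_rw [smul_mul_smul_comm, sgn_mul_self, one_smul]
    exact cyc_perm (fun i j => w K t j * w K t i) isRep.cyc' isRep.cyc k

/-- A permutation `k` of the parameters is realised by `e_g ↦ e_{kg}` and
`w_i ↦ sign(k) w_{k i}`. -/
theorem comodAlgIso_of_perm {s t : Fin 3 → K} (k : S3) (h : ∀ i, s i = t (k i)) :
    ComodAlgIso (coaction K s) (coaction K t) := by
  have h' : ∀ i, t i = s (k⁻¹ i) := fun i => by simp [h]
  refine ⟨AlgEquiv.ofAlgHom (lift (isRep_perm k h)) (lift (isRep_perm k⁻¹ h')) ?_ ?_, ?_⟩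
  · refine hom_ext (fun g => ?_) (fun i => ?_)
    · simp
    · simp [smul_smul, sgn_inv, sgn_mul_self]
  · refine hom_ext (fun g => ?_) (fun i => ?_)
    · simp
    · simp [smul_smul, sgn_inv, sgn_mul_self]
  · have key : (coaction K t).comp (lift (isRep_perm k h)) = (Algebra.TensorProduct.map
        (lift (isRep_perm k h)) (AlgHom.id K (H K))).comp (coaction K s) := by
      refine hom_ext (fun g => ?_) (fun i => ?_)
      · simp only [AlgHom.comp_apply, lift_e, coaction_e, coE, map_sum,
          Algebra.TensorProduct.map_tmul, AlgHom.id_apply]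
        rw [← Equiv.sum_comp (Equiv.mulLeft k)]
        refine Finset.sum_congr rfl fun m _ => ?_
        simp [mul_assoc]
      · simp only [AlgHom.comp_apply, lift_x, map_smul, coaction_x, coX, coQ, map_add, map_sum,
          Algebra.TensorProduct.map_tmul, AlgHom.id_apply, map_one, lift_e, smul_add,
          Finset.smul_sum, TensorProduct.smul_tmul']
        congr 1
        rw [← Equiv.sum_comp (Equiv.mulLeft k)]
        refine Finset.sum_congr rfl fun m _ => ?_
        rw [Equiv.coe_mulLeft, sgn_mul, ← TensorProduct.smul_tmul', ← TensorProduct.smul_tmul',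
          ← TensorProduct.smul_tmul', smul_smul, ← mul_assoc,
          sgn_mul_self, one_mul, inv_mul_apply k m i]
    exact DFunLike.congr_fun key

end PermHom

variable {K : Type*} [Field K]

theorem charAct_coaction_e (t : Fin 3 → K) (s g : S3) :
    charAct (coaction K t) s (e K t g) = e K t (g * s⁻¹) := by
  refine charAct_apply_of_eq (y := fun s => e K t (g * s⁻¹)) ?_ s
  rw [coaction_e, coE, ← Equiv.sum_comp ((Equiv.inv S3).trans (Equiv.mulLeft g))]
  refine Finset.sum_congr rfl fun s _ => ?_
  simp

/-- The span of the `e_g` in `W_λ` is determined by the coaction. -/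
theorem baseAlg_coaction (t : Fin 3 → K) :
    Subalgebra.toSubmodule (baseAlg (coaction K t)) = Submodule.span K (Set.range (e K t)) := by
  obtain ⟨α, -, φ, -, -, hc⟩ := isCocycleDeformation_coaction t
  symm
  apply Submodule.eq_of_le_of_finrank_eq
  · refine Submodule.span_le.2 ?_
    rintro _ ⟨g, rfl⟩
    change e K t g ∈ baseAlg (coaction K t)
    rw [mem_baseAlg]
    simp only [charAct_coaction_e]
    rw [coaction_e, coE, ← Equiv.sum_comp ((Equiv.inv S3).trans (Equiv.mulLeft g))]
    refine Finset.sum_congr rfl fun s _ => ?_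
    simp
  · rw [Subalgebra.finrank_toSubmodule, finrank_baseAlg hc,
      finrank_span_eq_card (e_linearIndependent t), Fintype.card_perm]
    rfl

/-- A comodule algebra isomorphism maps the idempotents `e_g` to a translate of the `e_g`. -/
theorem exists_perm_map_e {s t : Fin 3 → K} (φ : W K s ≃ₐ[K] W K t)
    (hφ : ∀ x, coaction K t (φ x) = φ.toLinearMap.rTensor (H K) (coaction K s x)) :
    ∃ k : S3, ∀ g, φ (e K s g) = e K t (k * g) := by
  have hco : ∀ g, coaction K t (φ (e K s g)) = ∑ r, φ (e K s (g * r⁻¹)) ⊗ₜ e K 0 r := by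
    intro g
    rw [hφ, coaction_e, coE, map_sum,
      ← Equiv.sum_comp ((Equiv.inv S3).trans (Equiv.mulLeft g))]
    refine Finset.sum_congr rfl fun s _ => ?_
    simp
  have hact : ∀ r g, charAct (coaction K t) r (φ (e K s g)) = φ (e K s (g * r⁻¹)) := fun r g =>
    charAct_apply_of_eq (hco g) r
  have hmem : φ (e K s 1) ∈ Submodule.span K (Set.range (e K t)) := by
    rw [← baseAlg_coaction, Subalgebra.mem_toSubmodule, mem_baseAlg, hco]
    simp only [hact]
  obtain ⟨c, hc⟩ := (Submodule.mem_span_range_iff_exists_fun K).1 hmem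
  have hcg : ∀ g, φ (e K s g) = ∑ h, c h • e K t (h * g) := by
    intro g
    have h := hact g⁻¹ 1
    rw [inv_inv, one_mul] at h
    rw [← h, ← hc, map_sum]
    refine Finset.sum_congr rfl fun h _ => ?_
    rw [map_smul, charAct_coaction_e, inv_inv]
  -- `φ (e_1)` is the function `c` on `S3`, an idempotent that is orthogonal to its translates, so
  -- `c` is the indicator function of one element `k`
  have hmul : ∀ g h, e K t h * φ (e K s g) = c (h * g⁻¹) • e K t h := by
    intro g h
    rw [hcg, Finset.mul_sum, Finset.sum_eq_single (h * g⁻¹)]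
    · rw [mul_smul_comm, inv_mul_cancel_right, isRep.mul_e, if_pos rfl]
    · intro k _ hk
      rw [mul_smul_comm, isRep.mul_e, if_neg, smul_zero]
      intro h'
      exact hk (eq_mul_inv_of_mul_eq h'.symm)
    · simp
  have hmul2 : ∀ g g' h, e K t h * φ (e K s g * e K s g') =
      (c (h * g⁻¹) * c (h * g'⁻¹)) • e K t h := by
    intro g g' h
    rw [map_mul, ← mul_assoc, hmul, smul_mul_assoc, hmul, smul_smul]
  have hsc : ∀ {a b : K} (h : S3), a • e K t h = b • e K t h → a = b := fun h hab =>
    smul_left_injective K (e_ne_zero t h) hab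
  obtain ⟨k, hk⟩ : ∃ k, c k ≠ 0 := by
    by_contra! h0
    have : φ (e K s 1) = 0 := by rw [← hc]; simp [h0]
    rw [map_eq_zero_iff φ φ.injective] at this
    exact e_ne_zero s 1 this
  have hk1 : c k = 1 := by
    have h := hmul2 1 1 k
    rw [isRep.mul_e, if_pos rfl, hmul, inv_one, mul_one] at h
    exact (mul_eq_left₀ hk).1 (hsc k h).symm
  have hc0 : ∀ h, h ≠ k → c h = 0 := by
    intro h hh
    have h2 := hmul2 1 (h⁻¹ * k) k
    have hne : (1 : S3) ≠ h⁻¹ * k := fun h' => hh (inv_mul_eq_one.1 h'.symm)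
    rw [isRep.mul_e, if_neg hne, map_zero, mul_zero, mul_inv_rev, inv_inv, inv_one, mul_one,
      mul_inv_cancel_left, hk1, one_mul, eq_comm, smul_eq_zero] at h2
    exact h2.resolve_right (e_ne_zero t k)
  refine ⟨k, fun g => ?_⟩
  rw [hcg, Finset.sum_eq_single k (fun h _ hh => by rw [hc0 h hh, zero_smul]) (by simp), hk1,
    one_smul]

/-- The images of the `w_i` under an isomorphism are the `sign(k) w_{k i}`: the difference is a
coinvariant, thus a scalar, of nontrivial degree. Comparing the squares gives the permutation. -/
theorem exists_perm_of_comodAlgIso {s t : Fin 3 → K}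
    (h : ComodAlgIso (coaction K s) (coaction K t)) : ∃ k : S3, ∀ i, s i = t (k i) := by
  obtain ⟨φ, hφ⟩ := h
  obtain ⟨k, hk⟩ := exists_perm_map_e φ hφ
  obtain ⟨α, -, ψ, h1, -, hc⟩ := isCocycleDeformation_coaction t
  have hw : ∀ i, φ (w K s i) = sgn K k • w K t (k i) := by
    intro i
    rw [← sub_eq_zero]
    have hco : coaction K t (φ (w K s i) - sgn K k • w K t (k i)) =
        (φ (w K s i) - sgn K k • w K t (k i)) ⊗ₜ 1 := by
      have hq : sgn K k • coQ K t (k i) = φ.toLinearMap.rTensor (H K) (coQ K s i) := by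
        rw [coQ, coQ, map_sum, Finset.smul_sum, ← Equiv.sum_comp (Equiv.mulLeft k)]
        refine Finset.sum_congr rfl fun m _ => ?_
        rw [Equiv.coe_mulLeft, sgn_mul, smul_smul, ← mul_assoc, sgn_mul_self, one_mul, map_smul,
          LinearMap.rTensor_tmul, inv_mul_apply k m i,
          AlgEquiv.toLinearMap_apply, hk]
      rw [map_sub, hφ, map_smul, coaction_x, coX, coaction_x, coX, map_add, smul_add, hq,
        LinearMap.rTensor_tmul, TensorProduct.sub_tmul, TensorProduct.smul_tmul']
      simp
    obtain ⟨c, hcc⟩ := exists_algebraMap_of_coinvariant ψ h1 hc hco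
    have hne : ∀ i, tr i ≠ 1 := by decide
    refine algebraMap_eq_zero_of_degree (isRep (t := t)).mul_e (e_ne_zero t 1) (hne (k i))
      (fun g => ?_) hcc
    rw [mul_sub, sub_mul, mul_smul_comm, smul_mul_assoc, isRep.comm]
    congr 1
    have h3 : e K t g = φ (e K s (k⁻¹ * g)) := by rw [hk, mul_inv_cancel_left]
    have h4 : e K t (tr (k i) * g) = φ (e K s (tr i * (k⁻¹ * g))) := by
      rw [hk, ← mul_assoc k, ← tr_smul, mul_assoc, mul_inv_cancel_left]
    rw [h3, h4, ← map_mul, ← map_mul, isRep.comm]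
  refine ⟨k, fun i => ?_⟩
  have h2 := congrArg φ (isRep.sq (t := s) i)
  have : Nontrivial (W K t) := ⟨e K t 1, 0, e_ne_zero t 1⟩
  rw [map_mul, hw, smul_mul_smul_comm, sgn_mul_self, one_smul, isRep.sq, AlgEquiv.commutes] at h2
  exact ((algebraMap K (W K t)).injective h2).symm

/-- `W_λ` and `W_μ` are isomorphic if and only if `μ` is a permutation of `λ`. -/
theorem comodAlgIso_iff (s t : Fin 3 → K) :
    ComodAlgIso (coaction K s) (coaction K t) ↔ ∃ σ : Equiv.Perm (Fin 3), t = s ∘ σ := by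
  constructor
  · intro h
    obtain ⟨k, hk⟩ := exists_perm_of_comodAlgIso h
    exact ⟨k⁻¹, by funext i; simp [hk]⟩
  · rintro ⟨σ, rfl⟩
    exact comodAlgIso_of_perm σ⁻¹ fun i => by simp

end Isomorphisms

/-! ### The set of equivalence classes -/

section Classes

section General

variable {K : Type*} [CommRing K] {H : Type*} [Ring H] [Bialgebra K H]
variable {W W' : Type*} [Ring W] [Algebra K W] [Ring W'] [Algebra K W']

theorem ComodAlgIso.symm {ρ : W →ₐ[K] W ⊗[K] H} {ρ' : W' →ₐ[K] W' ⊗[K] H}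
    (h : ComodAlgIso ρ ρ') : ComodAlgIso ρ' ρ := by
  obtain ⟨φ, hφ⟩ := h
  refine ⟨φ.symm, fun w => ?_⟩
  have h2 := hφ (φ.symm w)
  rw [AlgEquiv.apply_symm_apply] at h2
  rw [h2, ← LinearMap.comp_apply, ← LinearMap.rTensor_comp]
  have h3 : φ.symm.toLinearMap ∘ₗ φ.toLinearMap = LinearMap.id := by ext; simp
  rw [h3, LinearMap.rTensor_id, LinearMap.id_apply]

theorem IsDeformationBy.of_comodAlgIso {α : H ⊗[K] H →ₗ[K] K} {ρ : W →ₐ[K] W ⊗[K] H}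
    {ρ' : W' →ₐ[K] W' ⊗[K] H} (hα : IsDeformationBy α ρ) (h : ComodAlgIso ρ ρ') :
    IsDeformationBy α ρ' := by
  obtain ⟨φ, h1, hm, hc⟩ := hα
  obtain ⟨ψ, hψ⟩ := h
  refine ⟨φ.trans ψ.toLinearEquiv, by simp [h1], fun x y => by simp [hm], fun x => ?_⟩
  rw [LinearEquiv.trans_apply]
  refine (hψ _).trans ?_
  rw [hc, ← LinearMap.comp_apply, ← LinearMap.rTensor_comp]
  rfl

theorem IsDeformationBy.comodAlgIso {α : H ⊗[K] H →ₗ[K] K} {ρ : W →ₐ[K] W ⊗[K] H}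
    {ρ' : W' →ₐ[K] W' ⊗[K] H} (hρ : IsDeformationBy α ρ) (hρ' : IsDeformationBy α ρ') :
    ComodAlgIso ρ ρ' := by
  obtain ⟨φ, h1, hm, hc⟩ := hρ
  obtain ⟨ψ, h1', hm', hc'⟩ := hρ'
  have hone : (φ.symm.trans ψ) 1 = 1 := by
    rw [LinearEquiv.trans_apply, ← h1', ψ.injective.eq_iff, LinearEquiv.symm_apply_eq, h1]
  have hmul : ∀ x y, (φ.symm.trans ψ) (x * y) = (φ.symm.trans ψ) x * (φ.symm.trans ψ) y := by
    intro x y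
    obtain ⟨x, rfl⟩ := φ.surjective x
    obtain ⟨y, rfl⟩ := φ.surjective y
    rw [← hm]
    simp [hm']
  refine ⟨AlgEquiv.ofLinearEquiv (φ.symm.trans ψ) hone hmul, fun w => ?_⟩
  obtain ⟨x, rfl⟩ := φ.surjective w
  change ρ' (ψ (φ.symm (φ x))) = (φ.symm.trans ψ).toLinearMap.rTensor H (ρ (φ x))
  rw [LinearEquiv.symm_apply_apply, hc, hc', ← LinearMap.rTensor_comp_apply]
  congr 2
  ext x
  simp

theorem TwoCocycle.Equivalent.of_isDeformationBy {α β : TwoCocycle K H}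
    {ρ : W →ₐ[K] W ⊗[K] H} (hα : IsDeformationBy α.1 ρ) (hβ : IsDeformationBy β.1 ρ) :
    TwoCocycle.Equivalent α β := by
  obtain ⟨φ, h1, hm, hc⟩ := hα
  obtain ⟨ψ, h1', hm', hc'⟩ := hβ
  refine ⟨φ.trans ψ.symm, ?_, fun x y => ?_, fun x => ?_⟩
  · rw [LinearEquiv.trans_apply, h1, LinearEquiv.symm_apply_eq, h1']
  · rw [LinearEquiv.trans_apply, LinearEquiv.symm_apply_eq, hm, hm']
    simp
  · apply (ψ.rTensor H).injective
    have h := hc' (ψ.symm (φ x))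
    rw [LinearEquiv.apply_symm_apply, hc] at h
    refine h.symm.trans ?_
    change _ = ψ.toLinearMap.rTensor H _
    rw [← LinearMap.rTensor_comp_apply]
    congr 2
    ext x
    simp

theorem TwoCocycle.Equivalent.isDeformationBy {α β : TwoCocycle K H}
    (h : TwoCocycle.Equivalent α β) {ρ : W →ₐ[K] W ⊗[K] H} (hβ : IsDeformationBy β.1 ρ) :
    IsDeformationBy α.1 ρ := by
  obtain ⟨θ, hθ1, hθm, hθc⟩ := h
  obtain ⟨φ, h1, hm, hc⟩ := hβ
  refine ⟨θ.trans φ, by simp [hθ1, h1], fun x y => by simp [hθm, hm], fun x => ?_⟩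
  rw [LinearEquiv.trans_apply, hc, hθc, ← LinearMap.comp_apply, ← LinearMap.rTensor_comp]
  rfl

end General

variable {K : Type*} [Field K]

/-- The algebra `W_λ` is isomorphic to `^αH` for some 2-cocycle `α`. -/
theorem exists_cocycle (t : Fin 3 → K) :
    ∃ α : TwoCocycle K (H K), IsDeformationBy α.1 (coaction K t) := by
  obtain ⟨α, hα, h⟩ := isCocycleDeformation_coaction t
  exact ⟨⟨α, hα⟩, h⟩

/-- Every `^αH` is isomorphic to some `W_λ`. -/
theorem exists_parameter [IsAlgClosed K] (α : TwoCocycle K (H K)) :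
    ∃ t : Fin 3 → K, IsDeformationBy α.1 (coaction K t) := by
  obtain ⟨t, ht⟩ := exists_comodAlgIso_of_isCocycleDeformation
    ⟨α.1, α.2, Deformed.isDeformationBy α⟩
  exact ⟨t, (Deformed.isDeformationBy α).of_comodAlgIso ht.symm⟩

theorem equivalent_iff {α β : TwoCocycle K (H K)} {s t : Fin 3 → K}
    (hα : IsDeformationBy α.1 (coaction K s)) (hβ : IsDeformationBy β.1 (coaction K t)) :
    TwoCocycle.Equivalent α β ↔ ∃ σ : Equiv.Perm (Fin 3), t = s ∘ σ := by
  rw [← comodAlgIso_iff]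
  exact ⟨fun h => hα.comodAlgIso (h.isDeformationBy hβ),
    fun h => TwoCocycle.Equivalent.of_isDeformationBy (hα.of_comodAlgIso h) hβ⟩

/-- The bijection from the set of equivalence classes to `A³ / S3`. -/
theorem exists_moduli_equiv [IsAlgClosed K] : ∃ Φ : Moduli K (H K) ≃ A3S3 K,
    ∀ (α : TwoCocycle K (H K)) (t : Fin 3 → K),
      IsDeformationBy α.1 (coaction K t) → Φ ⟦α⟧ = ⟦t⟧ := by
  choose p hp using exists_parameter (K := K)
  set f : Moduli K (H K) → A3S3 K := Quotient.lift (fun α => (⟦p α⟧ : A3S3 K))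
    fun α β h => Quotient.sound ((equivalent_iff (hp α) (hp β)).1 h) with hf
  have hfb : Function.Bijective f := by
    constructor
    · intro x y
      induction x using Quotient.inductionOn with | h α => ?_
      induction y using Quotient.inductionOn with | h β => ?_
      intro h
      exact Quotient.sound ((equivalent_iff (hp α) (hp β)).2 (Quotient.exact h))
    · intro x
      induction x using Quotient.inductionOn with | h t => ?_
      obtain ⟨α, hα⟩ := exists_cocycle t
      exact ⟨⟦α⟧, Quotient.sound ((equivalent_iff (hp α) hα).1 ((twoCocycleSetoid K (H K)).refl α))⟩
  refine ⟨Equiv.ofBijective f hfb, fun α t h => Quotient.sound ?_⟩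
  exact (equivalent_iff (hp α) h).1 ((twoCocycleSetoid K (H K)).refl α)

/-- The bijection from `A³ / S3` to `A³` given by the elementary symmetric functions. -/
theorem exists_esymm3_equiv [IsAlgClosed K] :
    ∃ Θ : A3S3 K ≃ (Fin 3 → K), ∀ t : Fin 3 → K, Θ ⟦t⟧ = esymm3 t := by
  set f : A3S3 K → (Fin 3 → K) := Quotient.lift esymm3 fun s t h => by
    obtain ⟨σ, rfl⟩ := h
    exact (esymm3_comp s σ).symm with hf
  have hfb : Function.Bijective f := by
    constructor
    · intro x y
      induction x using Quotient.inductionOn with | h s => ?_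
      induction y using Quotient.inductionOn with | h t => ?_
      intro h
      exact Quotient.sound (exists_perm_of_esymm3_eq h)
    · intro c
      obtain ⟨t, ht⟩ := esymm3_surjective c
      exact ⟨⟦t⟧, ht⟩
  exact ⟨Equiv.ofBijective f hfb, fun t => rfl⟩

end Classes

/-! ### Functions of the parameter are regular -/

section GaloisMap

variable {K : Type*} [CommRing K] {H : Type*} [Ring H] [Bialgebra K H]
variable {V V' : Type*} [AddCommGroup V] [Module K V] [AddCommGroup V'] [Module K V']

/-- The Galois map is natural in the multiplication and the coaction. -/
theorem rTensor_galoisMap {m : V ⊗[K] V →ₗ[K] V} {m' : V' ⊗[K] V' →ₗ[K] V'}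
    {R : V →ₗ[K] V ⊗[K] H} {R' : V' →ₗ[K] V' ⊗[K] H} {θ : V →ₗ[K] V'}
    (hm : ∀ x y, θ (m (x ⊗ₜ y)) = m' (θ x ⊗ₜ θ y)) (hR : ∀ x, θ.rTensor H (R x) = R' (θ x))
    (z : V ⊗[K] V) :
    θ.rTensor H (galoisMap m R z) = galoisMap m' R' (TensorProduct.map θ θ z) := by
  induction z using TensorProduct.induction_on with
  | zero => simp
  | add u v hu hv => simp only [map_add, hu, hv]
  | tmul x y =>
    simp only [galoisMap, LinearMap.comp_apply, LinearMap.lTensor_tmul, TensorProduct.map_tmul,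
      ← hR]
    generalize R y = u
    induction u using TensorProduct.induction_on with
    | zero => simp
    | add u v hu hv => simp only [map_add, TensorProduct.tmul_add, hu, hv]
    | tmul p q => simp [hm]

/-- The bilinear map with `(a ⊗ b, v ⊗ y) ↦ a v b ⊗ y`. -/
def sandwich (m : V ⊗[K] V →ₗ[K] V) : V ⊗[K] V →ₗ[K] V ⊗[K] V →ₗ[K] V ⊗[K] V :=
  TensorProduct.curry (m.rTensor V ∘ₗ (TensorProduct.assoc K V V V).symm.toLinearMap ∘ₗ
    m.rTensor (V ⊗[K] V) ∘ₗ (TensorProduct.tensorTensorTensorComm K V V V V).toLinearMap)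

theorem sandwich_tmul (m : V ⊗[K] V →ₗ[K] V) (a b v y : V) :
    sandwich m (a ⊗ₜ b) (v ⊗ₜ y) = m (m (a ⊗ₜ v) ⊗ₜ b) ⊗ₜ y := rfl

/-- The bilinear map with `(a ⊗ b, v ⊗ y) ↦ (a v) (b y)`. -/
def mulMul (m : V ⊗[K] V →ₗ[K] V) : V ⊗[K] V →ₗ[K] V ⊗[K] V →ₗ[K] V :=
  TensorProduct.curry (m ∘ₗ TensorProduct.map m m ∘ₗ
    (TensorProduct.tensorTensorTensorComm K V V V V).toLinearMap)

theorem mulMul_tmul (m : V ⊗[K] V →ₗ[K] V) (a b v y : V) :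
    mulMul m (a ⊗ₜ b) (v ⊗ₜ y) = m (m (a ⊗ₜ v) ⊗ₜ m (b ⊗ₜ y)) := rfl

section

variable {m : V ⊗[K] V →ₗ[K] V} {m' : V' ⊗[K] V' →ₗ[K] V'} {θ : V →ₗ[K] V'}
  (hm : ∀ x y, θ (m (x ⊗ₜ y)) = m' (θ x ⊗ₜ θ y))
include hm

theorem map_sandwich (z z' : V ⊗[K] V) : TensorProduct.map θ θ (sandwich m z z') =
    sandwich m' (TensorProduct.map θ θ z) (TensorProduct.map θ θ z') := by
  induction z using TensorProduct.induction_on with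
  | zero => simp
  | add u v hu hv => simp only [map_add, LinearMap.add_apply, hu, hv]
  | tmul a b =>
    induction z' using TensorProduct.induction_on with
    | zero => simp
    | add u v hu hv => simp only [map_add, hu, hv]
    | tmul v y => simp only [sandwich_tmul, TensorProduct.map_tmul, hm]

theorem map_mulMul (z z' : V ⊗[K] V) : θ (mulMul m z z') =
    mulMul m' (TensorProduct.map θ θ z) (TensorProduct.map θ θ z') := by
  induction z using TensorProduct.induction_on with
  | zero => simp
  | add u v hu hv => simp only [map_add, LinearMap.add_apply, hu, hv]
  | tmul a b =>
    induction z' using TensorProduct.induction_on with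
    | zero => simp
    | add u v hu hv => simp only [map_add, hu, hv]
    | tmul v y => simp only [mulMul_tmul, TensorProduct.map_tmul, hm]

end

end GaloisMap

section PolyMaps

variable {K : Type*} [Field K] {U : Type*} [AddCommGroup U] [Module K U]
variable {V : Type*} [AddCommGroup V] [Module K V] [FiniteDimensional K V]

theorem IsPolyMap.id : IsPolyMap K (fun u : U => u) := IsPolyMap.linear LinearMap.id

theorem IsPolyMap.fst {V₁ V₂ : Type*} [AddCommGroup V₁] [Module K V₁] [AddCommGroup V₂]
    [Module K V₂] {f : U → V₁ × V₂} (hf : IsPolyMap K f) : IsPolyMap K (fun u => (f u).1) :=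
  hf.linear_comp (LinearMap.fst K V₁ V₂)

theorem IsPolyMap.snd {V₁ V₂ : Type*} [AddCommGroup V₁] [Module K V₁] [AddCommGroup V₂]
    [Module K V₂] {f : U → V₁ × V₂} (hf : IsPolyMap K f) : IsPolyMap K (fun u => (f u).2) :=
  hf.linear_comp (LinearMap.snd K V₁ V₂)

theorem IsPolyMap.mem_const (c : K) : (fun _ : U => c) ∈ polyFun K U :=
  (polyFun K U).algebraMap_mem c

theorem IsPolyMap.tmul {V' : Type*} [AddCommGroup V'] [Module K V'] {f : U → V} {g : U → V'}
    (hf : IsPolyMap K f) (hg : IsPolyMap K g) : IsPolyMap K (fun p => f p ⊗ₜ[K] g p) :=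
  IsPolyMap.bilinear (TensorProduct.mk K V V') hf hg

theorem IsPolyMap.sandwich {m : U → V ⊗[K] V →ₗ[K] V} {z z' : U → V ⊗[K] V}
    (hm : IsPolyMap K m) (hz : IsPolyMap K z) (hz' : IsPolyMap K z') :
    IsPolyMap K (fun p => sandwich (m p) (z p) (z' p)) :=
  ((hm.linear_comp (LinearMap.rTensorHom V)).apply
    (((hm.linear_comp (LinearMap.rTensorHom (V ⊗[K] V))).apply
      ((hz.tmul hz').linear_comp
        (TensorProduct.tensorTensorTensorComm K V V V V).toLinearMap)).linear_comp
      (TensorProduct.assoc K V V V).symm.toLinearMap))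

theorem IsPolyMap.tensorMap {V₁ V₂ V₃ V₄ : Type*} [AddCommGroup V₁] [Module K V₁]
    [AddCommGroup V₂] [Module K V₂] [AddCommGroup V₃] [Module K V₃] [AddCommGroup V₄] [Module K V₄]
    [FiniteDimensional K V₁] [FiniteDimensional K V₂] {f : U → V₁ →ₗ[K] V₂} {g : U → V₃ →ₗ[K] V₄}
    (hf : IsPolyMap K f) (hg : IsPolyMap K g) :
    IsPolyMap K (fun p => TensorProduct.map (f p) (g p)) := by
  have h := IsPolyMap.bilinear (TensorProduct.mapBilinear (RingHom.id K) V₁ V₃ V₂ V₄) hf hg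
  exact h

theorem IsPolyMap.mulMul {m : U → V ⊗[K] V →ₗ[K] V} {z z' : U → V ⊗[K] V}
    (hm : IsPolyMap K m) (hz : IsPolyMap K z) (hz' : IsPolyMap K z') :
    IsPolyMap K (fun p => mulMul (m p) (z p) (z' p)) :=
  hm.apply ((hm.tensorMap hm).apply ((hz.tmul hz').linear_comp
    (TensorProduct.tensorTensorTensorComm K V V V V).toLinearMap))

end PolyMaps

section Invariants

variable {K : Type*} [Field K] (t : Fin 3 → K)

/-- The elements `e_k` are fixed by the projection `v ↦ Σ_k e_k v e_k`, which annihilates the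
elements `e_k w_i` of nontrivial degree. -/
theorem sandwich_translation (i : Fin 3) :
    sandwich (LinearMap.mul' K (W K t)) (∑ k, e K t k ⊗ₜ e K t k)
      (∑ k, sgn K k • (e K t k ⊗ₜ w K t (k i) - (e K t k * w K t (k i)) ⊗ₜ 1)) =
    ∑ k, sgn K k • (e K t k ⊗ₜ w K t (k i)) := by
  have hne : ∀ i (k : S3), tr i * k ≠ k := by decide
  rw [map_sum]
  refine Finset.sum_congr rfl fun k _ => ?_
  rw [map_smul, map_sub, map_sum, LinearMap.sum_apply, LinearMap.sum_apply,
    Finset.sum_eq_single k, Finset.sum_eq_single k]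
  · simp only [sandwich_tmul, LinearMap.mul'_apply]
    rw [isRep.mul_e, if_pos rfl, isRep.mul_e, if_pos rfl, ← mul_assoc, isRep.mul_e, if_pos rfl,
      isRep.comm, mul_assoc, isRep.mul_e, if_neg (hne _ _), mul_zero, TensorProduct.zero_tmul,
      sub_zero]
  · intro l _ hl
    simp only [sandwich_tmul, LinearMap.mul'_apply]
    rw [← mul_assoc, isRep.mul_e, if_neg hl, zero_mul, zero_mul, TensorProduct.zero_tmul]
  · simp
  · intro l _ hl
    simp only [sandwich_tmul, LinearMap.mul'_apply]
    rw [isRep.mul_e, if_neg hl, zero_mul, TensorProduct.zero_tmul]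
  · simp

/-- The product is taken in each component `e_k`, where it is `w_{k(i)}² = λ_{k(i)}`. -/
theorem mulMul_translation (i : Fin 3) :
    mulMul (LinearMap.mul' K (W K t)) (∑ k, sgn K k • (e K t k ⊗ₜ w K t (k i)))
      (∑ k, sgn K k • (e K t k ⊗ₜ w K t (k i))) = ∑ k, t (k i) • e K t k := by
  rw [map_sum]
  refine Finset.sum_congr rfl fun k _ => ?_
  rw [map_sum, LinearMap.sum_apply, Finset.sum_eq_single k]
  · rw [map_smul, map_smul, LinearMap.smul_apply, smul_smul, sgn_mul_self, one_smul, mulMul_tmul]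
    simp only [LinearMap.mul'_apply]
    rw [isRep.mul_e, if_pos rfl, isRep.sq, Algebra.algebraMap_eq_smul_one, mul_smul_comm, mul_one]
  · intro l _ hl
    rw [map_smul, map_smul, LinearMap.smul_apply, mulMul_tmul]
    simp only [LinearMap.mul'_apply]
    rw [isRep.mul_e, if_neg hl, zero_mul, smul_zero, smul_zero]
  · simp

variable {V : Type*} [AddCommGroup V] [Module K V]

variable (K V) in
/-- The triples `(m, T, A)` of structure maps on a space `V`. -/
abbrev Triple : Type _ :=
  (V ⊗[K] V →ₗ[K] V) × (V ⊗[K] H K →ₗ[K] V ⊗[K] V) × (Module.Dual K (H K) ⊗[K] V →ₗ[K] V)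

/-- A linear isomorphism from `V` to `W_λ` that is compatible with the multiplication `m` and
the inverse `T` of the Galois map of a triple `(m, T, A)`. -/
structure IsModel (p : Triple K V) (θ : V ≃ₗ[K] W K t) : Prop where
  map_mul : ∀ x y, θ (p.1 (x ⊗ₜ y)) = θ x * θ y
  can_map : ∀ x h, can (coaction K t) (TensorProduct.map θ.toLinearMap θ.toLinearMap
    (p.2.1 (x ⊗ₜ h))) = θ x ⊗ₜ h

/-- A triple that presents a cocycle `α` is the triple of structure maps of every `W_λ` isomorphic
to `^αH`. -/
theorem exists_isModel {p : StructureSpace K (H K)} {α : TwoCocycle K (H K)} (hp : Presents p α)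
    {t : Fin 3 → K} (hα : IsDeformationBy α.1 (coaction K t)) : ∃ θ, IsModel t p θ := by
  obtain ⟨φ, hm, -, -, hT⟩ := hp
  obtain ⟨ψ, -, hm', hc⟩ := hα
  have hmul : ∀ x y, (φ.symm.trans ψ) (p.1 (x ⊗ₜ y)) =
      (φ.symm.trans ψ) x * (φ.symm.trans ψ) y := by
    intro x y
    obtain ⟨x, rfl⟩ := φ.surjective x
    obtain ⟨y, rfl⟩ := φ.surjective y
    rw [hm]
    simp [hm']
  refine ⟨φ.symm.trans ψ, hmul, fun x h => ?_⟩
  rw [← rTensor_galoisMap (m := p.1) (R := transportCoaction φ) (m' := LinearMap.mul' K _)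
    (R' := (coaction K t).toLinearMap) hmul]
  · have h2 := LinearMap.congr_fun hT (x ⊗ₜ h)
    rw [LinearMap.comp_apply, LinearMap.id_apply] at h2
    rw [h2]
    rfl
  · intro y
    obtain ⟨y, rfl⟩ := φ.surjective y
    change _ = coaction K t (ψ (φ.symm (φ y)))
    rw [LinearEquiv.symm_apply_apply, hc, transportCoaction, LinearMap.comp_apply,
      LinearMap.comp_apply, LinearEquiv.coe_coe, LinearEquiv.symm_apply_apply,
      ← LinearMap.rTensor_comp_apply]
    congr 2
    ext x
    simp

/-- The unit of the algebra that is given by a triple `(m, T, A)`: as `T(x ⊗ 1) = x ⊗ 1`, it is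
obtained from `T` by contraction with a linear form `ξ` with `ξ(x) = 1`. -/
def unitOf (x : V) (ξ : Module.Dual K V) (p : Triple K V) : V :=
  TensorProduct.lid K V (ξ.rTensor V (p.2.1 (x ⊗ₜ 1)))

/-- The tensor `T(1 ⊗ h)`. -/
def translationOf (x : V) (ξ : Module.Dual K V) (h : H K) (p : Triple K V) : V ⊗[K] V :=
  p.2.1 (unitOf x ξ p ⊗ₜ h)

/-- A polynomial map on the space of triples with the value `Σ_k λ_{k(i)} e_k` at a point that
presents `W_λ`. -/
def squareOf (x : V) (ξ : Module.Dual K V) (i : Fin 3) (p : Triple K V) : V :=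
  mulMul p.1 (sandwich p.1 (translationOf x ξ (e K 0 1) p) (translationOf x ξ (w K 0 i) p))
    (sandwich p.1 (translationOf x ξ (e K 0 1) p) (translationOf x ξ (w K 0 i) p))

section

variable {t} {x : V} {ξ : Module.Dual K V}

theorem isPolyMap_unitOf [FiniteDimensional K V] (x : V) (ξ : Module.Dual K V) :
    IsPolyMap K (unitOf x ξ) :=
  ((IsPolyMap.id.snd.fst.apply (IsPolyMap.const (x ⊗ₜ 1))).linear_comp
    (ξ.rTensor V)).linear_comp (TensorProduct.lid K V).toLinearMap

theorem isPolyMap_translationOf [FiniteDimensional K V] (x : V) (ξ : Module.Dual K V) (h : H K) :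
    IsPolyMap K (translationOf x ξ h) :=
  IsPolyMap.id.snd.fst.apply ((isPolyMap_unitOf x ξ).tmul (IsPolyMap.const h))

theorem isPolyMap_squareOf [FiniteDimensional K V] (x : V) (ξ : Module.Dual K V) (i : Fin 3) :
    IsPolyMap K (squareOf x ξ i) :=
  have h := IsPolyMap.sandwich IsPolyMap.id.fst (isPolyMap_translationOf x ξ (e K 0 1))
    (isPolyMap_translationOf x ξ (w K 0 i))
  IsPolyMap.mulMul IsPolyMap.id.fst h h

variable {p : Triple K V} {θ : V ≃ₗ[K] W K t} (hθ : IsModel t p θ) (hx : ξ x = 1)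
include hθ hx

theorem map_unitOf : θ (unitOf x ξ p) = 1 := by
  have h1 : p.2.1 (x ⊗ₜ 1) = x ⊗ₜ θ.symm 1 := by
    apply (TensorProduct.congr θ θ).injective
    apply (can_coaction_bijective t).1
    refine (hθ.can_map _ _).trans ?_
    rw [TensorProduct.congr_tmul, can_tmul, LinearEquiv.apply_symm_apply, map_one, mul_one]
  rw [← LinearEquiv.eq_symm_apply, unitOf, h1, LinearMap.rTensor_tmul, TensorProduct.lid_tmul, hx,
    one_smul]

theorem can_map_translationOf (h : H K) : can (coaction K t)
    (TensorProduct.map θ.toLinearMap θ.toLinearMap (translationOf x ξ h p)) = 1 ⊗ₜ h := by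
  rw [translationOf, hθ.can_map, map_unitOf hθ hx]

/-- As the Galois map is bijective, `T(1 ⊗ e_1)` and `T(1 ⊗ x_i)` are the translation elements in
`can_translation_e` and `can_translation_w`. -/
theorem map_squareOf (i : Fin 3) : θ (squareOf x ξ i p) = ∑ k, t (k i) • e K t k := by
  have hm : ∀ x y, θ.toLinearMap (p.1 (x ⊗ₜ y)) =
    LinearMap.mul' K (W K t) (θ.toLinearMap x ⊗ₜ θ.toLinearMap y) := hθ.map_mul
  have h1 := can_translation_e t 1
  simp only [mul_one] at h1
  change θ.toLinearMap _ = _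
  rw [squareOf, map_mulMul hm, map_sandwich hm,
    (can_coaction_bijective t).1 ((can_map_translationOf hθ hx _).trans h1.symm),
    (can_coaction_bijective t).1 ((can_map_translationOf hθ hx _).trans
      (can_translation_w t i).symm),
    sandwich_translation, mulMul_translation]

end

/-- A polynomial function of the parameter is obtained from a polynomial map on the space of
triples. -/
theorem exists_isPolyMap_value [FiniteDimensional K V] [Nontrivial V] {g : (Fin 3 → K) → K}
    (hg : g ∈ polyFun K (Fin 3 → K)) : ∃ v : Triple K V → V, IsPolyMap K v ∧
      ∀ (t : Fin 3 → K) p θ, IsModel t p θ → θ (v p) = ∑ k : S3, g (t ∘ k) • e K t k := by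
  obtain ⟨x, hx0⟩ := exists_ne (0 : V)
  obtain ⟨ξ, hx⟩ := Module.Projective.exists_dual_eq_one K hx0
  induction hg using Algebra.adjoin_induction with
  | mem g hg =>
    obtain ⟨φ, rfl⟩ := hg
    refine ⟨fun p => ∑ i, φ (Pi.single i 1) • squareOf x ξ i p,
      IsPolyMap.sum _ fun i _ => IsPolyMap.smul (IsPolyMap.mem_const _)
        (isPolyMap_squareOf x ξ i), fun t p θ hθ => ?_⟩
    simp only [map_sum, map_smul, map_squareOf hθ hx, Finset.smul_sum]
    rw [Finset.sum_comm]
    refine Finset.sum_congr rfl fun k _ => ?_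
    rw [← Finset.univ_sum_single (t ∘ k), map_sum, Finset.sum_smul]
    refine Finset.sum_congr rfl fun i _ => ?_
    have : (Pi.single i ((t ∘ k) i) : Fin 3 → K) = t (k i) • Pi.single i 1 := by
      rw [← Pi.single_smul]; simp
    rw [this, map_smul, smul_smul, smul_eq_mul, mul_comm]
  | algebraMap r =>
    refine ⟨fun p => r • unitOf x ξ p, IsPolyMap.smul (IsPolyMap.mem_const _)
      (isPolyMap_unitOf x ξ), fun t p θ hθ => ?_⟩
    rw [map_smul, map_unitOf hθ hx, ← isRep.sum_e (t := t), Finset.smul_sum]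
    rfl
  | add g g' _ _ h h' =>
    obtain ⟨v, hv, hvθ⟩ := h
    obtain ⟨v', hv', hvθ'⟩ := h'
    refine ⟨_, hv.add hv', fun t p θ hθ => ?_⟩
    rw [map_add, hvθ t p θ hθ, hvθ' t p θ hθ, ← Finset.sum_add_distrib]
    exact Finset.sum_congr rfl fun k _ => (add_smul _ _ _).symm
  | mul g g' _ _ h h' =>
    obtain ⟨v, hv, hvθ⟩ := h
    obtain ⟨v', hv', hvθ'⟩ := h'
    refine ⟨fun p => p.1 (v p ⊗ₜ v' p), IsPolyMap.id.fst.apply (hv.tmul hv'),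
      fun t p θ hθ => ?_⟩
    rw [hθ.map_mul, hvθ t p θ hθ, hvθ' t p θ hθ, Finset.sum_mul_sum]
    refine Finset.sum_congr rfl fun k _ => ?_
    rw [Finset.sum_eq_single k]
    · rw [smul_mul_smul_comm, isRep.mul_e, if_pos rfl]; rfl
    · intro l _ hl
      rw [smul_mul_smul_comm, isRep.mul_e, if_neg hl.symm, smul_zero]
    · simp

/-- The value of a symmetric polynomial at the parameter is a polynomial function on the space of
triples: a multiple of the unit is determined by the trace of its left multiplication. -/
theorem exists_polyFun_isModel [CharZero K] [FiniteDimensional K V] [Nontrivial V]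
    {g : (Fin 3 → K) → K} (hg : g ∈ polyFun K (Fin 3 → K))
    (hs : ∀ (t : Fin 3 → K) (k : S3), g (t ∘ k) = g t) :
    ∃ F ∈ polyFun K (Triple K V), ∀ (t : Fin 3 → K) p θ, IsModel t p θ → F p = g t := by
  obtain ⟨v, hv, hvθ⟩ := exists_isPolyMap_value (V := V) hg
  refine ⟨fun p => (Module.finrank K V : K)⁻¹ *
    LinearMap.trace K V (TensorProduct.curry p.1 (v p)), ?_, fun t p θ hθ => ?_⟩
  · have h1 : IsPolyMap K (fun p : Triple K V => TensorProduct.curry p.1) :=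
      IsPolyMap.id.fst.linear_comp (TensorProduct.lcurry (RingHom.id K) V V V)
    exact mem_polyFun_iff.2 (((h1.apply hv).linear_comp (LinearMap.trace K V)).linear_comp
      (LinearMap.lsmul K K (Module.finrank K V : K)⁻¹))
  · have h1 := hvθ t p θ hθ
    simp only [hs] at h1
    rw [← Finset.smul_sum, isRep.sum_e] at h1
    have h2 : TensorProduct.curry p.1 (v p) = g t • LinearMap.id := by
      refine LinearMap.ext fun x => θ.injective ?_
      rw [TensorProduct.curry_apply, hθ.map_mul, h1]
      simp
    have h3 : (Module.finrank K V : K) ≠ 0 := Nat.cast_ne_zero.2 Module.finrank_pos.ne'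
    dsimp only
    rw [h2, map_smul, LinearMap.trace_id, smul_eq_mul, mul_comm (g t), inv_mul_cancel_left₀ h3]

/-- The value of a symmetric polynomial at the parameter is a polynomial function on the space of
triples. -/
theorem exists_polyFun_presents [CharZero K] {g : (Fin 3 → K) → K}
    (hg : g ∈ polyFun K (Fin 3 → K)) (hs : ∀ (t : Fin 3 → K) (k : S3), g (t ∘ k) = g t) :
    ∃ F ∈ polyFun K (StructureSpace K (H K)), ∀ (p : StructureSpace K (H K))
      (α : TwoCocycle K (H K)) (t : Fin 3 → K), Presents p α →
      IsDeformationBy α.1 (coaction K t) → F p = g t := by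
  have : Nontrivial (Carrier K (H K)) := by
    apply Module.nontrivial_of_finrank_pos (R := K)
    rw [Module.finrank_fin_fun, finrank_W]
    norm_num
  obtain ⟨F, hF, hFθ⟩ := exists_polyFun_isModel (V := Carrier K (H K)) hg hs
  refine ⟨F, hF, fun p α t hp hα => ?_⟩
  obtain ⟨θ, hθ⟩ := exists_isModel hp hα
  exact hFθ t p θ hθ

end Invariants

/-! ### Regular functions are functions of the parameter -/

section Family

section Polynomials

variable {K : Type*} [Field K] {U : Type*} [AddCommGroup U] [Module K U]

theorem polyFun_add {f g : U → K} (hf : f ∈ polyFun K U) (hg : g ∈ polyFun K U) :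
    (fun u => f u + g u) ∈ polyFun K U := add_mem hf hg

theorem polyFun_mul {f g : U → K} (hf : f ∈ polyFun K U) (hg : g ∈ polyFun K U) :
    (fun u => f u * g u) ∈ polyFun K U := mul_mem hf hg

theorem polyFun_sub {f g : U → K} (hf : f ∈ polyFun K U) (hg : g ∈ polyFun K U) :
    (fun u => f u - g u) ∈ polyFun K U := sub_mem hf hg

theorem polyFun_neg {f : U → K} (hf : f ∈ polyFun K U) : (fun u => -f u) ∈ polyFun K U :=
  neg_mem hf

theorem polyFun_coord {ι : Type*} (i : ι) : (fun t : ι → K => t i) ∈ polyFun K (ι → K) :=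
  Algebra.subset_adjoin ⟨LinearMap.proj i, rfl⟩

/-- The structure constants in `leftMulFun` are polynomials in the parameter. -/
theorem isPolyMap_leftMul (i : Fin 3) : IsPolyMap K (fun t : Fin 3 → K => leftMul t i) := by
  refine IsPolyMap.of_apply_basis (Pi.basisFun K (Fin 12)) fun j => IsPolyMap.pi fun u => ?_
  rw [← mem_polyFun_iff]
  generalize Pi.basisFun K (Fin 12) j = v
  simp only [leftMul_apply]
  fin_cases i <;> fin_cases u <;>
    simp only [leftMulFun, Fin.mk_one, Fin.zero_eta, Fin.reduceFinMk, Matrix.cons_val] <;>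
    repeat' first
      | exact IsPolyMap.mem_const _
      | exact polyFun_coord _
      | apply polyFun_add
      | apply polyFun_sub
      | apply polyFun_mul
      | apply polyFun_neg

theorem isPolyMap_repX (i : Fin 3) : IsPolyMap K (fun t : Fin 3 → K => repX t i) := by
  have h : ∀ t : Fin 3 → K, repX t i = ∑ h : S3, LinearMap.single K (fun _ => Fin 12 → K) h ∘ₗ
      leftMul t i ∘ₗ LinearMap.proj h := by
    intro t
    refine LinearMap.ext fun c => ?_
    funext h u
    rw [repX_apply, LinearMap.sum_apply, Finset.sum_apply, Finset.sum_eq_single h]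
    · simp
    · intro h' _ hh
      simp [hh.symm]
    · simp
  simp only [h]
  exact IsPolyMap.sum _ fun h _ => IsPolyMap.linearMap_comp
    (IsPolyMap.linearMap_comp (IsPolyMap.const _) (isPolyMap_leftMul i)) (IsPolyMap.const _)

/-- A family of representations of the `W_λ` that is polynomial on the generators is polynomial on
the elements with fixed coordinates. -/
theorem isPolyMap_uncoord [FiniteDimensional K U] (P : ∀ t : Fin 3 → K, W K t →ₐ[K] Module.End K U)
    (he : ∀ g, IsPolyMap K fun t => P t (e K t g)) (hw : ∀ i, IsPolyMap K fun t => P t (w K t i))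
    (c : S3 → Fin 12 → K) : IsPolyMap K fun t => P t (uncoord t c) := by
  have hmul : ∀ {f g : (Fin 3 → K) → Module.End K U}, IsPolyMap K f → IsPolyMap K g →
      IsPolyMap K fun t => f t * g t := fun hf hg => IsPolyMap.linearMap_comp hg hf
  have hl : ∀ l : List (Fin 3), IsPolyMap K fun t => P t (l.map (w K t)).prod := by
    intro l
    induction l with
    | nil => simpa using IsPolyMap.const (1 : Module.End K U)
    | cons i l ih =>
      simp only [List.map_cons, List.prod_cons, map_mul]
      exact hmul (hw i) ih
  simp only [uncoord_apply, comb, Fintype.linearCombination_apply, map_sum, map_mul, map_smul]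
  exact IsPolyMap.sum _ fun h _ => hmul (IsPolyMap.sum _ fun u _ =>
    IsPolyMap.smul (IsPolyMap.mem_const _) (hl (wordList u))) (he h)

end Polynomials

variable {K : Type*} [Field K]

/-- The multiplication of `W_λ` in coordinates. -/
def coordMul (t : Fin 3 → K) :
    (S3 → Fin 12 → K) ⊗[K] (S3 → Fin 12 → K) →ₗ[K] (S3 → Fin 12 → K) :=
  coord t ∘ₗ LinearMap.mul' K (W K t) ∘ₗ TensorProduct.map (uncoord t) (uncoord t)

theorem isPolyMap_coordMul : IsPolyMap K (coordMul (K := K)) := by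
  have b := Module.finBasis K (S3 → Fin 12 → K)
  refine IsPolyMap.of_apply_basis (b.tensorProduct b) fun ij => ?_
  have h : ∀ t, coordMul t ((b.tensorProduct b) ij) = rep t (uncoord t (b ij.1)) (b ij.2) := by
    intro t
    rw [Module.Basis.tensorProduct_apply', coordMul, LinearMap.comp_apply, LinearMap.comp_apply,
      TensorProduct.map_tmul, LinearMap.mul'_apply, coord_mul, coord_uncoord]
  simp only [h]
  have he : ∀ g, IsPolyMap K fun t : Fin 3 → K => rep t (e K t g) := fun g => by
    simpa only [rep_e] using IsPolyMap.const _
  have hw : ∀ i, IsPolyMap K fun t : Fin 3 → K => rep t (w K t i) := fun i => by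
    simpa only [rep_w] using isPolyMap_repX i
  exact (isPolyMap_uncoord rep he hw (b ij.1)).apply (IsPolyMap.const _)

/-- The coaction on `W_λ` in coordinates. -/
def coordCoaction (t : Fin 3 → K) : (S3 → Fin 12 → K) →ₗ[K] (S3 → Fin 12 → K) ⊗[K] H K :=
  (coord t).rTensor (H K) ∘ₗ (coaction K t).toLinearMap ∘ₗ uncoord t

/-- The action of `W_λ` on `W_λ ⊗ H`, by left multiplication through the coaction, with `W_λ` in
coordinates. -/
def coactionRep (t : Fin 3 → K) : W K t →ₐ[K] Module.End K ((S3 → Fin 12 → K) ⊗[K] H K) :=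
  (Module.endTensorEndAlgHom (R := K) (S := K) (A := K)).comp
    ((Algebra.TensorProduct.map (rep t) (Algebra.lmul K (H K))).comp (coaction K t))

theorem coactionRep_apply (t : Fin 3 → K) (x : W K t) :
    coactionRep t x (coordOne ⊗ₜ 1) = (coord t).rTensor (H K) (coaction K t x) := by
  simp only [coactionRep, AlgHom.comp_apply]
  generalize coaction K t x = z
  induction z using TensorProduct.induction_on with
  | zero => simp
  | add u v hu hv => simp only [map_add, LinearMap.add_apply, hu, hv]
  | tmul p q => simp [coord_apply, Module.endTensorEndAlgHom_apply]

/-- A family of linear maps is polynomial if it is given by the action on a fixed vector in a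
polynomial family of representations of the `W_λ`. -/
theorem isPolyMap_of_rep {U : Type*} [AddCommGroup U] [Module K U] [FiniteDimensional K U]
    (L : (Fin 3 → K) → (S3 → Fin 12 → K) →ₗ[K] U) (P : ∀ t : Fin 3 → K, W K t →ₐ[K] Module.End K U)
    (u : U) (hL : ∀ t c, L t c = P t (uncoord t c) u)
    (he : ∀ g, ∃ C, ∀ t, P t (e K t g) = C)
    (hw : ∀ i, ∃ (N : ((S3 → Fin 12 → K) →ₗ[K] (S3 → Fin 12 → K)) →ₗ[K] U →ₗ[K] U) (C : U →ₗ[K] U),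
      ∀ t, P t (w K t i) = N (repX t i) + C) : IsPolyMap K L := by
  have b := Module.finBasis K (S3 → Fin 12 → K)
  refine IsPolyMap.of_apply_basis b fun i => ?_
  simp only [hL]
  have he' : ∀ g, IsPolyMap K fun t : Fin 3 → K => P t (e K t g) := fun g => by
    obtain ⟨C, hC⟩ := he g
    simp only [hC]
    exact IsPolyMap.const _
  have hw' : ∀ i, IsPolyMap K fun t : Fin 3 → K => P t (w K t i) := fun i => by
    obtain ⟨N, C, hC⟩ := hw i
    simp only [hC]
    exact ((isPolyMap_repX i).linear_comp N).add (IsPolyMap.const _)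
  exact (isPolyMap_uncoord P he' hw' (b i)).apply (IsPolyMap.const _)

theorem isPolyMap_coordCoaction : IsPolyMap K (coordCoaction (K := K)) := by
  refine isPolyMap_of_rep coordCoaction coactionRep (coordOne ⊗ₜ 1)
    (fun t c => (coactionRep_apply t _).symm)
    (fun g => ⟨∑ k : S3, TensorProduct.map (repE k) (LinearMap.mulLeft K (e K 0 (k⁻¹ * g))),
      fun t => ?_⟩)
    (fun i => ⟨LinearMap.rTensorHom (H K), ∑ g : S3, sgn K g •
      TensorProduct.map (repE g) (LinearMap.mulLeft K (w K 0 (g⁻¹ i))), fun t => ?_⟩)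
  · refine TensorProduct.ext' fun x y => ?_
    simp [coactionRep, coE, Module.endTensorEndAlgHom_apply]
  · refine TensorProduct.ext' fun x y => ?_
    simp [coactionRep, coX, coQ, Module.endTensorEndAlgHom_apply]

section Contract

variable {H' V U : Type*} [AddCommGroup H'] [Module K H'] [AddCommGroup V] [Module K V]
variable [AddCommGroup U] [Module K U]

/-- The map `f ⊗ x ↦ x₀ f(x₁)` for a map `R : x ↦ x₀ ⊗ x₁`. -/
def contract (R : V →ₗ[K] V ⊗[K] H') : Module.Dual K H' ⊗[K] V →ₗ[K] V :=
  TensorProduct.lift (LinearMap.mk₂ K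
    (fun (f : Module.Dual K H') x => TensorProduct.rid K V (f.lTensor V (R x)))
    (fun f g x => by rw [LinearMap.lTensor_add, LinearMap.add_apply, map_add])
    (fun r f x => by rw [LinearMap.lTensor_smul, LinearMap.smul_apply, map_smul])
    (fun f x y => by simp only [map_add]) (fun r f x => by simp only [map_smul]))

theorem contract_tmul (R : V →ₗ[K] V ⊗[K] H') (f : Module.Dual K H') (x : V) :
    contract R (f ⊗ₜ x) = TensorProduct.rid K V (f.lTensor V (R x)) := rfl

theorem IsPolyMap.contract [FiniteDimensional K V] [FiniteDimensional K H']
    {R : U → V →ₗ[K] V ⊗[K] H'} (hR : IsPolyMap K R) : IsPolyMap K (fun u => contract (R u)) := by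
  have b := Module.finBasis K V
  have b' := Module.finBasis K (Module.Dual K H')
  refine IsPolyMap.of_apply_basis (V₁ := Module.Dual K H' ⊗[K] V) (b'.tensorProduct b)
    fun ij => ?_
  simp only [Module.Basis.tensorProduct_apply', contract_tmul]
  exact ((hR.apply (IsPolyMap.const _)).linear_comp ((b' ij.1).lTensor V)).linear_comp
    (TensorProduct.rid K V).toLinearMap

theorem IsPolyMap.galoisMap {H : Type*} [Ring H] [Bialgebra K H] [FiniteDimensional K V]
    [FiniteDimensional K H] {m : U → V ⊗[K] V →ₗ[K] V} {R : U → V →ₗ[K] V ⊗[K] H}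
    (hm : IsPolyMap K m) (hR : IsPolyMap K R) :
    IsPolyMap K (fun u => galoisMap (m u) (R u)) := by
  have h1 : IsPolyMap K (fun u => (R u).lTensor V) := hR.linear_comp (LinearMap.lTensorHom V)
  have h2 : IsPolyMap K (fun u => (m u).rTensor H) := hm.linear_comp (LinearMap.rTensorHom H)
  have h3 : IsPolyMap K (fun u => (TensorProduct.assoc K V V H).symm.toLinearMap ∘ₗ
    (R u).lTensor V) := h1.linearMap_comp (IsPolyMap.const _)
  exact h3.linearMap_comp h2

end Contract

/-- A polynomial family of triples on a space `V` of the right dimension, with isomorphisms to the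
`W_λ`. -/
theorem exists_isPolyMap_family [IsAlgClosed K] {V : Type*} [AddCommGroup V] [Module K V]
    [FiniteDimensional K V] (κ : (S3 → Fin 12 → K) ≃ₗ[K] V) :
    ∃ P : (Fin 3 → K) → Triple K V, IsPolyMap K P ∧ ∀ t, ∃ (θ : V ≃ₗ[K] W K t)
      (R : V →ₗ[K] V ⊗[K] H K), (∀ x y, θ ((P t).1 (x ⊗ₜ y)) = θ x * θ y) ∧
      (∀ x, θ.toLinearMap.rTensor (H K) (R x) = coaction K t (θ x)) ∧
      (P t).2.2 = contract R ∧ (P t).2.1 ∘ₗ galoisMap (P t).1 R = LinearMap.id ∧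
      galoisMap (P t).1 R ∘ₗ (P t).2.1 = LinearMap.id := by
  set m : (Fin 3 → K) → V ⊗[K] V →ₗ[K] V := fun t =>
    κ.toLinearMap ∘ₗ coordMul t ∘ₗ TensorProduct.map κ.symm.toLinearMap κ.symm.toLinearMap with hm
  set R : (Fin 3 → K) → V →ₗ[K] V ⊗[K] H K := fun t =>
    κ.toLinearMap.rTensor (H K) ∘ₗ coordCoaction t ∘ₗ κ.symm.toLinearMap with hR
  have hmP : IsPolyMap K m :=
    ((IsPolyMap.const _).linearMap_comp isPolyMap_coordMul).linearMap_comp (IsPolyMap.const _)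
  have hRP : IsPolyMap K R :=
    ((IsPolyMap.const _).linearMap_comp isPolyMap_coordCoaction).linearMap_comp (IsPolyMap.const _)
  set θ : ∀ t : Fin 3 → K, V ≃ₗ[K] W K t := fun t => κ.symm.trans (coordEquiv t).symm with hθ
  have hθa : ∀ t x, θ t x = uncoord t (κ.symm x) := fun t x => rfl
  have hmθ : ∀ t x y, θ t (m t (x ⊗ₜ y)) = θ t x * θ t y := by
    intro t x y
    rw [hθa, hθa, hθa, hm]
    simp only [LinearMap.comp_apply, LinearEquiv.coe_coe, LinearEquiv.symm_apply_apply,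
      TensorProduct.map_tmul, coordMul, LinearMap.mul'_apply, uncoord_coord]
  have hRθ : ∀ t x, (θ t).toLinearMap.rTensor (H K) (R t x) = coaction K t (θ t x) := by
    intro t x
    have h1 : (θ t).toLinearMap ∘ₗ κ.toLinearMap ∘ₗ coord t = LinearMap.id := by
      refine LinearMap.ext fun y => ?_
      change uncoord t (κ.symm (κ (coord t y))) = y
      rw [LinearEquiv.symm_apply_apply, uncoord_coord]
    have h2 : R t x = κ.toLinearMap.rTensor (H K)
      ((coord t).rTensor (H K) (coaction K t (θ t x))) := rfl
    rw [h2, ← LinearMap.rTensor_comp_apply, ← LinearMap.rTensor_comp_apply,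
      LinearMap.comp_assoc, h1, LinearMap.rTensor_id, LinearMap.id_apply]
  have hM : ∀ t, Function.Bijective (galoisMap (m t) (R t)) := by
    intro t
    have h1 : ∀ z, (θ t).rTensor (H K) (galoisMap (m t) (R t) z) =
        can (coaction K t) (TensorProduct.congr (θ t) (θ t) z) :=
      rTensor_galoisMap (θ := (θ t).toLinearMap) (m' := LinearMap.mul' K (W K t))
        (R' := (coaction K t).toLinearMap) (hmθ t) (hRθ t)
    have h2 : Function.Bijective fun z => (θ t).rTensor (H K) (galoisMap (m t) (R t) z) := by
      simp only [h1]
      exact (can_coaction_bijective t).comp (TensorProduct.congr (θ t) (θ t)).bijective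
    exact (Function.Bijective.of_comp_iff' ((θ t).rTensor (H K)).bijective _).1 h2
  set T : (Fin 3 → K) → V ⊗[K] H K →ₗ[K] V ⊗[K] V := fun t =>
    (LinearEquiv.ofBijective _ (hM t)).symm.toLinearMap with hT
  have hMT : ∀ t, galoisMap (m t) (R t) ∘ₗ T t = LinearMap.id := fun t =>
    LinearMap.ext fun z => (LinearEquiv.ofBijective _ (hM t)).apply_symm_apply z
  have hTM : ∀ t, T t ∘ₗ galoisMap (m t) (R t) = LinearMap.id := fun t =>
    LinearMap.ext fun z => (LinearEquiv.ofBijective _ (hM t)).symm_apply_apply z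
  have hTP : IsPolyMap K T := IsPolyMap.inverse (hmP.galoisMap hRP) hMT hTM
  exact ⟨fun t => (m t, T t, contract (R t)), hmP.prodMk (hTP.prodMk hRP.contract),
    fun t => ⟨θ t, R t, hmθ t, hRθ t, rfl, hTM t, hMT t⟩⟩

/-- There is a polynomial family of triples such that the one at `λ` presents `W_λ`. -/
theorem exists_presented_family [IsAlgClosed K] :
    ∃ P : (Fin 3 → K) → StructureSpace K (H K), IsPolyMap K P ∧
      ∀ t, ∃ α : TwoCocycle K (H K), IsDeformationBy α.1 (coaction K t) ∧ Presents (P t) α := by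
  have hfin : Module.finrank K (S3 → Fin 12 → K) = Module.finrank K (Carrier K (H K)) := by
    rw [Module.finrank_fin_fun, ← (coordEquiv (0 : Fin 3 → K)).finrank_eq]
  obtain ⟨P, hP, hPt⟩ := exists_isPolyMap_family (LinearEquiv.ofFinrankEq _ _ hfin)
  refine ⟨P, hP, fun t => ?_⟩
  obtain ⟨θ, R, hm, hR, hA, hTM, hMT⟩ := hPt t
  obtain ⟨α, hα⟩ := exists_cocycle t
  refine ⟨α, hα, ?_⟩
  obtain ⟨ψ, -, hψm, hψ⟩ := hα
  have hRφ : R = transportCoaction (ψ.trans θ.symm) := by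
    refine LinearMap.ext fun x => (θ.rTensor (H K)).injective ?_
    obtain ⟨y, rfl⟩ := (ψ.trans θ.symm).surjective x
    refine (hR _).trans ?_
    have h1 : θ ((ψ.trans θ.symm) y) = ψ y := by simp
    have h2 : θ.toLinearMap ∘ₗ (ψ.trans θ.symm).toLinearMap = ψ.toLinearMap := by ext; simp
    rw [h1, hψ, transportCoaction, LinearMap.comp_apply, LinearMap.comp_apply, LinearEquiv.coe_coe,
      LinearEquiv.symm_apply_apply, ← h2, LinearMap.rTensor_comp_apply]
    rfl
  refine ⟨ψ.trans θ.symm, fun x y => θ.injective ?_, fun f x => ?_, ?_, ?_⟩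
  · rw [hm]
    simp [hψm]
  · rw [hA, contract_tmul, hRφ]
  · rw [← hRφ, hTM]
  · rw [← hRφ, hMT]

/-- A regular function on the set of classes, restricted to a polynomial family of triples that runs
through all `W_λ`, is a polynomial function of `λ`. -/
theorem exists_eq_of_isRegular [IsAlgClosed K] {f : Moduli K (H K) → K}
    (hf : Moduli.IsRegular f) : ∃ g ∈ polyFun K (Fin 3 → K), ∀ t, ∃ α : TwoCocycle K (H K),
      IsDeformationBy α.1 (coaction K t) ∧ f ⟦α⟧ = g t := by
  obtain ⟨F, hF, hFf⟩ := hf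
  obtain ⟨P, hP, hPα⟩ := exists_presented_family (K := K)
  refine ⟨fun t => F (P t), IsPolyMap.comp hF hP, fun t => ?_⟩
  obtain ⟨α, hα, hPr⟩ := hPα t
  exact ⟨α, hα, (hFf _ _ hPr).symm⟩

end Family

end

end FK

theorem mainTheorem5 (K : Type*) [Field K] [IsAlgClosed K] [CharZero K] :
    (∀ (W : Type*) [Ring W] [Algebra K W] (ρ : W →ₐ[K] W ⊗[K] FK.H K),
      FK.IsCocycleDeformation ρ → ∃ t : Fin 3 → K, FK.ComodAlgIso (FK.coaction K t) ρ) ∧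
    (∀ t : Fin 3 → K, FK.IsCocycleDeformation (FK.coaction K t)) ∧
    (∀ s t : Fin 3 → K, FK.ComodAlgIso (FK.coaction K s) (FK.coaction K t) ↔
      ∃ σ : Equiv.Perm (Fin 3), t = s ∘ σ) ∧
    ∃ (Φ : FK.Moduli K (FK.H K) ≃ FK.A3S3 K) (Θ : FK.A3S3 K ≃ (Fin 3 → K)),
      (∀ (α : FK.TwoCocycle K (FK.H K)) (t : Fin 3 → K),
        FK.IsDeformationBy α.1 (FK.coaction K t) → Φ ⟦α⟧ = ⟦t⟧) ∧
      (∀ t : Fin 3 → K, Θ ⟦t⟧ = FK.esymm3 t) ∧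
      (∀ f : FK.A3S3 K → K, FK.A3S3.IsRegular f ↔ FK.Moduli.IsRegular fun c => f (Φ c)) ∧
      (∀ F : (Fin 3 → K) → K, F ∈ FK.polyFun K (Fin 3 → K) ↔
        FK.A3S3.IsRegular fun c => F (Θ c)) := by
  obtain ⟨Φ, hΦ⟩ := FK.exists_moduli_equiv (K := K)
  obtain ⟨Θ, hΘ⟩ := FK.exists_esymm3_equiv (K := K)
  refine ⟨fun W _ _ ρ h => FK.exists_comodAlgIso_of_isCocycleDeformation h,
    FK.isCocycleDeformation_coaction, FK.comodAlgIso_iff, Φ, Θ, hΦ, hΘ, fun f => ⟨fun hf => ?_,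
    fun hf => ?_⟩, fun F => ?_⟩
  · obtain ⟨F, hF, hFp⟩ := FK.exists_polyFun_presents hf
      fun t k => congrArg f (Quotient.sound ⟨k⁻¹, by funext i; simp⟩)
    refine ⟨F, hF, fun p α hp => ?_⟩
    obtain ⟨t, ht⟩ := FK.exists_parameter α
    rw [hFp p α t hp ht, ← hΦ α t ht]
  · obtain ⟨g, hg, hgf⟩ := FK.exists_eq_of_isRegular hf
    have h : (fun t : Fin 3 → K => f ⟦t⟧) = g := by
      funext t
      obtain ⟨α, hα, h⟩ := hgf t
      rw [← h, hΦ α t hα]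
    rw [FK.A3S3.IsRegular, h]
    exact hg
  · simp only [FK.A3S3.IsRegular, hΘ]
    exact ⟨FK.comp_esymm3_mem_polyFun, FK.mem_polyFun_of_comp_esymm3⟩
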